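/- **Setting.** Let $n\ge 1$ and $k=\lceil\log_2(n+1)\rceil$. A $K$-multilinear map generator $\mathcal G$ outputs, on a security parameter $\lambda$, a random instance $\Gamma=(N,G_1,\dots,G_K,e,g_1,\dots,g_K)$: cyclic groups $G_i=\langle g_i\rangle$ of order $N=pq$ with $p,q$ $\lambda$-bit primes, and maps $e:G_i\times G_j\to G_{i+j}$ ($i+j\le K$) with $e(g_i^a,g_j^b)=g_{i+j}^{ab}$. The description of $\Gamma$ reveals $N$ but not $p,q$; group elements are encoded injectively by strings of length polynomial in $\lambda$, and multiplication and $e$ are computable in polynomial time. Algorithms may draw uniform elements of $\{0,\dots,a-1\}$. A function of $\lambda$ is negligible if it is eventually smaller than every $\lambda^{-c}$. *SDA*: for every $i\in\{1,\dots,K\}$ and every probabilistic polynomial-time (PPT) $\mathcal A$, $|\Pr[\mathcal A(1^\lambda,\Gamma,u)=1]-\Pr[\mathcal A(1^\lambda,\Gamma,u^q)=1]|$ is negligible, for random $\Gamma$ and uniform $u\in G_i$. *$(K,n)$-MSDHS*: for every PPT $\mathcal A$, $\Pr[\mathcal A(1^\lambda,p,q,\Gamma,g_1,g_1^{s},\dots,g_1^{s^n})=g_K^{p/s}]$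 is negligible, for random $\Gamma$ and uniform $s\in\mathbb Z_N$ (success requires $s\in\mathbb Z_N^*$). For each $\lambda$ let there be given a polynomial $f=f_0+\dots+f_nx^n$ of degree at most $n$ with coefficients in $\mathbb N$ (read modulo $q$), a finite input domain $\mathbb D\subset\mathbb N$ and a finite result domain $\mathbb M\subset\mathbb N$ (read modulo $q$), all computable from $1^\lambda$ in time polynomial in $\lambda$ (so $|\mathbb D|,|\mathbb M|$ are polynomial in $\lambda$); assume that $f(\alpha)\bmod q$ lies in $\mathbb M$ modulo $q$ for all $\alpha\in\mathbb D$ and all instances that can occur. **The scheme $\Pi_{\rm pe}$**, over $\Gamma\leftarrow\mathcal G$ with $K=2k+1$. The client holds both keys. * KeyGen: draw $\Gamma$, $s\leftarrow\mathbb Z_N$, $u\leftarrow G_1$; put $t=g_1^{f(s)}$, $h=u^q$; $sk=(p,q,s,t)$, $pk=(\Gamma,g_1,h;g_1^{s},g_1^{s^2},\dots,g_1^{s^{2^{k-1}}};f)$. * ProbGen on $\alpha\in\mathbb D$: draw $r_\ell\leftarrow\mathbb Z_N$ and output $\sigma=(\sigma_1,\dots,\sigma_k)$, $\sigma_\ell=g_1^{\alpha^{2^{\ell-1}}}h^{r_\ell}$,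 and the verification key $\tau=\alpha$ (kept by the client). * Compute: with $e_k:G_1^k\to G_k$ the iterated map, let $\rho_i=e_k(\phi_1,\dots,\phi_k)\in G_k$, where $\phi_\ell=\sigma_\ell$ if the $\ell$-th binary digit of $i$ is $1$ and $\phi_\ell=g_1$ otherwise, and let $\xi_i\in G_k$ be formed in the same way from the $g_1^{s^{2^{\ell-1}}}$. Output $\rho=\prod_{i=0}^n\rho_i^{f_i}\in G_k$ and $\pi=\prod_{i=0}^{n-1}\prod_{j=0}^{i}e(\rho_j,\xi_{i-j})^{f_{i+1}}\in G_{2k}$. * Verify: search $\mathbb M$ for $y$ with $\rho^p=(g_k^p)^y$. If there is such a $y$ and $e(t/g_1^{y},g_{2k}^{p})=e(g_1^{s}/g_1^{\alpha},\pi^{p})$, output $y\bmod q$; otherwise output $\perp$. (Strings that do not encode group elements are rejected.) **Theorem.** If $(2k+1,n)$-MSDHS and SDA hold for $\mathcal G$, then $\Pi_{\rm pe}$ is 1. *correct*: for all keys, inputs $\alpha\in\mathbb D$ and coins, Verify outputs $f(\alpha)\bmod q$ when the server is honest; 2. *secure*: a PPT adversary receives $pk$, adaptively obtains the encodings $\sigma$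 of polynomially many inputs of its choice, then chooses $\hat\alpha\in\mathbb D$, receives its encoding, and answers $(\bar\rho,\bar\pi)$; the probability that Verify outputs a value $\bar y\notin\{f(\hat\alpha)\bmod q,\perp\}$ is negligible; 3. *input private*: a PPT adversary receives $pk$, chooses $\alpha_0,\alpha_1\in\mathbb D$, receives the encoding $\sigma$ of $\alpha_b$ for a uniform bit $b$, and outputs a bit $b'$; before and after the challenge it may adaptively obtain encodings of polynomially many inputs. Then $\Pr[b'=b]\le\frac12+\varepsilon(\lambda)$ with $\varepsilon$ negligible. Moreover, count as one operation each multiplication, division, exponentiation, evaluation of $e$ or comparison of group elements, each arithmetic operation on residues and each random choice. Then ProbGen and Verify together take at most $C(\log_2(n+1)+|\mathbb M|)$ operations for an absolute constant $C$, whatever the server answers; that is, $O(\log n)$ for result domains of bounded size. Hence $\Pi_{\rm pe}$ is *outsourced*: for every $\varepsilon>0$ and $B$ there is $n_0$ such that, for all $n\ge n_0$, if $\deg f=n$ and $|\mathbb M|\le B$, the client takes at most $\varepsilon T$ operations, where $T=2n$ is the number of operations of evaluating $f(\alpha)$ directly by Horner's rule. -/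

import Mathlib

open Polynomial

noncomputable section

/-! ## Probabilistic algorithms with a step count -/

/-- Data handled by algorithms: binary trees whose leaves are natural numbers (bit strings). -/
inductive Val : Type
  | num : ℕ → Val
  | pair : Val → Val → Val

namespace Val

/-- Bit size of a datum. -/
def size : Val → ℕ
  | num n => Nat.size n + 1
  | pair a b => a.size + b.size + 1

def fst : Val → Val
  | num _ => num 0
  | pair a _ => a

def snd : Val → Val
  | num _ => num 0
  | pair _ b => b

def isPair : Val → ℕ
  | num _ => 0
  | pair _ _ => 1

/-- A finite sequence as a datum. -/
def list (l : List Val) : Val := l.foldr pair (num 0)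

/-- The string `1^lam`. -/
def unary (lam : ℕ) : Val := list (List.replicate lam (num 0))

end Val

/-- Arithmetic on natural numbers (subtraction is truncated; division and remainder by `0`
return `0` and the dividend). -/
inductive ArithOp : Type
  | add | sub | mul | div | mod

def ArithOp.apply : ArithOp → ℕ → ℕ → ℕ
  | add, a, b => a + b
  | sub, a, b => a - b
  | mul, a, b => a * b
  | div, a, b => a / b
  | mod, a, b => a % b

def ArithOp.applyVal (o : ArithOp) : Val → Val
  | .pair (.num a) (.num b) => .num (o.apply a b)
  | _ => .num 0

/-- Programs of a probabilistic first-order language. A program maps a datum to a datum; it may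
measure the size of its input, do arithmetic, branch, draw uniform numbers and run counted loops.
Every clocked computation (a machine run for a computed number of steps) is a counted loop, so
that the programs of polynomially bounded cost are exactly the polynomial-time algorithms. -/
inductive Code : Type
  | id
  | const (v : Val)
  | fst
  | snd
  | isPair
  | size
  | arith (o : ArithOp)
  /-- on input `a`, a uniformly random element of `{0, …, a - 1}` (and `0` if `a = 0`) -/
  | rand
  /-- run both programs on the input and pair the results -/
  | pair (f g : Code)
  /-- run `g`, then run `f` on its result -/
  | comp (f g : Code)
  /-- run `f` on the input if `c` does not output `0` on it, and `g` otherwise -/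
  | ite (c f g : Code)
  /-- on input `(m, x)`, apply `f` to `x` successively `m` times -/
  | iter (f : Code)

namespace Code

/-- The result of a deterministic basic instruction: it costs the bits read plus the bits
written. -/
def basic (v w : Val) : PMF (Val × ℕ) := PMF.pure (w, v.size + w.size)

/-- `m` successive runs of `step`, with accumulated cost. -/
def loop (step : Val → PMF (Val × ℕ)) : ℕ → Val → PMF (Val × ℕ)
  | 0, x => PMF.pure (x, 0)
  | m + 1, x => (step x).bind fun a => (loop step m a.1).map fun b => (b.1, a.2 + b.2)

/-- The joint distribution of the output and the number of (bit) steps of a run. -/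
def eval : Code → Val → PMF (Val × ℕ)
  | id, v => basic v v
  | const w, v => basic v w
  | fst, v => basic v v.fst
  | snd, v => basic v v.snd
  | isPair, v => basic v (.num v.isPair)
  | size, v => basic v (.num v.size)
  | arith o, v => basic v (o.applyVal v)
  | rand, .num (a + 1) =>
      (PMF.uniformOfFintype (Fin (a + 1))).bind fun i => basic (.num (a + 1)) (.num i)
  | rand, v => basic v (.num 0)
  | pair f g, v =>
      (eval f v).bind fun a => (eval g v).map fun b =>
        (.pair a.1 b.1, v.size + a.2 + b.2)
  | comp f g, v =>
      (eval g v).bind fun a => (eval f a.1).map fun b => (b.1, a.2 + b.2)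
  | ite c f g, v =>
      (eval c v).bind fun a =>
        match a.1 with
        | .num 0 => (eval g v).map fun b => (b.1, v.size + a.2 + b.2)
        | _ => (eval f v).map fun b => (b.1, v.size + a.2 + b.2)
  | iter f, .pair (.num m) x =>
      (loop (eval f) m x).map fun b => (b.1, (Val.pair (.num m) x).size + b.2)
  | iter _, v => basic v (.num 0)

/-- The output distribution of a program. -/
def output (c : Code) (v : Val) : PMF Val := (c.eval v).map Prod.fst

/-- Probabilistic polynomial time: on every input and for all coins, the number of steps is
bounded by a fixed polynomial in the size of the input. -/
def PPT (c : Code) : Prop :=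
  ∃ P : ℕ[X], ∀ v, ∀ o ∈ (c.eval v).support, o.2 ≤ P.eval v.size

end Code

/-- Negligible functions of the security parameter. -/
def Negligible (f : ℕ → ℝ) : Prop :=
  Asymptotics.SuperpolynomialDecay Filter.atTop (fun lam : ℕ => (lam : ℝ)) f

/-- Probability that a random bit equals `1`. -/
def prTrue (m : PMF Bool) : ℝ := (m true).toReal

/-! ## Multilinear maps -/

/-- A `K`-multilinear map instance `(N, G_1, …, G_K, e, g_1, …, g_K)`, `N = pq`, together with the
string `desc` describing it and the encodings of group elements by bit strings (natural numbers).
Only the levels `1, …, K` are meaningful; nothing is asked of the other ones. -/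
structure MultilinearInstance (K : ℕ) where
  p : ℕ
  q : ℕ
  p_prime : p.Prime
  q_prime : q.Prime
  G : ℕ → Type
  [group : ∀ i, CommGroup (G i)]
  [fintype : ∀ i, Fintype (G i)]
  g : ∀ i, G i
  card_eq : ∀ i, 1 ≤ i → i ≤ K → Fintype.card (G i) = p * q
  generates : ∀ i, 1 ≤ i → i ≤ K → ∀ x : G i, x ∈ Subgroup.zpowers (g i)
  e : ∀ {i j : ℕ}, G i → G j → G (i + j)
  e_pow : ∀ i j, 1 ≤ i → 1 ≤ j → i + j ≤ K → ∀ a b : ℕ,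
    e (g i ^ a) (g j ^ b) = g (i + j) ^ (a * b)
  enc : ∀ i, G i → ℕ
  enc_injective : ∀ i, 1 ≤ i → i ≤ K → Function.Injective (enc i)
  desc : Val

attribute [instance] MultilinearInstance.group MultilinearInstance.fintype

namespace MultilinearInstance

variable {K : ℕ} (Γ : MultilinearInstance K)

/-- The group order. -/
def N : ℕ := Γ.p * Γ.q

instance : NeZero Γ.N := ⟨Nat.mul_ne_zero Γ.p_prime.ne_zero Γ.q_prime.ne_zero⟩

/-- `g_i^a` for an exponent `a` modulo `N`. -/
def gpow (i : ℕ) (a : ZMod Γ.N) : Γ.G i := Γ.g i ^ a.val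

/-- The string given to an algorithm that receives the element `x` of `G_i`. -/
def elt {i : ℕ} (x : Γ.G i) : Val := .num (Γ.enc i x)

/-- The string given to an algorithm that receives `Γ`. The primes `p, q` are not part of it. -/
def toVal : Val :=
  Val.list [.num Γ.N, Γ.desc, Val.list ((List.range K).map fun i => Γ.elt (Γ.g (i + 1)))]

open Classical in
/-- Parse a received string as an element of `G_i`. -/
def parse (i : ℕ) (v : Val) : Option (Γ.G i) :=
  if h : ∃ x : Γ.G i, v = Γ.elt x then some h.choose else none

/-- The map `e_m : G_1 × ⋯ × G_1 → G_m`, on `φ 0, …, φ (m - 1)`. -/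
def multiPair : (m : ℕ) → (ℕ → Γ.G 1) → Γ.G m
  | 0, _ => 1
  | 1, φ => φ 0
  | m + 2, φ => Γ.e (i := m + 1) (j := 1) (multiPair (m + 1) φ) (φ (m + 1))

end MultilinearInstance

/-- A generator `𝒢(1^lam, K)` of `K`-multilinear map instances. The possible outcomes are indexed
by `Idx`. Descriptions and encodings have polynomial length, and multiplication and the maps `e`
are computable in polynomial time from the description. (There are no `lam`-bit primes for
`lam < 2`.) -/
structure MultilinearGenerator (K : ℕ) where
  Idx : Type
  inst : Idx → MultilinearInstance K
  sample : ℕ → PMF Idx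
  size_p : ∀ lam, 2 ≤ lam → ∀ w ∈ (sample lam).support, Nat.size (inst w).p = lam
  size_q : ∀ lam, 2 ≤ lam → ∀ w ∈ (sample lam).support, Nat.size (inst w).q = lam
  bound : ℕ[X]
  desc_size : ∀ lam, ∀ w ∈ (sample lam).support, (inst w).desc.size ≤ bound.eval lam
  enc_size : ∀ lam, ∀ w ∈ (sample lam).support, ∀ i, 1 ≤ i → i ≤ K →
    ∀ x : (inst w).G i, ((inst w).elt x).size ≤ bound.eval lam
  mulCode : Code
  mulCode_ppt : mulCode.PPT
  mulCode_spec : ∀ lam, ∀ w ∈ (sample lam).support, ∀ i, 1 ≤ i → i ≤ K →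
    ∀ x y : (inst w).G i,
      mulCode.output (Val.list [(inst w).toVal, .num i, (inst w).elt x, (inst w).elt y]) =
        PMF.pure ((inst w).elt (x * y))
  pairCode : Code
  pairCode_ppt : pairCode.PPT
  pairCode_spec : ∀ lam, ∀ w ∈ (sample lam).support, ∀ i j, 1 ≤ i → 1 ≤ j → i + j ≤ K →
    ∀ (x : (inst w).G i) (y : (inst w).G j),
      pairCode.output
        (Val.list [(inst w).toVal, .num i, .num j, (inst w).elt x, (inst w).elt y]) =
        PMF.pure ((inst w).elt ((inst w).e x y))

/-! ## The two assumptions -/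

section Assumptions

variable {K : ℕ} (𝒢 : MultilinearGenerator K)

/-- The output of `c` on `(Γ, u)` (if `inSub` is false) or `(Γ, u^q)` (if `inSub` is true), for
random `Γ` and `u ∈ G_i`. -/
def sdaGame (i : ℕ) (c : Code) (inSub : Bool) (lam : ℕ) : PMF Val := do
  let w ← 𝒢.sample lam
  let u ← PMF.uniformOfFintype ((𝒢.inst w).G i)
  let x := if inSub then u ^ (𝒢.inst w).q else u
  c.output (Val.list [Val.unary lam, (𝒢.inst w).toVal, (𝒢.inst w).elt x])

/-- The subgroup decision assumption, at every level `i ∈ {1, …, K}`. -/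
def SDA : Prop :=
  ∀ i, 1 ≤ i → i ≤ K → ∀ c : Code, c.PPT →
    Negligible fun lam =>
      |(sdaGame 𝒢 i c false lam (.num 1)).toReal - (sdaGame 𝒢 i c true lam (.num 1)).toReal|

open Classical in
/-- `c` receives `p, q, Γ, g_1, g_1^s, …, g_1^(s^n)` and has to output `g_K^(p/s)`. -/
def msdhsGame (n : ℕ) (c : Code) (lam : ℕ) : PMF Bool := do
  let w ← 𝒢.sample lam
  let Γ := 𝒢.inst w
  let s ← PMF.uniformOfFintype (ZMod Γ.N)
  let o ← c.output (Val.list [Val.unary lam, .num Γ.p, .num Γ.q, Γ.toVal,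
    Val.list ((List.range (n + 1)).map fun i => Γ.elt (Γ.gpow 1 (s ^ i)))])
  PMF.pure (decide (IsUnit s ∧ o = Γ.elt (Γ.gpow K (Γ.p * s⁻¹))))

/-- The `(K, n)`-MSDHS assumption. -/
def MSDHS (n : ℕ) : Prop :=
  ∀ c : Code, c.PPT → Negligible fun lam => prTrue (msdhsGame 𝒢 n c lam)

end Assumptions

/-! ## Counting the operations of the client -/

/-- A value together with the number of elementary operations spent on computing it. -/
structure Counted (α : Type) where
  val : α
  ops : ℕ

namespace Counted

instance : Monad Counted where
  pure a := ⟨a, 0⟩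
  bind x f := ⟨(f x.val).val, x.ops + (f x.val).ops⟩

/-- One elementary operation with result `a`. -/
def op {α : Type} (a : α) : Counted α := ⟨a, 1⟩

end Counted

/-! ## Verifiable computation -/

/-- A verifiable computation scheme for the function `func` on the inputs `dom`, with the strings
through which the server sees its messages. The client holds both keys. -/
structure VCScheme where
  PK : Type
  SK : PK → Type
  /-- encoded inputs `σ` -/
  Query : PK → Type
  /-- verification keys `τ` -/
  Tau : PK → Type
  /-- encoded outputs `ρ` -/
  Rho : PK → Type
  /-- proofs `π` -/
  Prf : PK → Type
  Out : PK → Type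
  dom : ℕ → List ℕ
  func : (pk : PK) → ℕ → Out pk
  keyGen : ℕ → PMF (Σ pk : PK, SK pk)
  probGen : (pk : PK) → SK pk → ℕ → PMF (Counted (Query pk × Tau pk))
  compute : (pk : PK) → Query pk → Rho pk × Prf pk
  verify : (pk : PK) → SK pk → Tau pk → Rho pk → Prf pk → Counted (Option (Out pk))
  pkVal : PK → Val
  queryVal : (pk : PK) → Query pk → Val
  parseRho : (pk : PK) → Val → Option (Rho pk)
  parsePrf : (pk : PK) → Val → Option (Prf pk)

/-- An adversary in the verification experiment. `setup` receives the public key and produces a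
state (which may contain the public key and all coins needed later); the other programs receive
the state and the list of all queries and answers so far. -/
structure VerAdversary where
  setup : Code
  query : Code
  challenge : Code
  forge : Code
  setup_ppt : setup.PPT
  query_ppt : query.PPT
  challenge_ppt : challenge.PPT
  forge_ppt : forge.PPT
  /-- the number of queries -/
  rounds : ℕ[X]

/-- An adversary in the privacy experiment; `query` and `query'` make its oracle queries before
and after it receives the encoding of the challenge. -/
structure PriAdversary where
  setup : Code
  query : Code
  challenge : Code
  query' : Code
  guess : Code
  setup_ppt : setup.PPT
  query_ppt : query.PPT
  challenge_ppt : challenge.PPT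
  query'_ppt : query'.PPT
  guess_ppt : guess.PPT
  /-- the number of queries in each of the two phases -/
  rounds : ℕ[X]

namespace VCScheme

variable (S : VCScheme)

/-- Parse an output of the adversary as an input from the domain. -/
def readInput (lam : ℕ) : Val → Option ℕ
  | .num a => if a ∈ S.dom lam then some a else none
  | .pair _ _ => none

/-- `m` adaptive queries to the input encoding algorithm (of which the adversary sees `σ` only).
Queries outside the domain are refused. -/
def queries (lam : ℕ) (pk : S.PK) (sk : S.SK pk) (query : Code) (st : Val) : ℕ → Val → PMF Val
  | 0, tr => PMF.pure tr
  | m + 1, tr => do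
      let v ← query.output (.pair st tr)
      match S.readInput lam v with
      | none => queries lam pk sk query st m (.pair (.num 0) tr)
      | some x => do
          let c ← S.probGen pk sk x
          queries lam pk sk query st m
            (.pair (.pair (.num x) (S.queryVal pk c.val.1)) tr)

open Classical in
/-- The verification experiment; it returns `true` iff the client accepts a wrong value. -/
def verExp (A : VerAdversary) (lam : ℕ) : PMF Bool := do
  let ⟨pk, sk⟩ ← S.keyGen lam
  let st ← A.setup.output (S.pkVal pk)
  let tr ← S.queries lam pk sk A.query st (A.rounds.eval lam) (.num 0)
  let v ← A.challenge.output (.pair st tr)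
  match S.readInput lam v with
  | none => PMF.pure false
  | some x => do
      let c ← S.probGen pk sk x
      let o ← A.forge.output
        (.pair st (.pair (.pair (.num x) (S.queryVal pk c.val.1)) tr))
      match S.parseRho pk o.fst, S.parsePrf pk o.snd with
      | some ρ, some π =>
          match (S.verify pk sk c.val.2 ρ π).val with
          | none => PMF.pure false
          | some y => PMF.pure (decide (y ≠ S.func pk x))
      | _, _ => PMF.pure false

open Classical in
/-- The privacy experiment; it returns `true` iff the adversary guesses which of its two inputs
has been encoded. -/
def priExp (A : PriAdversary) (lam : ℕ) : PMF Bool := do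
  let ⟨pk, sk⟩ ← S.keyGen lam
  let st ← A.setup.output (S.pkVal pk)
  let tr ← S.queries lam pk sk A.query st (A.rounds.eval lam) (.num 0)
  let v ← A.challenge.output (.pair st tr)
  match S.readInput lam v.fst, S.readInput lam v.snd with
  | some x₀, some x₁ => do
      let b ← PMF.uniformOfFintype Bool
      let c ← S.probGen pk sk (if b then x₁ else x₀)
      let tr' ← S.queries lam pk sk A.query' st (A.rounds.eval lam)
        (.pair (.pair (.num x₀) (.pair (.num x₁) (S.queryVal pk c.val.1))) tr)
      let b' ← A.guess.output (.pair st tr')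
      PMF.pure (decide (b' = .num (if b then 1 else 0)))
  | _, _ => PMF.pure false

/-- An honest server always makes the client output the value of the function. -/
def Correct : Prop :=
  ∀ lam, ∀ key ∈ (S.keyGen lam).support, ∀ x ∈ S.dom lam,
    ∀ c ∈ (S.probGen key.1 key.2 x).support,
      (S.verify key.1 key.2 c.val.2 (S.compute key.1 c.val.1).1
        (S.compute key.1 c.val.1).2).val = some (S.func key.1 x)

/-- No polynomial-time server makes the client accept a wrong value, except with negligible
probability. -/
def Secure : Prop :=
  ∀ A : VerAdversary, Negligible fun lam => prTrue (S.verExp A lam)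

/-- No polynomial-time server distinguishes between two inputs with more than negligible
advantage. -/
def InputPrivate : Prop :=
  ∀ A : PriAdversary, ∃ ε : ℕ → ℝ, Negligible ε ∧ ∀ lam, prTrue (S.priExp A lam) ≤ 1 / 2 + ε lam

/-- `T` bounds the number of operations of the client (encoding an input, then verifying any
answer of the server). -/
def ClientOpsAtMost (lam : ℕ) (T : ℝ) : Prop :=
  ∀ key ∈ (S.keyGen lam).support, ∀ x ∈ S.dom lam,
    ∀ c ∈ (S.probGen key.1 key.2 x).support, ∀ ρ π,
      ((c.ops + (S.verify key.1 key.2 c.val.2 ρ π).ops : ℕ) : ℝ) ≤ T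

end VCScheme

/-! ## The scheme for polynomial evaluation -/

/-- The public data of the outsourced task for each security parameter: a polynomial of degree at
most `n`, the domain of inputs and the domain of possible results. Residues modulo `q` are
represented by natural numbers, since `q` is chosen later and is secret. All the data are
computable in time polynomial in `lam`; in particular the domains have polynomial size. -/
structure PolyFamily (n : ℕ) where
  poly : ℕ → ℕ[X]
  degree_le : ∀ lam, (poly lam).natDegree ≤ n
  dom : ℕ → List ℕ
  msg : ℕ → List ℕ
  gen : Code
  gen_ppt : gen.PPT
  gen_spec : ∀ lam, gen.output (Val.unary lam) = PMF.pure (Val.list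
    [Val.list ((List.range (n + 1)).map fun i => .num ((poly lam).coeff i)),
      Val.list ((dom lam).map .num), Val.list ((msg lam).map .num)])

/-- `f(a)` modulo `m`. -/
def evalMod (f : ℕ[X]) (m : ℕ) (a : ZMod m) : ZMod m := f.eval₂ (Nat.castRingHom (ZMod m)) a

/-- `k = ⌈log₂ (n + 1)⌉`. -/
def logDeg (n : ℕ) : ℕ := Nat.clog 2 (n + 1)

/-- All the results `f(α)`, `α` in the domain, lie (modulo `q`) in the domain of results. -/
def PolyFamily.Admissible {n K : ℕ} (F : PolyFamily n) (𝒢 : MultilinearGenerator K) : Prop :=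
  ∀ lam, ∀ w ∈ (𝒢.sample lam).support, ∀ a ∈ F.dom lam, ∃ m ∈ F.msg lam,
    (m : ZMod (𝒢.inst w).q) = evalMod (F.poly lam) (𝒢.inst w).q a

/-- Horner's rule for `f(a)` modulo `m`, over the `d` coefficients below the current one. -/
def hornerLoop (f : ℕ[X]) (m : ℕ) (a : ZMod m) : ℕ → ZMod m → Counted (ZMod m)
  | 0, acc => pure acc
  | d + 1, acc => do
      let b ← Counted.op (acc * a)
      let c ← Counted.op (b + (f.coeff d : ZMod m))
      hornerLoop f m a d c

/-- Direct evaluation of `f(a)` modulo `m`. -/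
def horner (f : ℕ[X]) (m : ℕ) (a : ZMod m) : Counted (ZMod m) :=
  hornerLoop f m a f.natDegree (f.coeff f.natDegree : ZMod m)

namespace PE

open Counted

variable {K : ℕ}

/-- `(Γ, g_1, h; g_1^s, g_1^(s^2), …, g_1^(s^(2^(k-1))); f)`, with `f` the polynomial of index
`lam` and `Γ` the instance of index `idx`. -/
structure PublicKey (𝒢 : MultilinearGenerator K) where
  lam : ℕ
  idx : 𝒢.Idx
  h : (𝒢.inst idx).G 1
  xi : List ((𝒢.inst idx).G 1)

abbrev PublicKey.inst {𝒢 : MultilinearGenerator K} (pk : PublicKey 𝒢) : MultilinearInstance K :=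
  𝒢.inst pk.idx

/-- `(p, q, s, t)`; the primes are those of the instance. -/
structure SecretKey {𝒢 : MultilinearGenerator K} (pk : PublicKey 𝒢) where
  s : ZMod pk.inst.N
  t : pk.inst.G 1

/-- Encrypt `a, a^2, a^4, …` with the given coins. -/
def encryptPowers (Γ : MultilinearInstance K) (h : Γ.G 1) :
    ZMod Γ.N → List (ZMod Γ.N) → Counted (List (Γ.G 1))
  | _, [] => pure []
  | a, r :: rs => do
      let r ← op r
      let x ← op (Γ.gpow 1 a)
      let y ← op (h ^ r.val)
      let c ← op (x * y)
      let a' ← op (a * a)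
      let cs ← encryptPowers Γ h a' rs
      pure (c :: cs)

open Classical in
/-- Find `m` in the given list with `b^m = a`. -/
def findLog {G : Type} [Group G] (a b : G) : List ℕ → Counted (Option ℕ)
  | [] => pure none
  | m :: ms => do
      let c ← op (b ^ m)
      let ok ← op (decide (c = a))
      if ok then pure (some m) else findLog a b ms

/-- `e_k(φ_1, …, φ_k)`, where `φ_ℓ` is the `ℓ`-th entry of the list if the `ℓ`-th binary digit of
`i` is `1`, and `g_1` otherwise. -/
def monomial (Γ : MultilinearInstance K) (k : ℕ) (l : List (Γ.G 1)) (i : ℕ) : Γ.G k :=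
  Γ.multiPair k fun ℓ => if i.testBit ℓ then l.getD ℓ 1 else Γ.g 1

open Classical in
/-- Decrypt `ρ` by searching the list `M`, then check the proof. -/
def verifyAlg (Γ : MultilinearInstance K) (k : ℕ) (M : List ℕ) (s : ZMod Γ.N) (t : Γ.G 1)
    (α : ℕ) (ρ : Γ.G k) (π : Γ.G (k + k)) : Counted (Option (ZMod Γ.q)) := do
  let ρp ← op (ρ ^ Γ.p)
  let gp ← op (Γ.g k ^ Γ.p)
  match ← findLog ρp gp M with
  | none => pure none
  | some y => do
      let gy ← op (Γ.g 1 ^ y)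
      let tg ← op (t / gy)
      let g2p ← op (Γ.g (k + k) ^ Γ.p)
      let lhs ← op (Γ.e tg g2p)
      let gs ← op (Γ.gpow 1 s)
      let ga ← op (Γ.g 1 ^ α)
      let gd ← op (gs / ga)
      let πp ← op (π ^ Γ.p)
      let rhs ← op (Γ.e gd πp)
      let ok ← op (decide (lhs = rhs))
      pure (if ok then some (y : ZMod Γ.q) else none)

open Finset in
/-- The verifiable computation scheme for evaluating a polynomial of degree at most `n`, over
multilinear map instances of `2k + 1` levels. The verification key is the input itself. -/
def scheme (n : ℕ) (𝒢 : MultilinearGenerator (2 * logDeg n + 1)) (F : PolyFamily n) :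
    VCScheme where
  PK := PublicKey 𝒢
  SK := SecretKey
  Query pk := List (pk.inst.G 1)
  Tau _ := ℕ
  Rho pk := pk.inst.G (logDeg n)
  Prf pk := pk.inst.G (logDeg n + logDeg n)
  Out pk := ZMod pk.inst.q
  dom := F.dom
  func pk α := evalMod (F.poly pk.lam) pk.inst.q α
  keyGen lam := do
    let w ← 𝒢.sample lam
    let Γ := 𝒢.inst w
    let s ← PMF.uniformOfFintype (ZMod Γ.N)
    let u ← PMF.uniformOfFintype (Γ.G 1)
    PMF.pure ⟨⟨lam, w, u ^ Γ.q, (List.range (logDeg n)).map fun ℓ => Γ.gpow 1 (s ^ 2 ^ ℓ)⟩,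
      ⟨s, Γ.gpow 1 (evalMod (F.poly lam) Γ.N s)⟩⟩
  probGen pk _ α := do
    let r ← PMF.uniformOfFintype (Fin (logDeg n) → ZMod pk.inst.N)
    PMF.pure (do
      let σ ← encryptPowers pk.inst pk.h α (List.ofFn r)
      pure (σ, α))
  compute pk σ :=
    (∏ i ∈ range (n + 1), monomial pk.inst (logDeg n) σ i ^ (F.poly pk.lam).coeff i,
      ∏ i ∈ range n, ∏ j ∈ range (i + 1),
        pk.inst.e (monomial pk.inst (logDeg n) σ j) (monomial pk.inst (logDeg n) pk.xi (i - j)) ^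
          (F.poly pk.lam).coeff (i + 1))
  verify pk sk α ρ π := verifyAlg pk.inst (logDeg n) (F.msg pk.lam) sk.s sk.t α ρ π
  pkVal pk := Val.list [Val.unary pk.lam, pk.inst.toVal, pk.inst.elt pk.h,
    Val.list (pk.xi.map pk.inst.elt),
    Val.list ((List.range (n + 1)).map fun i => .num ((F.poly pk.lam).coeff i))]
  queryVal pk σ := Val.list (σ.map pk.inst.elt)
  parseRho pk := pk.inst.parse (logDeg n)
  parsePrf pk := pk.inst.parse (logDeg n + logDeg n)

end PE

end

/-!
The scheme works with exponents. All group elements are powers of the generators `g_i`, the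
exponents live in `ZMod N`, and raising to the power `p` forgets everything but the exponent
modulo `q` (`MultilinearInstance.pow_p_eq_iff`). Verification of `(ρ, π) = (g_k^R, g_{2k}^P)`
amounts to the equation `f(s) - R = (s - α) P` modulo `q` (`PE.verifyAlg_val`).

*Correctness.* The factor `h^r` of an encoded input has an exponent divisible by `q`, so the server
computes with `α, α^2, α^4, …` modulo `q`. The honest `P` is the value at `s` of the quotient of
`f(X) - f(α)` by `X - α` (`evalMod_sub`), and the verification equation is an identity.

*Input privacy.* Replace `h = u^q` by a random `u`. The subgroup decision assumption at level `1`
bounds the difference. A random `u` generates `G_1` except with a negligible probability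
(`MultilinearGenerator.negligible_badProb`), and then an encoded input is a tuple of independent
uniform elements (`MultilinearInstance.encryptK_congr`), so that the challenge bit is hidden.

*Security.* Given `g_1, g_1^s, …, g_1^(s^n)` and `p, q`, guess the input `α` of the forgery and
the wrong value `y` in their domains, of polynomial size, and run the adversary with the secret
`S = s + α`. A successful forgery satisfies `f(S) - y = s P` modulo `q`, whereas
`f(S) - f(α) = s W` with `g_1^W` computable from the given powers. So `s (P - W) = f(α) - y`, a
known and invertible number modulo `q`; with its inverse `c`, the element `g_K^(p / s)` is
`g_K^(p c (P - W))`, obtained by pairing `g_{2k}^P` and `g_1^W` with generators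
(`MultilinearInstance.exponent_eq`, `PE.exists_isSolver`). It remains to average over the coins:
the shift by `α` preserves the uniform distribution of the secret (`PE.winProb_le`).

Both reductions have to be programs of polynomial cost. They are not written down as programs.
Instead, `PolyKernel ctx F` states that the random map `F` is computed by some polynomial-time
program from the data `ctx`, and this property is closed under composition, case distinction,
sequential random choice (`PolyKernel.bind`) and bounded loops (`PolyKernel.iterate`).

*Operations of the client.* Encoding an input takes `5 k` operations, and verification at most
`2 |𝕄| + 12`, where `k < log₂ (n + 1) + 1`.
-/

noncomputable section

/-! ### Costs of programs -/

theorem Polynomial.eval_nat_mono (P : ℕ[X]) {a b : ℕ} (h : a ≤ b) : P.eval a ≤ P.eval b := by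
  simp only [eval_eq_sum, Polynomial.sum]
  gcongr

namespace Val

theorem one_le_size (v : Val) : 1 ≤ v.size := by
  cases v <;> simp [size]

theorem fst_size_le (v : Val) : v.fst.size ≤ v.size := by
  cases v <;> simp [size, fst]
  omega

theorem snd_size_le (v : Val) : v.snd.size ≤ v.size := by
  cases v <;> simp [size, snd]
  omega

end Val

theorem Nat.size_le_self (a : ℕ) : Nat.size a ≤ a := Nat.size_le.2 Nat.lt_two_pow_self

theorem Nat.size_add_le (a b : ℕ) : Nat.size (a + b) ≤ Nat.size a + Nat.size b + 1 := by
  rw [Nat.size_le]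
  have ha := Nat.lt_size_self a
  have hb := Nat.lt_size_self b
  have h1 : 2 ^ a.size ≤ 2 ^ (a.size + b.size) := Nat.pow_le_pow_right (by norm_num) (by omega)
  have h2 : 2 ^ b.size ≤ 2 ^ (a.size + b.size) := Nat.pow_le_pow_right (by norm_num) (by omega)
  rw [pow_succ]
  omega

theorem Nat.size_mul_le (a b : ℕ) : Nat.size (a * b) ≤ Nat.size a + Nat.size b := by
  rw [Nat.size_le, pow_add]
  exact Nat.mul_lt_mul'' (Nat.lt_size_self a) (Nat.lt_size_self b)

theorem ArithOp.apply_size_le (o : ArithOp) (a b : ℕ) :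
    Nat.size (o.apply a b) ≤ Nat.size a + Nat.size b + 1 := by
  cases o
  · exact Nat.size_add_le a b
  · exact (Nat.size_le_size (Nat.sub_le a b)).trans (by omega)
  · exact (Nat.size_mul_le a b).trans (by omega)
  · exact (Nat.size_le_size (Nat.div_le_self a b)).trans (by omega)
  · exact (Nat.size_le_size (Nat.mod_le a b)).trans (by omega)

theorem ArithOp.applyVal_size_le (o : ArithOp) (v : Val) : (o.applyVal v).size ≤ v.size + 1 := by
  have h0 : (Val.num 0).size = 1 := by simp [Val.size]
  rcases v with a | ⟨a | ⟨_, _⟩, b | ⟨_, _⟩⟩ <;>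
    simp only [applyVal, h0, le_add_iff_nonneg_left, zero_le]
  have := o.apply_size_le a b
  simp only [Val.size]
  omega

namespace Code

theorem basic_support {v w : Val} {o : Val × ℕ} (h : o ∈ (basic v w).support) :
    o = (w, v.size + w.size) := by
  simpa [basic] using h

/-- The cost of a loop whose steps preserve an invariant under which they cost at most `T`. -/
theorem loop_cost {step : Val → PMF (Val × ℕ)} {Inv : Val → Prop} {T : ℕ}
    (h : ∀ z, Inv z → ∀ o ∈ (step z).support, Inv o.1 ∧ o.2 ≤ T) (m : ℕ) :
    ∀ z, Inv z → ∀ o ∈ (loop step m z).support, o.2 ≤ m * T := by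
  induction m with
  | zero => intro z _ o ho; simp [loop] at ho; simp [ho]
  | succ m ih =>
    intro z hz o ho
    simp only [loop, PMF.mem_support_bind_iff, PMF.mem_support_map_iff] at ho
    obtain ⟨a, ha, b, hb, rfl⟩ := ho
    have h1 := h z hz a ha
    have h2 := ih a.1 h1.1 b hb
    rw [add_mul, one_mul]
    dsimp only
    omega

/-- A run writes its output, so the output is at most as long as the run. -/
theorem size_le_cost (c : Code) : ∀ (v : Val), ∀ o ∈ (c.eval v).support, o.1.size ≤ o.2 := by
  have hb : ∀ v w : Val, ∀ o ∈ (basic v w).support, o.1.size ≤ o.2 := by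
    intro v w o ho
    rw [basic_support ho]
    exact Nat.le_add_left _ _
  induction c with
  | id => intro v; exact hb _ _
  | const w => intro v; exact hb _ _
  | fst => intro v; exact hb _ _
  | snd => intro v; exact hb _ _
  | isPair => intro v; exact hb _ _
  | size => intro v; exact hb _ _
  | arith o => intro v; exact hb _ _
  | rand =>
    intro v
    rcases v with (_ | a) | ⟨a, b⟩
    · exact hb _ _
    · intro o ho
      simp only [eval, PMF.mem_support_bind_iff] at ho
      obtain ⟨i, -, hi⟩ := ho
      exact hb _ _ o hi
    · exact hb _ _
  | pair f g hf hg =>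
    intro v o ho
    simp only [eval, PMF.mem_support_bind_iff, PMF.mem_support_map_iff] at ho
    obtain ⟨a, ha, b, hb, rfl⟩ := ho
    have h1 := hf v a ha
    have h2 := hg v b hb
    have h3 := v.one_le_size
    simp only [Val.size]
    omega
  | comp f g hf hg =>
    intro v o ho
    simp only [eval, PMF.mem_support_bind_iff, PMF.mem_support_map_iff] at ho
    obtain ⟨a, ha, b, hb, rfl⟩ := ho
    have h2 := hf a.1 b hb
    dsimp only
    omega
  | ite c f g hc hf hg =>
    intro v o ho
    simp only [eval, PMF.mem_support_bind_iff] at ho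
    obtain ⟨a, ha, ho⟩ := ho
    split at ho <;> simp only [PMF.mem_support_map_iff] at ho <;> obtain ⟨b, hb, rfl⟩ := ho
    · have := hg v b hb
      dsimp only
      omega
    · have := hf v b hb
      dsimp only
      omega
  | iter f hf =>
    intro v
    have hl : ∀ (m : ℕ) (x : Val), ∀ o ∈ (loop f.eval m x).support, o.1.size ≤ x.size + o.2 := by
      intro m
      induction m with
      | zero => intro x o ho; simp [loop] at ho; simp [ho]
      | succ m ih =>
        intro x o ho
        simp only [loop, PMF.mem_support_bind_iff, PMF.mem_support_map_iff] at ho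
        obtain ⟨a, ha, b, hb, rfl⟩ := ho
        have h1 := hf x a ha
        have h2 := ih a.1 b hb
        dsimp only
        omega
    rcases v with a | ⟨m | ⟨_, _⟩, x⟩
    · exact hb _ _
    · intro o ho
      simp only [eval, PMF.mem_support_map_iff] at ho
      obtain ⟨b, hb, rfl⟩ := ho
      have := hl m x b hb
      simp only [Val.size]
      omega
    · exact hb _ _

theorem mem_support_output {c : Code} {v : Val} {o : Val × ℕ} (h : o ∈ (c.eval v).support) :
    o.1 ∈ (c.output v).support := by
  rw [output, PMF.mem_support_map_iff]
  exact ⟨o, h, rfl⟩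

/-! ### Output distributions -/

theorem output_basic (v w : Val) : (basic v w).map Prod.fst = PMF.pure w := by
  simp [basic, PMF.pure_map]

theorem output_pair (f g : Code) (v : Val) :
    (pair f g).output v = (f.output v).bind fun a => (g.output v).map (Val.pair a) := by
  simp only [output, eval, PMF.map_bind, PMF.bind_map, PMF.map_comp]
  rfl

theorem output_comp (f g : Code) (v : Val) :
    (comp f g).output v = (g.output v).bind f.output := by
  simp only [output, eval, PMF.map_bind, PMF.bind_map, PMF.map_comp]
  rfl

/-- Branching on a test whose result is deterministic. -/
theorem output_ite {c f g : Code} {v : Val} {m : ℕ} (hc : c.output v = PMF.pure (.num m)) :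
    (ite c f g).output v = if m = 0 then g.output v else f.output v := by
  have h : ∀ a ∈ (c.eval v).support, a.1 = .num m := by
    intro a ha
    have := mem_support_output ha
    simpa [hc] using this
  have key : (ite c f g).output v =
      (c.eval v).bind fun _ => if m = 0 then g.output v else f.output v := by
    simp only [output, eval, PMF.map_bind]
    apply PMF.ext
    intro w
    simp only [PMF.bind_apply]
    refine tsum_congr fun a => ?_
    by_cases ha : a ∈ (c.eval v).support
    · have := h a ha
      rw [this]
      rcases m with _ | m <;> simp [PMF.map_comp]
    · rw [PMF.mem_support_iff, not_not] at ha
      simp [ha]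
  rw [key, PMF.bind_const]

/-- Repeated application of a random map. -/
def _root_.PMF.iterate {α : Type} (F : α → PMF α) : ℕ → α → PMF α
  | 0, x => PMF.pure x
  | m + 1, x => (F x).bind (PMF.iterate F m)

/-- Branching on a test whose result is deterministic. -/
theorem output_iter (f : Code) (m : ℕ) (x : Val) :
    (iter f).output (.pair (.num m) x) = PMF.iterate f.output m x := by
  simp only [output, eval, PMF.map_comp]
  change (loop f.eval m x).map Prod.fst = _
  induction m generalizing x with
  | zero => simp [loop, PMF.iterate, PMF.pure_map]
  | succ m ih =>
    simp only [loop, PMF.iterate, PMF.map_bind, PMF.map_comp, output, PMF.bind_map]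
    congr 1
    funext a
    exact ih a.1

/-! ### Polynomial-time programs are closed under composition -/

theorem PPT.of_basic {c : Code} {w : Val → Val} (k : ℕ) (h : ∀ v, c.eval v = basic v (w v))
    (hw : ∀ v, (w v).size ≤ v.size + k) : c.PPT := by
  refine ⟨X + X + C k, fun v o ho => ?_⟩
  rw [h v] at ho
  rw [basic_support ho]
  have := hw v
  simp only [eval_add, eval_X, eval_C]
  omega

theorem ppt_id : id.PPT := .of_basic 0 (w := fun v => v) (fun _ => rfl) (fun _ => le_rfl)

theorem ppt_const (w : Val) : (const w).PPT :=
  .of_basic w.size (w := fun _ => w) (fun _ => rfl) (fun _ => Nat.le_add_left _ _)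

theorem ppt_fst : fst.PPT := .of_basic 0 (fun _ => rfl) Val.fst_size_le

theorem ppt_snd : snd.PPT := .of_basic 0 (fun _ => rfl) Val.snd_size_le

theorem ppt_isPair : isPair.PPT := by
  refine .of_basic 1 (w := fun v => .num v.isPair) (fun _ => rfl) fun v => ?_
  have := v.one_le_size
  cases v <;> simp_all [Val.isPair, Val.size]

theorem ppt_size : size.PPT := by
  refine .of_basic 1 (w := fun v => .num v.size) (fun _ => rfl) fun v => ?_
  simpa [Val.size] using Nat.size_le_self v.size

theorem ppt_arith (o : ArithOp) : (arith o).PPT :=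
  .of_basic 1 (fun _ => rfl) o.applyVal_size_le

theorem ppt_rand : rand.PPT := by
  refine ⟨X + X + 1, fun v o ho => ?_⟩
  simp only [eval_add, eval_X, eval_one]
  have h0 : (Val.num 0).size = 1 := by simp [Val.size]
  rcases v with (_ | a) | ⟨a, b⟩
  · rw [basic_support ho, h0]
    omega
  · simp only [eval, PMF.mem_support_bind_iff] at ho
    obtain ⟨i, -, hi⟩ := ho
    rw [basic_support hi]
    have := Nat.size_le_size i.isLt.le
    simp only [Val.size]
    omega
  · rw [basic_support ho, h0]
    omega

theorem PPT.pair {f g : Code} (hf : f.PPT) (hg : g.PPT) : (pair f g).PPT := by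
  obtain ⟨P, hP⟩ := hf
  obtain ⟨Q, hQ⟩ := hg
  refine ⟨X + P + Q, fun v o ho => ?_⟩
  simp only [eval, PMF.mem_support_bind_iff, PMF.mem_support_map_iff] at ho
  obtain ⟨a, ha, b, hb, rfl⟩ := ho
  have := hP v a ha
  have := hQ v b hb
  simp only [eval_add, eval_X]
  omega

/-- Composition, when the outer program is only known to be fast on the outputs of the inner
one. -/
theorem PPT.comp_of_cost {f g : Code} (hg : g.PPT) (P : ℕ[X])
    (hf : ∀ v, ∀ a ∈ (g.output v).support, ∀ o ∈ (f.eval a).support, o.2 ≤ P.eval v.size) :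
    (comp f g).PPT := by
  obtain ⟨Q, hQ⟩ := hg
  refine ⟨P + Q, fun v o ho => ?_⟩
  simp only [eval, PMF.mem_support_bind_iff, PMF.mem_support_map_iff] at ho
  obtain ⟨a, ha, b, hb, rfl⟩ := ho
  have := hQ v a ha
  have := hf v a.1 (mem_support_output ha) b hb
  simp only [eval_add]
  omega

/-- The size of the output of a polynomial-time program is polynomially bounded. -/
theorem PPT.exists_size_le {c : Code} (hc : c.PPT) :
    ∃ P : ℕ[X], ∀ v, ∀ a ∈ (c.output v).support, a.size ≤ P.eval v.size := by
  obtain ⟨P, hP⟩ := hc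
  refine ⟨P, fun v a ha => ?_⟩
  rw [output, PMF.mem_support_map_iff] at ha
  obtain ⟨o, ho, rfl⟩ := ha
  exact (size_le_cost c v o ho).trans (hP v o ho)

theorem PPT.comp {f g : Code} (hf : f.PPT) (hg : g.PPT) : (comp f g).PPT := by
  obtain ⟨P, hP⟩ := hf
  obtain ⟨Q, hQ⟩ := hg.exists_size_le
  refine hg.comp_of_cost (P.comp Q) fun v a ha o ho => ?_
  rw [eval_comp]
  exact (hP a o ho).trans (P.eval_nat_mono (hQ v a ha))

theorem PPT.ite {c f g : Code} (hc : c.PPT) (hf : f.PPT) (hg : g.PPT) : (ite c f g).PPT := by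
  obtain ⟨P, hP⟩ := hf
  obtain ⟨Q, hQ⟩ := hg
  obtain ⟨R, hR⟩ := hc
  refine ⟨X + R + P + Q, fun v o ho => ?_⟩
  simp only [eval, PMF.mem_support_bind_iff] at ho
  obtain ⟨a, ha, ho⟩ := ho
  have := hR v a ha
  simp only [eval_add, eval_X]
  split at ho <;> simp only [PMF.mem_support_map_iff] at ho <;> obtain ⟨b, hb, rfl⟩ := ho
  · have := hQ v b hb
    dsimp only
    omega
  · have := hP v b hb
    dsimp only
    omega

end Code

/-! ### Polynomial-time kernels -/

/-- The random map `F` is computed in polynomial time from the data `ctx`: some PPT program outputs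
the distribution `F x` on the input `ctx x`. The points `x : X` are the well-formed inputs; the
program is fast on all inputs, but nothing is asked of its output on ill-formed ones. -/
def PolyKernel {X : Type} (ctx : X → Val) (F : X → PMF Val) : Prop :=
  ∃ c : Code, c.PPT ∧ ∀ x, c.output (ctx x) = F x

/-- The function `f` is computed in polynomial time from the data `ctx`. -/
def PolyFun {X : Type} (ctx f : X → Val) : Prop :=
  PolyKernel ctx fun x => PMF.pure (f x)

section Calculus

variable {X : Type} {ctx : X → Val}

theorem PolyKernel.congr {F G : X → PMF Val} (h : PolyKernel ctx F) (hFG : ∀ x, F x = G x) :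
    PolyKernel ctx G := by
  rwa [← funext hFG]

theorem PolyFun.congr {f g : X → Val} (h : PolyFun ctx f) (hfg : ∀ x, f x = g x) :
    PolyFun ctx g := by
  rwa [← funext hfg]

theorem PolyKernel.reindex {X' : Type} {F : X → PMF Val} (h : PolyKernel ctx F) (φ : X' → X) :
    PolyKernel (fun x => ctx (φ x)) fun x => F (φ x) := by
  obtain ⟨c, hc, h⟩ := h
  exact ⟨c, hc, fun x => h _⟩

theorem PolyFun.reindex {X' : Type} {f : X → Val} (h : PolyFun ctx f) (φ : X' → X) :
    PolyFun (fun x => ctx (φ x)) fun x => f (φ x) :=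
  PolyKernel.reindex h φ

theorem Code.PPT.polyKernel {c : Code} (hc : c.PPT) : PolyKernel ctx fun x => c.output (ctx x) :=
  ⟨c, hc, fun _ => rfl⟩

theorem PolyFun.self : PolyFun ctx ctx :=
  ⟨.id, Code.ppt_id, fun _ => Code.output_basic _ _⟩

theorem PolyFun.const (v : Val) : PolyFun ctx fun _ => v :=
  ⟨.const v, Code.ppt_const v, fun _ => Code.output_basic _ _⟩

theorem PolyKernel.comp {f : X → Val} {F : X → PMF Val} (hF : PolyKernel f F)
    (hf : PolyFun ctx f) : PolyKernel ctx F := by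
  obtain ⟨c, hc, hf⟩ := hf
  obtain ⟨d, hd, hF⟩ := hF
  exact ⟨.comp d c, hd.comp hc, fun x => by rw [Code.output_comp, hf, PMF.pure_bind, hF]⟩

theorem PolyFun.comp {f g : X → Val} (hg : PolyFun f g) (hf : PolyFun ctx f) : PolyFun ctx g :=
  PolyKernel.comp hg hf

theorem PolyFun.fst {f : X → Val} (hf : PolyFun ctx f) : PolyFun ctx fun x => (f x).fst :=
  .comp ⟨.fst, Code.ppt_fst, fun _ => Code.output_basic _ _⟩ hf

theorem PolyFun.snd {f : X → Val} (hf : PolyFun ctx f) : PolyFun ctx fun x => (f x).snd :=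
  .comp ⟨.snd, Code.ppt_snd, fun _ => Code.output_basic _ _⟩ hf

theorem PolyFun.isPair {f : X → Val} (hf : PolyFun ctx f) :
    PolyFun ctx fun x => .num (f x).isPair :=
  .comp ⟨.isPair, Code.ppt_isPair, fun _ => Code.output_basic _ _⟩ hf

theorem PolyFun.size {f : X → Val} (hf : PolyFun ctx f) : PolyFun ctx fun x => .num (f x).size :=
  .comp ⟨.size, Code.ppt_size, fun _ => Code.output_basic _ _⟩ hf

theorem PolyFun.pair {f g : X → Val} (hf : PolyFun ctx f) (hg : PolyFun ctx g) :
    PolyFun ctx fun x => .pair (f x) (g x) := by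
  obtain ⟨c, hc, hf⟩ := hf
  obtain ⟨d, hd, hg⟩ := hg
  exact ⟨.pair c d, hc.pair hd, fun x => by
    rw [Code.output_pair, hf, hg, PMF.pure_bind, PMF.pure_map]⟩

theorem PolyFun.arithOp (o : ArithOp) {a b : X → ℕ} (ha : PolyFun ctx fun x => .num (a x))
    (hb : PolyFun ctx fun x => .num (b x)) : PolyFun ctx fun x => .num (o.apply (a x) (b x)) :=
  .comp (f := fun x => .pair (.num (a x)) (.num (b x)))
    ⟨.arith o, Code.ppt_arith o, fun _ => Code.output_basic _ _⟩ (ha.pair hb)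

theorem PolyFun.add {a b : X → ℕ} (ha : PolyFun ctx fun x => .num (a x))
    (hb : PolyFun ctx fun x => .num (b x)) : PolyFun ctx fun x => .num (a x + b x) :=
  ha.arithOp .add hb

theorem PolyFun.sub {a b : X → ℕ} (ha : PolyFun ctx fun x => .num (a x))
    (hb : PolyFun ctx fun x => .num (b x)) : PolyFun ctx fun x => .num (a x - b x) :=
  ha.arithOp .sub hb

theorem PolyFun.mul {a b : X → ℕ} (ha : PolyFun ctx fun x => .num (a x))
    (hb : PolyFun ctx fun x => .num (b x)) : PolyFun ctx fun x => .num (a x * b x) :=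
  ha.arithOp .mul hb

theorem PolyFun.div {a b : X → ℕ} (ha : PolyFun ctx fun x => .num (a x))
    (hb : PolyFun ctx fun x => .num (b x)) : PolyFun ctx fun x => .num (a x / b x) :=
  ha.arithOp .div hb

theorem PolyFun.mod {a b : X → ℕ} (ha : PolyFun ctx fun x => .num (a x))
    (hb : PolyFun ctx fun x => .num (b x)) : PolyFun ctx fun x => .num (a x % b x) :=
  ha.arithOp .mod hb

theorem PolyFun.natPow {a : X → ℕ} (ha : PolyFun ctx fun x => .num (a x)) (m : ℕ) :
    PolyFun ctx fun x => .num (a x ^ m) := by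
  induction m with
  | zero => exact (PolyFun.const (.num 1)).congr fun x => by rw [pow_zero]
  | succ m ih => exact (ih.mul ha).congr fun x => by rw [pow_succ]

theorem PolyFun.sum_range {a : ℕ → X → ℕ} (m : ℕ)
    (ha : ∀ i < m, PolyFun ctx fun x => .num (a i x)) :
    PolyFun ctx fun x => .num (∑ i ∈ Finset.range m, a i x) := by
  induction m with
  | zero => exact (PolyFun.const (.num 0)).congr fun x => by simp
  | succ m ih =>
    exact ((ih fun i hi => ha i (by omega)).add (ha m (by omega))).congr fun x => by
      rw [Finset.sum_range_succ]

theorem PolyFun.polyEval {a : X → ℕ} (ha : PolyFun ctx fun x => .num (a x)) (P : ℕ[X]) :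
    PolyFun ctx fun x => .num (P.eval (a x)) := by
  refine (PolyFun.sum_range (a := fun i x => P.coeff i * a x ^ i) (P.natDegree + 1)
    fun i _ => (PolyFun.const (.num (P.coeff i))).mul (ha.natPow i)).congr fun x => ?_
  rw [eval_eq_sum_range]

theorem PolyFun.size_le {f : X → Val} (hf : PolyFun ctx f) :
    ∃ P : ℕ[X], ∀ x, (f x).size ≤ P.eval (ctx x).size := by
  obtain ⟨c, hc, h⟩ := hf
  obtain ⟨P, hP⟩ := hc.exists_size_le
  exact ⟨P, fun x => hP _ _ (by simp [h])⟩

/-- Uniform numbers below `a`, in the convention of `Code.rand`. -/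
def PMF.below : ℕ → PMF ℕ
  | 0 => PMF.pure 0
  | a + 1 => (PMF.uniformOfFintype (Fin (a + 1))).map Fin.val

theorem PolyKernel.below {a : X → ℕ} (ha : PolyFun ctx fun x => .num (a x)) :
    PolyKernel ctx fun x => (PMF.below (a x)).map .num := by
  have h : ∀ m : ℕ, Code.rand.output (.num m) = (PMF.below m).map .num := by
    rintro (_ | m)
    · exact (Code.output_basic _ _).trans (PMF.pure_map _ _).symm
    · simp only [Code.output, Code.eval, PMF.map_bind, PMF.below, PMF.map_comp,
        Code.output_basic]
      rfl
  exact .comp ⟨.rand, Code.ppt_rand, fun x => h (a x)⟩ ha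

/-- Case distinction by a polynomial-time test. -/
theorem PolyKernel.cases {F : X → PMF Val} (p : X → Prop) [DecidablePred p]
    (hp : PolyFun ctx fun x => .num (if p x then 1 else 0))
    (h₁ : PolyKernel (fun x : {x // p x} => ctx x) fun x => F x)
    (h₀ : PolyKernel (fun x : {x // ¬ p x} => ctx x) fun x => F x) : PolyKernel ctx F := by
  obtain ⟨c, hc, h⟩ := hp
  obtain ⟨c₁, hc₁, h₁⟩ := h₁
  obtain ⟨c₀, hc₀, h₀⟩ := h₀
  refine ⟨.ite c c₁ c₀, hc.ite hc₁ hc₀, fun x => ?_⟩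
  rw [Code.output_ite (h x)]
  by_cases hx : p x
  · simpa [hx] using h₁ ⟨x, hx⟩
  · simpa [hx] using h₀ ⟨x, hx⟩

theorem PolyFun.cases {f : X → Val} (p : X → Prop) [DecidablePred p]
    (hp : PolyFun ctx fun x => .num (if p x then 1 else 0))
    (h₁ : PolyFun (fun x : {x // p x} => ctx x) fun x => f x)
    (h₀ : PolyFun (fun x : {x // ¬ p x} => ctx x) fun x => f x) : PolyFun ctx f :=
  PolyKernel.cases p hp h₁ h₀

theorem PolyFun.ite {f g : X → Val} (p : X → Prop) [DecidablePred p]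
    (hp : PolyFun ctx fun x => .num (if p x then 1 else 0))
    (hf : PolyFun ctx f) (hg : PolyFun ctx g) : PolyFun ctx fun x => if p x then f x else g x :=
  .cases p hp ((hf.reindex Subtype.val).congr fun x => (if_pos x.2).symm)
    ((hg.reindex Subtype.val).congr fun x => (if_neg x.2).symm)

theorem PolyFun.decideNe {a : X → ℕ} (ha : PolyFun ctx fun x => .num (a x)) :
    PolyFun ctx fun x => .num (if a x ≠ 0 then 1 else 0) := by
  -- `1 - (1 - a)` in truncated arithmetic
  refine ((PolyFun.const (.num 1)).sub ((PolyFun.const (.num 1)).sub ha)).congr fun x => ?_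
  split_ifs <;> congr 1 <;> omega

theorem PolyFun.decideEq {a b : X → ℕ} (ha : PolyFun ctx fun x => .num (a x))
    (hb : PolyFun ctx fun x => .num (b x)) :
    PolyFun ctx fun x => .num (if a x = b x then 1 else 0) := by
  refine ((PolyFun.const (.num 1)).sub ((ha.sub hb).add (hb.sub ha))).congr fun x => ?_
  split_ifs <;> congr 1 <;> omega

/-- Data computed from a context are computed from any data that determine the context. -/
theorem PolyFun.via {X' : Type} {c : X' → Val} {f : X → Val} (hf : PolyFun ctx f) (φ : X' → X)
    (h : PolyFun c fun z => ctx (φ z)) : PolyFun c fun z => f (φ z) :=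
  .comp (hf.reindex φ) h

/-- Data computed from a context are still available after the context has been extended. -/
theorem PolyFun.weaken {f : X → Val} (hf : PolyFun ctx f) {Y : X → Type} {e : Sigma Y → Val} :
    PolyFun (fun z : Sigma Y => .pair (ctx z.1) (e z)) fun z => f z.1 :=
  hf.via Sigma.fst PolyFun.self.fst

/-- The datum by which a context has been extended. -/
theorem PolyFun.top {e : X → Val} : PolyFun (fun x => .pair (ctx x) (e x)) e :=
  PolyFun.self.snd

/-- Sequential composition. The second kernel receives the context, together with the encoding
`e x y` of the outcome `y` of the first one. -/
theorem PolyKernel.bind {Y : X → Type} {F : ∀ x, PMF (Y x)} (e : ∀ x, Y x → Val)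
    {G : ∀ x, Y x → PMF Val}
    (hF : PolyKernel ctx fun x => (F x).map (e x))
    (hG : PolyKernel (fun z : Σ x, Y x => .pair (ctx z.1) (e z.1 z.2)) fun z => G z.1 z.2) :
    PolyKernel ctx fun x => (F x).bind (G x) := by
  obtain ⟨c, hc, h⟩ := hF
  obtain ⟨d, hd, h'⟩ := hG
  refine ⟨.comp d (.pair .id c), hd.comp (Code.ppt_id.pair hc), fun x => ?_⟩
  have hid : Code.id.output (ctx x) = PMF.pure (ctx x) := Code.output_basic _ _
  rw [Code.output_comp, Code.output_pair, hid, PMF.pure_bind, h, PMF.map_comp,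
    PMF.bind_map]
  congr 1
  funext y
  exact h' ⟨x, y⟩

/-- The number represented by a datum, and `0` if there is none. -/
def Val.toNat : Val → ℕ
  | num k => k
  | pair _ _ => 0

theorem PolyFun.toNat {f : X → Val} (hf : PolyFun ctx f) :
    PolyFun ctx fun x => .num (f x).toNat := by
  refine PolyFun.cases (fun x => (f x).isPair ≠ 0) hf.isPair.decideNe ?_ ?_
  · refine (PolyFun.const (.num 0)).congr ?_
    rintro ⟨x, hx⟩
    rcases h : f x with k | ⟨k, l⟩
    · simp [h, Val.isPair] at hx
    · simp [Val.toNat]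
  · refine (hf.reindex Subtype.val).congr ?_
    rintro ⟨x, hx⟩
    rcases h : f x with k | ⟨k, l⟩
    · simp [Val.toNat]
    · simp [h, Val.isPair] at hx

end Calculus

/-! ### Bounded loops -/

section Loops

variable {X : Type} {ctx : X → Val}

theorem PMF.iterate_pure {α : Type} (f : α → α) (m : ℕ) (x : α) :
    PMF.iterate (fun y => PMF.pure (f y)) m x = PMF.pure (f^[m] x) := by
  induction m generalizing x with
  | zero => rfl
  | succ m ih => simp only [PMF.iterate, PMF.pure_bind, ih, Function.iterate_succ_apply]

/-- Replace data of more than `B` bits by `0`. -/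
def Val.clamp (B : ℕ) (v : Val) : Val := if v.size - B ≠ 0 then .num 0 else v

theorem Val.clamp_size_le (B : ℕ) (v : Val) : (v.clamp B).size ≤ B + 1 := by
  unfold clamp
  split_ifs with h
  · simp [size]
  · omega

/-- A polynomially bounded number of iterations of a polynomial-time kernel, each of which
lengthens the state by a polynomially bounded number of bits. The program that computes it is
polynomial-time on all inputs since it discards states that become too long. -/
theorem PolyKernel.iterate {Y : X → Type} (e : ∀ x, Y x → Val) {m : X → ℕ} {y₀ : ∀ x, Y x}
    {F : ∀ x, Y x → PMF (Y x)} (hm : PolyFun ctx fun x => .num (m x))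
    (P : ℕ[X]) (hmP : ∀ x, m x ≤ P.eval (ctx x).size)
    (h₀ : PolyFun ctx fun x => e x (y₀ x))
    (hF : PolyKernel (fun z : Σ x, Y x => .pair (ctx z.1) (e z.1 z.2))
      fun z => (F z.1 z.2).map (e z.1))
    (Q : ℕ[X]) (hQ : ∀ x y, ∀ y' ∈ (F x y).support,
      (e x y').size ≤ (e x y).size + Q.eval (ctx x).size) :
    PolyKernel ctx fun x => (PMF.iterate (F x) (m x) (y₀ x)).map (e x) := by
  obtain ⟨cm, hcm, hm⟩ := hm
  obtain ⟨c0, hc0, h0⟩ := h₀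
  obtain ⟨cF, hcF, hF⟩ := hF
  obtain ⟨P0, hP0⟩ := hc0.exists_size_le
  -- a bound for the sizes of all states and for the number of iterations
  set R : ℕ[X] := P0 + P * Q + P with hR
  have hB : PolyFun (fun v : Val => v) fun v => .num (R.eval v.size) :=
    PolyFun.polyEval PolyFun.self.size R
  -- one step, on states `((v, B), y)`, where `v` is the input
  let st (v : Val) (B : ℕ) (y : Val) : Val := .pair (.pair v (.num B)) y
  obtain ⟨cs, hcs, hs⟩ : PolyKernel (fun z : Val × ℕ × Val => st z.1 z.2.1 z.2.2) fun z =>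
      (cF.output (.pair z.1 z.2.2)).bind fun y => PMF.pure (st z.1 z.2.1 (y.clamp z.2.1)) := by
    refine .bind (Y := fun _ => Val) (fun _ y => y) ?_ ?_
    · refine PolyKernel.congr (.comp (f := fun z : Val × ℕ × Val => .pair z.1 z.2.2)
        hcF.polyKernel ?_) fun z => (PMF.map_id _).symm
      exact (PolyFun.self.fst.fst).pair PolyFun.self.snd
    · have hb : PolyFun (fun z : Σ _ : Val × ℕ × Val, Val =>
          .pair (st z.1.1 z.1.2.1 z.1.2.2) z.2) fun z => .num z.1.2.1 := PolyFun.self.fst.fst.snd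
      refine PolyFun.pair PolyFun.self.fst.fst ?_
      exact PolyFun.ite _ (PolyFun.decideNe (PolyFun.sub PolyFun.self.snd.size hb)) (.const _)
        PolyFun.self.snd
  -- the number of iterations and the initial state, on all inputs
  obtain ⟨cp, hcp, hp⟩ : PolyKernel (fun v : Val => v) fun v =>
      (cm.output v).bind fun k => (c0.output v).bind fun y => (PMF.pure (Val.pair
        (.num (min k.toNat (R.eval v.size)))
        (st v (R.eval v.size) y))) := by
    refine .bind (Y := fun _ => Val) (fun _ y => y)
      (hcm.polyKernel.congr fun z => (PMF.map_id _).symm) ?_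
    refine .bind (Y := fun _ => Val) (fun _ y => y)
      (.comp (f := fun z : Σ _ : Val, Val => z.1)
        (hc0.polyKernel.congr fun z => (PMF.map_id _).symm) PolyFun.self.fst) ?_
    have hv : PolyFun (fun z : Σ _ : (Σ _ : Val, Val), Val => .pair (.pair z.1.1 z.1.2) z.2)
      fun z => z.1.1 := PolyFun.self.fst.fst
    have hB' : PolyFun (fun z : Σ _ : (Σ _ : Val, Val), Val => .pair (.pair z.1.1 z.1.2) z.2)
      fun z => .num (R.eval z.1.1.size) := PolyFun.polyEval hv.size R
    refine PolyFun.pair ?_ (PolyFun.pair (hv.pair hB') PolyFun.self.snd)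
    have hk := PolyFun.toNat (PolyFun.self (ctx := fun z : Σ _ : (Σ _ : Val, Val), Val =>
      .pair (.pair z.1.1 z.1.2) z.2)).fst.snd
    refine (hk.sub (hk.sub hB')).congr ?_
    rintro ⟨⟨v, k⟩, y⟩
    simp only [Val.fst, Val.snd]
    congr 1
    omega
  refine ⟨.comp .snd (.comp (.iter cs) cp), Code.ppt_snd.comp ?_, fun x => ?_⟩
  · obtain ⟨S, hS⟩ := hcs
    let W : ℕ[X] := Polynomial.X + (R + 1) + (R + P0 + 1) + 2
    refine hcp.comp_of_cost ((R + 1 + W + 1) + R * S.comp W) fun v a ha o ho => ?_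
    rw [hp] at ha
    simp only [PMF.mem_support_bind_iff, PMF.mem_support_pure_iff] at ha
    obtain ⟨k, -, y, hy, rfl⟩ := ha
    generalize hkk : min k.toNat (R.eval v.size) = k' at ho
    have hk' : k' ≤ R.eval v.size := hkk ▸ min_le_right _ _
    simp only [Code.eval, PMF.mem_support_map_iff] at ho
    obtain ⟨b, hb, rfl⟩ := ho
    have hsize : ∀ y : Val, y.size ≤ (R + P0 + 1).eval v.size →
        (st v (R.eval v.size) y).size ≤ W.eval v.size := by
      intro y hy
      have := Nat.size_le_self (R.eval v.size)
      simp only [st, Val.size, W, eval_add, eval_X, eval_one, eval_ofNat] at hy ⊢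
      omega
    have hy' : y.size ≤ (R + P0 + 1).eval v.size := by
      have := hP0 v y hy
      simp only [eval_add]
      omega
    have hcost := Code.loop_cost (step := cs.eval) (T := (S.comp W).eval v.size)
      (Inv := fun z => ∃ y : Val, y.size ≤ (R + P0 + 1).eval v.size ∧
        z = st v (R.eval v.size) y) ?_ k' _ ⟨y, hy', rfl⟩ b hb
    · have h1 := hsize y hy'
      have h2 := Nat.mul_le_mul_right ((S.comp W).eval v.size) hk'
      have h3 := Nat.size_le_self k'
      simp only [eval_add, eval_mul, eval_one] at *
      rw [Val.size, Val.size]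
      omega
    · rintro z ⟨y, hy, rfl⟩ o ho
      constructor
      · have := Code.mem_support_output ho
        rw [hs (v, R.eval v.size, y)] at this
        simp only [PMF.mem_support_bind_iff, PMF.mem_support_pure_iff] at this
        obtain ⟨y', -, hy'⟩ := this
        refine ⟨_, ?_, hy'⟩
        have := Val.clamp_size_le (R.eval v.size) y'
        simp only [eval_add, eval_one]
        omega
      · rw [eval_comp]
        exact (hS _ o ho).trans (S.eval_nat_mono (hsize y hy))
  · dsimp only at hm h0 hp ⊢
    have hsnd : ∀ v : Val, Code.snd.output v = PMF.pure v.snd := fun v => Code.output_basic _ _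
    set B := R.eval (ctx x).size with hBdef
    have hstep : ∀ y : Y x, (e x y).size + Q.eval (ctx x).size ≤ B →
        cs.output (st (ctx x) B (e x y)) = (F x y).map fun y' => st (ctx x) B (e x y') := by
      intro y hy
      have hFy : cF.output (.pair (ctx x) (e x y)) = (F x y).map (e x) := hF ⟨x, y⟩
      refine (hs (ctx x, B, e x y)).trans ?_
      dsimp only
      rw [hFy, PMF.bind_map]
      apply PMF.ext
      intro w
      rw [PMF.map, PMF.bind_apply, PMF.bind_apply]
      refine tsum_congr fun y' => ?_
      by_cases h : y' ∈ (F x y).support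
      · have := hQ x y y' h
        have : (e x y').size - B = 0 := by omega
        simp [Val.clamp, this]
      · rw [PMF.mem_support_iff, not_not] at h
        simp [h]
    have hiter : ∀ (k : ℕ) (y : Y x), (e x y).size + k * Q.eval (ctx x).size ≤ B →
        PMF.iterate cs.output k (st (ctx x) B (e x y)) =
          (PMF.iterate (F x) k y).map fun y' => st (ctx x) B (e x y') := by
      intro k
      induction k with
      | zero => intro y _; simp [PMF.iterate, PMF.pure_map]
      | succ k ih =>
        intro y hy
        rw [add_mul, one_mul] at hy
        simp only [PMF.iterate, PMF.map_bind]
        rw [hstep y (by omega), PMF.bind_map]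
        apply PMF.ext
        intro w
        rw [PMF.bind_apply, PMF.bind_apply]
        refine tsum_congr fun y' => ?_
        by_cases h : y' ∈ (F x y).support
        · have := hQ x y y' h
          simp only [Function.comp]
          rw [ih y' (by omega)]
        · rw [PMF.mem_support_iff, not_not] at h
          simp [h]
    have hy0 : (e x (y₀ x)).size ≤ P0.eval (ctx x).size := hP0 _ _ (by simp [h0])
    have hmx := hmP x
    have hle : (e x (y₀ x)).size + m x * Q.eval (ctx x).size ≤ B := by
      have := Nat.mul_le_mul_right (Q.eval (ctx x).size) hmx
      simp only [hBdef, hR, eval_add, eval_mul]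
      omega
    have hmin : min (m x) B = m x := by
      simp only [hBdef, hR, eval_add]
      omega
    rw [Code.output_comp, Code.output_comp, hp, hm, h0, PMF.pure_bind, PMF.pure_bind,
      PMF.pure_bind, Code.output_iter, Val.toNat, ← hBdef, hmin, hiter _ _ hle, PMF.bind_map]
    rw [PMF.map]
    congr 1
    funext y
    exact hsnd _

theorem PolyFun.iterate {Y : X → Type} (e : ∀ x, Y x → Val) {m : X → ℕ} {y₀ : ∀ x, Y x}
    {f : ∀ x, Y x → Y x} (hm : PolyFun ctx fun x => .num (m x))
    (P : ℕ[X]) (hmP : ∀ x, m x ≤ P.eval (ctx x).size)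
    (h₀ : PolyFun ctx fun x => e x (y₀ x))
    (hf : PolyFun (fun z : Σ x, Y x => .pair (ctx z.1) (e z.1 z.2)) fun z => e z.1 (f z.1 z.2))
    (Q : ℕ[X]) (hQ : ∀ x y, (e x (f x y)).size ≤ (e x y).size + Q.eval (ctx x).size) :
    PolyFun ctx fun x => e x ((f x)^[m x] (y₀ x)) := by
  refine (PolyKernel.iterate e (F := fun x y => PMF.pure (f x y)) hm P hmP h₀
    (PolyKernel.congr hf fun z => (PMF.pure_map _ _).symm) Q ?_).congr fun x => ?_
  · intro x y y' hy'
    rw [PMF.mem_support_pure_iff] at hy'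
    rw [hy']
    exact hQ x y
  · rw [PMF.iterate_pure, PMF.pure_map]

theorem Val.length_lt_size_list (l : List Val) : l.length < (Val.list l).size := by
  induction l with
  | nil => simp [Val.list, Val.size]
  | cons a l ih =>
    simp only [Val.list, List.foldr_cons, Val.size, List.length_cons] at *
    have := a.one_le_size
    omega

/-- Folding a list, with an accumulator that grows by polynomially many bits in each step. -/
theorem PolyFun.foldl {Y Z : X → Type} (e : ∀ x, Y x → Val) (eZ : ∀ x, Z x → Val)
    {l : ∀ x, List (Z x)} {y₀ : ∀ x, Y x} {f : ∀ x, Y x → Z x → Y x}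
    (hl : PolyFun ctx fun x => Val.list ((l x).map (eZ x)))
    (h₀ : PolyFun ctx fun x => e x (y₀ x))
    (hf : PolyFun (fun z : Σ x, Y x × Z x => .pair (ctx z.1) (.pair (e z.1 z.2.1) (eZ z.1 z.2.2)))
      fun z => e z.1 (f z.1 z.2.1 z.2.2))
    (Q : ℕ[X]) (hQ : ∀ x y z, (e x (f x y z)).size ≤ (e x y).size + Q.eval (ctx x).size) :
    PolyFun ctx fun x => e x ((l x).foldl (f x) (y₀ x)) := by
  -- the state consists of the accumulator and of the rest of the list
  let E (x : X) (s : Y x × List (Z x)) : Val := .pair (e x s.1) (Val.list (s.2.map (eZ x)))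
  let step (x : X) (s : Y x × List (Z x)) : Y x × List (Z x) :=
    match s with
    | (y, []) => (y, [])
    | (y, z :: l) => (f x y z, l)
  have hstep : ∀ x (l : List (Z x)) (y : Y x) (m : ℕ), l.length ≤ m →
      (step x)^[m] (y, l) = (l.foldl (f x) y, []) := by
    intro x l
    induction l with
    | nil =>
      intro y m _
      induction m with
      | zero => rfl
      | succ m ih => rw [Function.iterate_succ_apply]; exact ih (Nat.zero_le _)
    | cons z l ih =>
      intro y m hm
      obtain ⟨m, rfl⟩ : ∃ k, m = k + 1 := ⟨m - 1, by simp at hm; omega⟩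
      rw [Function.iterate_succ_apply]
      exact ih _ _ (by simpa using hm)
  obtain ⟨P, hP⟩ := hl.size_le
  refine (PolyFun.iterate E (f := step) (y₀ := fun x => (y₀ x, l x))
    (m := fun x => (Val.list ((l x).map (eZ x))).size) hl.size P hP (h₀.pair hl) ?_ Q
    ?_).fst.congr fun x => ?_
  · refine PolyFun.cases (fun z => (Val.list (z.2.2.map (eZ z.1))).isPair ≠ 0)
      (PolyFun.decideNe PolyFun.self.snd.snd.isPair) ?_ ?_
    · let X' := {z : Σ x, Y x × List (Z x) // (Val.list (z.2.2.map (eZ z.1))).isPair ≠ 0}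
      have hne : ∀ z : X', z.1.2.2 ≠ [] := by
        rintro ⟨⟨x, y, l⟩, hz⟩ (h : l = [])
        subst h
        exact hz rfl
      have h := hf.reindex fun z : X' => ⟨z.1.1, z.1.2.1, z.1.2.2.head (hne z)⟩
      have hc : PolyFun (fun z : X' => .pair (ctx z.1.1) (E z.1.1 z.1.2)) fun z =>
          .pair (ctx z.1.1) (.pair (e z.1.1 z.1.2.1) (eZ z.1.1 (z.1.2.2.head (hne z)))) := by
        refine PolyFun.pair PolyFun.self.fst (PolyFun.pair PolyFun.self.snd.fst
          (PolyFun.congr PolyFun.self.snd.snd.fst ?_))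
        rintro ⟨⟨x, y, _ | ⟨z, l⟩⟩, hz⟩
        · exact absurd rfl (hne ⟨⟨x, y, []⟩, hz⟩)
        · rfl
      refine PolyFun.congr ((h.comp hc).pair PolyFun.self.snd.snd.snd) ?_
      rintro ⟨⟨x, y, _ | ⟨z, l⟩⟩, hz⟩
      · exact absurd rfl (hne ⟨⟨x, y, []⟩, hz⟩)
      · rfl
    · refine PolyFun.congr PolyFun.self.snd ?_
      rintro ⟨⟨x, y, _ | ⟨z, l⟩⟩, hz⟩
      · rfl
      · simp [Val.list, Val.isPair] at hz
  · rintro x ⟨y, _ | ⟨z, l⟩⟩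
    · simp [step]
    · have := hQ x y z
      simp only [step, E, Val.size, List.map_cons, Val.list, List.foldr_cons]
      omega
  · rw [hstep x _ _ _ (by simpa using (Val.length_lt_size_list ((l x).map (eZ x))).le)]
    rfl

end Loops

/-! ### Lists and powers -/

/-- The entry of index `i` of a list. -/
def Val.nth : ℕ → Val → Val
  | 0, v => v.fst
  | i + 1, v => Val.nth i v.snd

theorem Val.nth_list {l : List Val} {i : ℕ} {a : Val} (h : l[i]? = some a) :
    Val.nth i (Val.list l) = a := by
  induction l generalizing i with
  | nil => simp at h
  | cons b l ih =>
    rcases i with _ | i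
    · simpa [Val.nth, Val.list, Val.fst] using h
    · exact ih (by simpa using h)

theorem Val.size_le_size_list {l : List Val} {a : Val} (h : a ∈ l) :
    a.size ≤ (Val.list l).size := by
  induction l with
  | nil => simp at h
  | cons b l ih =>
    simp only [Val.list, List.foldr_cons, Val.size] at *
    rcases List.mem_cons.1 h with rfl | h
    · omega
    · have := ih h
      omega

theorem Val.size_list_le {l : List Val} {B : ℕ} (h : ∀ a ∈ l, a.size ≤ B) :
    (Val.list l).size ≤ l.length * (B + 1) + 1 := by
  induction l with
  | nil => simp [Val.list, Val.size]
  | cons b l ih =>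
    have h1 := ih fun a ha => h a (List.mem_cons_of_mem _ ha)
    have h2 := h b List.mem_cons_self
    simp only [Val.list, List.foldr_cons, Val.size, List.length_cons, add_mul] at *
    omega

theorem Val.lt_size_unary (lam : ℕ) : lam < (Val.unary lam).size := by
  simpa [Val.unary] using Val.length_lt_size_list (List.replicate lam (.num 0))

section

variable {X : Type} {ctx : X → Val}

theorem PolyFun.nth (i : ℕ) {f : X → Val} (hf : PolyFun ctx f) :
    PolyFun ctx fun x => (f x).nth i := by
  induction i generalizing f with
  | zero => exact hf.fst
  | succ i ih => exact ih hf.snd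

theorem PolyFun.list {m : ℕ} {f : ℕ → X → Val} (hf : ∀ i < m, PolyFun ctx (f i)) :
    PolyFun ctx fun x => Val.list ((List.range m).map fun i => f i x) := by
  suffices h : ∀ l : List ℕ, (∀ i ∈ l, i < m) →
      PolyFun ctx fun x => Val.list (l.map fun i => f i x) from
    h _ fun i hi => List.mem_range.1 hi
  intro l
  induction l with
  | nil => intro _; exact .const _
  | cons a l ih =>
    intro h
    exact (hf a (h a List.mem_cons_self)).pair (ih fun i hi => h i (List.mem_cons_of_mem _ hi))

theorem PolyFun.length {Z : X → Type} {eZ : ∀ x, Z x → Val} {l : ∀ x, List (Z x)}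
    (hl : PolyFun ctx fun x => Val.list ((l x).map (eZ x))) :
    PolyFun ctx fun x => .num (l x).length := by
  have h1 : ∀ (α : Type) (l : List α) (m : ℕ), l.foldl (fun c _ => c + 1) m = m + l.length := by
    intro α l
    induction l with
    | nil => intro m; rfl
    | cons a l ih => intro m; rw [List.foldl_cons, ih, List.length_cons]; omega
  refine (PolyFun.foldl (fun _ m => .num m) eZ (f := fun _ c _ => c + 1) hl
    (PolyFun.const (.num 0)) (.add PolyFun.self.snd.fst (.const (.num 1))) 2 ?_).congr fun x => ?_
  · intro x y z
    have := Nat.size_add_le y 1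
    have h : Nat.size 1 = 1 := Nat.size_one
    simp only [Val.size, eval_ofNat]
    omega
  · rw [h1, zero_add]

theorem PolyFun.decideMem {l : X → List ℕ} {a : X → ℕ}
    (hl : PolyFun ctx fun x => Val.list ((l x).map .num)) (ha : PolyFun ctx fun x => .num (a x)) :
    PolyFun ctx fun x => .num (if a x ∈ l x then 1 else 0) := by
  have h1 : ∀ (l : List ℕ) (a : ℕ) (b : Bool),
      l.foldl (fun b z => if z = a then true else b) b = (b || decide (a ∈ l)) := by
    intro l a
    induction l with
    | nil => intro b; simp
    | cons z l ih =>
      intro b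
      rw [List.foldl_cons, ih]
      by_cases h : z = a
      · simp [h]
      · simp [h, Ne.symm h]
  refine (PolyFun.foldl (Y := fun _ => Bool) (Z := fun _ => ℕ) (fun _ b => .num b.toNat)
    (fun _ m => .num m) (f := fun x b z => if z = a x then true else b) (y₀ := fun _ => false) hl
    (PolyFun.const (.num 0)) ?_ 2 ?_).congr fun x => ?_
  · refine (PolyFun.ite (fun z => z.2.2 = a z.1) 
      (.decideEq (a := fun z : Σ _ : X, Bool × ℕ => z.2.2) PolyFun.self.snd.snd ha.weaken)
      (.const (.num 1)) PolyFun.self.snd.fst).congr fun z => ?_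
    split_ifs <;> rfl
  · intro x y z
    have h : Nat.size 1 = 1 := Nat.size_one
    have h0 : Nat.size 0 = 0 := Nat.size_zero
    simp only [Val.size, eval_ofNat]
    split_ifs <;> cases y <;> simp [h, h0]
  · rw [h1]
    by_cases h : a x ∈ l x <;> simp [h]

theorem PolyFun.getD {l : X → List ℕ} {i : X → ℕ}
    (hl : PolyFun ctx fun x => Val.list ((l x).map .num)) (hi : PolyFun ctx fun x => .num (i x)) :
    PolyFun ctx fun x => .num ((l x).getD (i x) 0) := by
  obtain ⟨P, hP⟩ := hl.size_le
  -- the index may be large; past the end of the list, all entries are `0`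
  have hmin : PolyFun ctx fun x => .num (min (i x) (Val.list ((l x).map .num)).size) := by
    refine (hi.sub (hi.sub hl.size)).congr fun x => ?_
    congr 1
    omega
  have hdrop : ∀ (m : ℕ) (l : List Val), Val.snd^[m] (Val.list l) = Val.list (l.drop m) := by
    intro m
    induction m with
    | zero => intro l; rfl
    | succ m ih =>
      intro l
      rw [Function.iterate_succ_apply]
      rcases l with _ | ⟨a, l⟩
      · exact (ih []).trans (by simp)
      · exact ih l
  refine (PolyFun.iterate (fun _ v => v) (f := fun _ v => v.snd) hmin P
    (fun x => (min_le_right _ _).trans (hP x)) hl PolyFun.self.snd.snd 0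
    fun x y => (Val.snd_size_le y).trans (Nat.le_add_right _ _)).fst.toNat.congr fun x => ?_
  rw [hdrop]
  congr 1
  have hlen := Val.length_lt_size_list ((l x).map .num)
  rw [List.length_map] at hlen
  by_cases h : i x < (l x).length
  · rw [min_eq_left (by omega), List.getD_eq_getElem _ _ h,
      List.drop_eq_getElem_cons (by simpa using h)]
    simp [Val.list, Val.fst, Val.toNat]
  · rw [List.drop_eq_nil_of_le (by rw [List.length_map]; omega),
      List.getD_eq_default _ _ (by omega)]
    rfl

/-- One step of exponentiation by squaring. -/
def squareStep {M : Type} [CommMonoid M] (s : M × M × ℕ) : M × M × ℕ :=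
  (if s.2.2 % 2 ≠ 0 then s.1 * s.2.1 else s.1, s.2.1 * s.2.1, s.2.2 / 2)

theorem squareStep_iterate {M : Type} [CommMonoid M] (j : ℕ) :
    ∀ (c b : M) (m : ℕ), m < 2 ^ j → (squareStep^[j] (c, b, m)).1 = c * b ^ m := by
  induction j with
  | zero => intro c b m hm; simp at hm; simp [hm]
  | succ j ih =>
    intro c b m hm
    rw [pow_succ] at hm
    rw [Function.iterate_succ_apply, squareStep, ih _ _ _ (by dsimp only; omega)]
    dsimp only
    have h2 := Nat.div_add_mod m 2
    conv_rhs => rw [← h2, pow_add, pow_mul]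
    rw [pow_two b]
    split_ifs with h
    · rw [show m % 2 = 1 by omega, pow_one, mul_comm (_ ^ _) b, mul_assoc]
    · rw [show m % 2 = 0 by omega, pow_zero, mul_one]

/-- Exponentiation by squaring in a commutative monoid whose elements have short encodings and
whose multiplication is computable in polynomial time. The exponent is shifted by one because the
encoding of the unit need not be available. -/
theorem PolyFun.powSucc {M : X → Type} [∀ x, CommMonoid (M x)] (e : ∀ x, M x → Val)
    (Q : ℕ[X]) (hQ : ∀ x y, (e x y).size ≤ Q.eval (ctx x).size)
    (hmul : ∀ {X' : Type} {ctx' : X' → Val} (φ : X' → X) (a b : ∀ x, M (φ x)),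
      PolyFun ctx' (fun x => ctx (φ x)) → PolyFun ctx' (fun x => e _ (a x)) →
      PolyFun ctx' (fun x => e _ (b x)) → PolyFun ctx' fun x => e _ (a x * b x))
    {a : ∀ x, M x} (ha : PolyFun ctx fun x => e x (a x))
    {m : X → ℕ} (hm : PolyFun ctx fun x => .num (m x)) :
    PolyFun ctx fun x => e x (a x ^ (m x + 1)) := by
  let E (x : X) (s : M x × M x × ℕ) : Val := .pair (e x s.1) (.pair (e x s.2.1) (.num s.2.2))
  obtain ⟨P, hP⟩ := hm.size_le
  have hx : PolyFun (fun z : Σ x, M x × M x × ℕ => .pair (ctx z.1) (E z.1 z.2))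
    fun z => ctx z.1 := PolyFun.self.weaken
  have hs : PolyFun (fun z : Σ x, M x × M x × ℕ => .pair (ctx z.1) (E z.1 z.2))
    fun z => E z.1 z.2 := PolyFun.self.snd
  have hc : PolyFun (fun z : Σ x, M x × M x × ℕ => .pair (ctx z.1) (E z.1 z.2))
    fun z => e z.1 z.2.1 := hs.fst
  have hb : PolyFun (fun z : Σ x, M x × M x × ℕ => .pair (ctx z.1) (E z.1 z.2))
    fun z => e z.1 z.2.2.1 := hs.snd.fst
  have hn : PolyFun (fun z : Σ x, M x × M x × ℕ => .pair (ctx z.1) (E z.1 z.2))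
    fun z => .num z.2.2.2 := hs.snd.snd
  refine (PolyFun.iterate E (f := fun _ => squareStep) (y₀ := fun x => (a x, a x, m x)) hm.size P hP
    (ha.pair (ha.pair hm)) ?_ (Q + Q) ?_).fst.congr fun x => ?_
  · refine PolyFun.pair ?_ (PolyFun.pair (hmul _ _ _ hx hb hb) (hn.div (.const (.num 2))))
    refine (PolyFun.ite (fun z => z.2.2.2 % 2 ≠ 0) (PolyFun.decideNe (hn.mod (.const (.num 2))))
      (hmul Sigma.fst (fun z => z.2.1) (fun z => z.2.2.1) hx hc hb) hc).congr fun z => ?_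
    unfold squareStep
    split_ifs <;> rfl
  · rintro x ⟨c, b, k⟩
    have h1 := hQ x (squareStep (c, b, k)).1
    have h2 := hQ x (squareStep (c, b, k)).2.1
    have h3 : Nat.size (squareStep (c, b, k)).2.2 ≤ Nat.size k :=
      Nat.size_le_size (Nat.div_le_self _ _)
    simp only [E, Val.size, eval_add]
    omega
  · have : m x < 2 ^ (Val.num (m x)).size := (Nat.lt_size_self _).trans_le
      (Nat.pow_le_pow_right (by norm_num) (Nat.le_succ _))
    simp only [E, Val.fst]
    rw [squareStep_iterate _ _ _ _ this, pow_succ']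

end

/-! ### Computations in the groups -/

/-- The data `ctx` determine, in polynomial time, the security parameter and a possible outcome of
the generator. -/
structure GroupData {K : ℕ} (𝒢 : MultilinearGenerator K) {X : Type} (ctx : X → Val)
    (lam : X → ℕ) (w : X → 𝒢.Idx) : Prop where
  mem : ∀ x, w x ∈ (𝒢.sample (lam x)).support
  lam_fun : PolyFun ctx fun x => Val.unary (lam x)
  inst_fun : PolyFun ctx fun x => (𝒢.inst (w x)).toVal

namespace GroupData

variable {K : ℕ} {𝒢 : MultilinearGenerator K} {X : Type} {ctx : X → Val} {lam : X → ℕ}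
  {w : X → 𝒢.Idx} {i j : ℕ}

theorem via (h : GroupData 𝒢 ctx lam w) {X' : Type} {c : X' → Val} (φ : X' → X)
    (hφ : PolyFun c fun z => ctx (φ z)) : GroupData 𝒢 c (fun z => lam (φ z)) fun z => w (φ z) :=
  ⟨fun _ => h.mem _, h.lam_fun.via φ hφ, h.inst_fun.via φ hφ⟩

theorem weaken (h : GroupData 𝒢 ctx lam w) {Y : X → Type} {e : Sigma Y → Val} :
    GroupData 𝒢 (fun z : Sigma Y => .pair (ctx z.1) (e z)) (fun z => lam z.1) fun z => w z.1 :=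
  h.via Sigma.fst PolyFun.self.fst

theorem lam_num (h : GroupData 𝒢 ctx lam w) : PolyFun ctx fun x => .num (lam x) :=
  (PolyFun.length (Z := fun _ => Val) (eZ := fun _ v => v)
    (l := fun x => List.replicate (lam x) (.num 0))
    (h.lam_fun.congr fun x => by simp [Val.unary])).congr fun x => by simp

theorem eval_lam_le (h : GroupData 𝒢 ctx lam w) (P : ℕ[X]) :
    ∃ Q : ℕ[X], ∀ x, P.eval (lam x) ≤ Q.eval (ctx x).size := by
  obtain ⟨Q, hQ⟩ := h.lam_fun.size_le
  refine ⟨P.comp Q, fun x => ?_⟩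
  rw [eval_comp]
  exact P.eval_nat_mono ((Val.lt_size_unary _).le.trans (hQ x))

theorem elt_size (h : GroupData 𝒢 ctx lam w) : ∃ Q : ℕ[X], ∀ x, ∀ i, 1 ≤ i → i ≤ K →
    ∀ y : (𝒢.inst (w x)).G i, ((𝒢.inst (w x)).elt y).size ≤ Q.eval (ctx x).size := by
  obtain ⟨Q, hQ⟩ := h.eval_lam_le 𝒢.bound
  exact ⟨Q, fun x i hi hi' y => (𝒢.enc_size _ _ (h.mem x) i hi hi' y).trans (hQ x)⟩

theorem order (h : GroupData 𝒢 ctx lam w) : PolyFun ctx fun x => .num (𝒢.inst (w x)).N :=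
  h.inst_fun.nth 0

theorem gen (h : GroupData 𝒢 ctx lam w) (hi : 1 ≤ i) (hi' : i ≤ K) :
    PolyFun ctx fun x => (𝒢.inst (w x)).elt ((𝒢.inst (w x)).g i) := by
  obtain ⟨i, rfl⟩ : ∃ j, i = j + 1 := ⟨i - 1, by omega⟩
  refine ((h.inst_fun.nth 2).nth i).congr fun x => ?_
  exact Val.nth_list (by simp [List.getElem?_range (show i < K by omega)])

theorem mul (h : GroupData 𝒢 ctx lam w) (hi : 1 ≤ i) (hi' : i ≤ K)
    {a b : ∀ x, (𝒢.inst (w x)).G i} (ha : PolyFun ctx fun x => (𝒢.inst (w x)).elt (a x))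
    (hb : PolyFun ctx fun x => (𝒢.inst (w x)).elt (b x)) :
    PolyFun ctx fun x => (𝒢.inst (w x)).elt (a x * b x) :=
  .comp (f := fun x => Val.list [(𝒢.inst (w x)).toVal, .num i, (𝒢.inst (w x)).elt (a x),
      (𝒢.inst (w x)).elt (b x)])
    ⟨𝒢.mulCode, 𝒢.mulCode_ppt, fun x => 𝒢.mulCode_spec _ _ (h.mem x) i hi hi' _ _⟩
    (h.inst_fun.pair ((PolyFun.const _).pair (ha.pair (hb.pair (.const _)))))

theorem pairing (h : GroupData 𝒢 ctx lam w) (hi : 1 ≤ i) (hj : 1 ≤ j) (hij : i + j ≤ K)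
    {a : ∀ x, (𝒢.inst (w x)).G i} {b : ∀ x, (𝒢.inst (w x)).G j}
    (ha : PolyFun ctx fun x => (𝒢.inst (w x)).elt (a x))
    (hb : PolyFun ctx fun x => (𝒢.inst (w x)).elt (b x)) :
    PolyFun ctx fun x => (𝒢.inst (w x)).elt ((𝒢.inst (w x)).e (a x) (b x)) :=
  .comp (f := fun x => Val.list [(𝒢.inst (w x)).toVal, .num i, .num j,
      (𝒢.inst (w x)).elt (a x), (𝒢.inst (w x)).elt (b x)])
    ⟨𝒢.pairCode, 𝒢.pairCode_ppt, fun x => 𝒢.pairCode_spec _ _ (h.mem x) i j hi hj hij _ _⟩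
    (h.inst_fun.pair ((PolyFun.const _).pair ((PolyFun.const _).pair
      (ha.pair (hb.pair (.const _))))))

theorem pow (h : GroupData 𝒢 ctx lam w) (hi : 1 ≤ i) (hi' : i ≤ K)
    {a : ∀ x, (𝒢.inst (w x)).G i} (ha : PolyFun ctx fun x => (𝒢.inst (w x)).elt (a x))
    {m : X → ℕ} (hm : PolyFun ctx fun x => .num (m x)) :
    PolyFun ctx fun x => (𝒢.inst (w x)).elt (a x ^ m x) := by
  obtain ⟨Q, hQ⟩ := h.elt_size
  -- adding the group order `N` to the exponent makes it positive
  refine (PolyFun.powSucc (fun x y => (𝒢.inst (w x)).elt y) Q (fun x y => hQ x i hi hi' y)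
    (fun {X' ctx'} φ a b hφ ha hb => ?_) ha
    (hm.add (h.order.sub (.const (.num 1))))).congr fun x => ?_
  · exact (h.via φ hφ).mul hi hi' ha hb
  · have hN : (𝒢.inst (w x)).N ≠ 0 := NeZero.ne _
    rw [show m x + ((𝒢.inst (w x)).N - 1) + 1 = m x + (𝒢.inst (w x)).N by omega, pow_add,
      MultilinearInstance.N, ← (𝒢.inst (w x)).card_eq i hi hi', pow_card_eq_one, mul_one]

/-- The encoding of the unit is not given, but computed as `g_i^N`. -/
theorem one (h : GroupData 𝒢 ctx lam w) (hi : 1 ≤ i) (hi' : i ≤ K) :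
    PolyFun ctx fun x => (𝒢.inst (w x)).elt (1 : (𝒢.inst (w x)).G i) :=
  (h.pow hi hi' (h.gen hi hi') (.const (.num 0))).congr fun x => by rw [pow_zero]

theorem prod (h : GroupData 𝒢 ctx lam w) (hi : 1 ≤ i) (hi' : i ≤ K) (m : ℕ)
    {a : ℕ → ∀ x, (𝒢.inst (w x)).G i}
    (ha : ∀ l < m, PolyFun ctx fun x => (𝒢.inst (w x)).elt (a l x)) :
    PolyFun ctx fun x => (𝒢.inst (w x)).elt (∏ l ∈ Finset.range m, a l x) := by
  induction m with
  | zero => exact (h.one hi hi').congr fun x => by rw [Finset.prod_range_zero]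
  | succ m ih =>
    exact (h.mul hi hi' (ih fun l hl => ha l (by omega)) (ha m (by omega))).congr fun x => by
      rw [Finset.prod_range_succ]

theorem gpow (h : GroupData 𝒢 ctx lam w) (hi : 1 ≤ i) (hi' : i ≤ K)
    {a : ∀ x, ZMod (𝒢.inst (w x)).N} (ha : PolyFun ctx fun x => .num (a x).val) :
    PolyFun ctx fun x => (𝒢.inst (w x)).elt ((𝒢.inst (w x)).gpow i (a x)) :=
  h.pow hi hi' (h.gen hi hi') ha

end GroupData

/-! ### Running the scheme and its adversaries -/

/-- Encryptions of `a, a^2, a^4, …` with coins drawn one after the other. -/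
def MultilinearInstance.encryptK {K : ℕ} (Γ : MultilinearInstance K) (h : Γ.G 1) :
    ℕ → ZMod Γ.N → PMF (List (Γ.G 1))
  | 0, _ => PMF.pure []
  | k + 1, a => (PMF.uniformOfFintype (ZMod Γ.N)).bind fun r =>
      (Γ.encryptK h k (a * a)).map fun l => Γ.gpow 1 a * h ^ r.val :: l

theorem PMF.map_uniformOfFintype_of_bijective {α β : Type} [Fintype α] [Nonempty α] [Fintype β]
    [Nonempty β] {f : α → β} (hf : Function.Bijective f) :
    (PMF.uniformOfFintype α).map f = PMF.uniformOfFintype β := by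
  apply PMF.ext
  intro b
  obtain ⟨a, rfl⟩ := hf.2 b
  classical
  rw [PMF.map_apply, tsum_eq_single a]
  · simp [Fintype.card_of_bijective hf]
  · intro a' ha'
    rw [if_neg fun h => ha' (hf.1 h.symm)]

theorem PMF.uniformOfFintype_prod (α β : Type) [Fintype α] [Nonempty α] [Fintype β]
    [Nonempty β] : PMF.uniformOfFintype (α × β) =
      (PMF.uniformOfFintype α).bind fun a => (PMF.uniformOfFintype β).map fun b => (a, b) := by
  classical
  apply PMF.ext
  rintro ⟨a, b⟩
  rw [PMF.bind_apply, tsum_eq_single a, PMF.map_apply, tsum_eq_single b]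
  · simp [Fintype.card_prod, ENNReal.mul_inv]
  · intro b' hb'
    rw [if_neg fun h => hb' (Prod.ext_iff.1 h).2.symm]
  · intro a' ha'
    rw [PMF.map_apply, ENNReal.tsum_eq_zero.2, mul_zero]
    intro b'
    rw [if_neg fun h => ha' (Prod.ext_iff.1 h).1.symm]

/-- Drawing all the coins in advance, as the scheme does, amounts to drawing them one after the
other. -/
theorem map_encryptPowers {K : ℕ} (Γ : MultilinearInstance K) (h : Γ.G 1) (k : ℕ)
    (a : ZMod Γ.N) :
    (PMF.uniformOfFintype (Fin k → ZMod Γ.N)).map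
      (fun r => (PE.encryptPowers Γ h a (List.ofFn r)).val) = Γ.encryptK h k a := by
  induction k generalizing a with
  | zero =>
    have : (fun r : Fin 0 → ZMod Γ.N => (PE.encryptPowers Γ h a (List.ofFn r)).val) =
        Function.const _ [] := by
      funext r
      rw [List.ofFn_zero]
      rfl
    rw [this, PMF.map_const]
    rfl
  | succ k ih =>
    rw [← PMF.map_uniformOfFintype_of_bijective
        (Fin.consEquiv fun _ : Fin (k + 1) => ZMod Γ.N).bijective,
      PMF.uniformOfFintype_prod, PMF.map_comp, PMF.map_bind, MultilinearInstance.encryptK]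
    congr 1
    funext r
    rw [PMF.map_comp, ← ih, PMF.map_comp]
    congr 1
    funext rs
    simp only [Function.comp, Fin.consEquiv, Equiv.coe_fn_mk, List.ofFn_succ, Fin.cons_zero,
      Fin.cons_succ]
    rfl

theorem PMF.map_val_uniformOfFintype (N : ℕ) [NeZero N] :
    (PMF.uniformOfFintype (ZMod N)).map ZMod.val = PMF.below N := by
  rcases N with _ | N
  · exact absurd rfl (NeZero.ne 0)
  · rfl

section

variable {n : ℕ} {𝒢 : MultilinearGenerator (2 * logDeg n + 1)} {X : Type} {ctx : X → Val}

namespace GroupData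

variable {lam : X → ℕ} {w : X → 𝒢.Idx}

theorem uniform (h : GroupData 𝒢 ctx lam w) : PolyKernel ctx fun x =>
    (PMF.uniformOfFintype (ZMod (𝒢.inst (w x)).N)).map fun r => .num r.val :=
  (PolyKernel.below h.order).congr fun x => by
    rw [← PMF.map_val_uniformOfFintype, PMF.map_comp]
    rfl

theorem encryptK (h : GroupData 𝒢 ctx lam w) (k : ℕ) {u : ∀ x, (𝒢.inst (w x)).G 1}
    (hu : PolyFun ctx fun x => (𝒢.inst (w x)).elt (u x)) {a : ∀ x, ZMod (𝒢.inst (w x)).N}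
    (ha : PolyFun ctx fun x => .num (a x).val) :
    PolyKernel ctx fun x => ((𝒢.inst (w x)).encryptK (u x) k (a x)).map fun σ =>
      Val.list (σ.map (𝒢.inst (w x)).elt) := by
  induction k generalizing X with
  | zero =>
    refine PolyKernel.congr (PolyFun.const (.num 0)) fun x => ?_
    rw [MultilinearInstance.encryptK, PMF.pure_map]
    rfl
  | succ k ih =>
    have h1 : 1 ≤ 2 * logDeg n + 1 := by omega
    refine PolyKernel.congr (PolyKernel.bind (Y := fun x => ZMod (𝒢.inst (w x)).N)
      (fun x r => .num r.val) h.uniform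
      (G := fun x r => ((𝒢.inst (w x)).encryptK (u x) k (a x * a x)).bind fun σ =>
        PMF.pure (Val.list ((((𝒢.inst (w x)).gpow 1 (a x) * u x ^ r.val) :: σ).map
          (𝒢.inst (w x)).elt))) ?_) fun x => ?_
    · refine PolyKernel.bind (fun z σ => Val.list (σ.map (𝒢.inst (w z.1)).elt))
        (ih (u := fun z => u z.1) (a := fun z => a z.1 * a z.1)
          h.weaken hu.weaken ?_) ?_
      · exact ((ha.mul ha).mod h.order).weaken.congr fun z => by rw [ZMod.val_mul]
      · refine PolyFun.pair ?_ PolyFun.top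
        have hr : PolyFun (fun z : Σ x, ZMod (𝒢.inst (w x)).N => .pair (ctx z.1) (.num z.2.val))
          fun z => .num z.2.val := PolyFun.top
        exact (h.weaken.mul le_rfl h1 (h.gpow le_rfl h1 ha).weaken
          (h.weaken.pow le_rfl h1 hu.weaken hr)).weaken
    · simp only [MultilinearInstance.encryptK, PMF.map_bind, PMF.map_comp]
      rfl

end GroupData

variable {F : PolyFamily n}

theorem PE.scheme_probGen_map (pk : PE.PublicKey 𝒢) (sk : PE.SecretKey pk) (α : ℕ) {β : Type}
    (f : List (pk.inst.G 1) → ℕ → β) :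
    ((PE.scheme n 𝒢 F).probGen pk sk α).map (fun c => f c.val.1 c.val.2) =
      (pk.inst.encryptK pk.h (logDeg n) α).map fun σ => f σ α := by
  rw [← map_encryptPowers, PMF.map_comp]
  have key : ∀ (μ : PMF (Fin (logDeg n) → ZMod pk.inst.N))
      (g : _ → Counted (List (pk.inst.G 1) × ℕ)),
      (μ.bind fun r => PMF.pure (g r)).map (fun c => f c.val.1 c.val.2) =
        μ.map fun r => f (g r).val.1 (g r).val.2 := by
    intro μ g
    simp only [PMF.map_bind, PMF.pure_map]
    rfl
  exact key _ _

theorem PE.scheme_probGen_bind (pk : PE.PublicKey 𝒢) (sk : PE.SecretKey pk) (α : ℕ) {β : Type}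
    (f : List (pk.inst.G 1) → ℕ → PMF β) :
    (((PE.scheme n 𝒢 F).probGen pk sk α).bind fun c => f c.val.1 c.val.2) =
      (pk.inst.encryptK pk.h (logDeg n) α).bind fun σ => f σ α := by
  have h := congrArg (fun m => PMF.bind m fun z => f z.1 z.2)
    (PE.scheme_probGen_map (F := F) pk sk α fun σ α => (σ, α))
  simpa only [PMF.bind_map, Function.comp_def] using h

variable (F) in
/-- An adversary's query for an encoded input, and the answer, which are added to the
transcript. -/
def PE.oracleStep (pk : PE.PublicKey 𝒢) (query : Code) (st tr : Val) : PMF Val :=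
  (query.output (.pair st tr)).bind fun v =>
    match (PE.scheme n 𝒢 F).readInput pk.lam v with
    | none => PMF.pure (.pair (.num 0) tr)
    | some x => (pk.inst.encryptK pk.h (logDeg n) x).map fun σ =>
        .pair (.pair (.num x) (Val.list (σ.map pk.inst.elt))) tr

/-- The transcript does not depend on the secret key, which serves only in the verification. -/
theorem PE.queries_eq (pk : PE.PublicKey 𝒢) (sk : PE.SecretKey pk) (query : Code) (st : Val)
    (m : ℕ) (tr : Val) : (PE.scheme n 𝒢 F).queries pk.lam pk sk query st m tr =
      PMF.iterate (PE.oracleStep F pk query st) m tr := by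
  induction m generalizing tr with
  | zero => rfl
  | succ m ih =>
    rw [PMF.iterate, PE.oracleStep, PMF.bind_bind]
    change PMF.bind _ _ = _
    congr 1
    funext v
    rcases (PE.scheme n 𝒢 F).readInput pk.lam v with _ | x
    · simp only [PMF.pure_bind]
      exact ih _
    · simp only [PMF.bind_map]
      refine (PE.scheme_probGen_bind (F := F) pk sk x fun σ _ =>
        (PE.scheme n 𝒢 F).queries pk.lam pk sk query st m
          (.pair (.pair (.num x) (Val.list (σ.map pk.inst.elt))) tr)).trans ?_
      congr 1
      funext σ
      exact ih _

theorem VCScheme.readInput_eq (S : VCScheme) (lam : ℕ) (v : Val) : S.readInput lam v =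
    if v.isPair = 0 ∧ v.toNat ∈ S.dom lam then some v.toNat else none := by
  rcases v with a | ⟨a, b⟩
  · simp [VCScheme.readInput, Val.isPair, Val.toNat]
  · simp [VCScheme.readInput, Val.isPair]

variable (F) in
/-- The data `ctx` determine, in polynomial time, a public key that can occur. -/
structure KeyData {X : Type} (ctx : X → Val) (pk : X → PE.PublicKey 𝒢) : Prop where
  mem : ∀ x, (pk x).idx ∈ (𝒢.sample (pk x).lam).support
  pk_fun : PolyFun ctx fun x => (PE.scheme n 𝒢 F).pkVal (pk x)

namespace KeyData

variable {pk : X → PE.PublicKey 𝒢}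

theorem via (h : KeyData F ctx pk) {X' : Type} {c : X' → Val} (φ : X' → X)
    (hφ : PolyFun c fun z => ctx (φ z)) : KeyData F c fun z => pk (φ z) :=
  ⟨fun _ => h.mem _, h.pk_fun.via φ hφ⟩

theorem weaken (h : KeyData F ctx pk) {Y : X → Type} {e : Sigma Y → Val} :
    KeyData F (fun z : Sigma Y => .pair (ctx z.1) (e z)) fun z => pk z.1 :=
  h.via Sigma.fst PolyFun.self.fst

theorem groupData (h : KeyData F ctx pk) :
    GroupData 𝒢 ctx (fun x => (pk x).lam) fun x => (pk x).idx :=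
  ⟨h.mem, h.pk_fun.nth 0, h.pk_fun.nth 1⟩

theorem h_fun (h : KeyData F ctx pk) : PolyFun ctx fun x => (pk x).inst.elt (pk x).h :=
  h.pk_fun.nth 2

end KeyData

theorem PolyFun.coeff {lam : X → ℕ} (hlam : PolyFun ctx fun x => Val.unary (lam x)) (i : ℕ)
    (hi : i ≤ n) : PolyFun ctx fun x => .num ((F.poly (lam x)).coeff i) := by
  have h := PolyFun.comp ⟨F.gen, F.gen_ppt, fun x => F.gen_spec (lam x)⟩ hlam
  exact ((h.nth 0).nth i).congr fun x => Val.nth_list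
    (by simp [List.getElem?_range (show i < n + 1 by omega)])

theorem PolyFun.dom {lam : X → ℕ} (hlam : PolyFun ctx fun x => Val.unary (lam x)) :
    PolyFun ctx fun x => Val.list ((F.dom (lam x)).map .num) :=
  (PolyFun.comp ⟨F.gen, F.gen_ppt, fun x => F.gen_spec (lam x)⟩ hlam).nth 1

theorem PolyFun.msg {lam : X → ℕ} (hlam : PolyFun ctx fun x => Val.unary (lam x)) :
    PolyFun ctx fun x => Val.list ((F.msg (lam x)).map .num) :=
  (PolyFun.comp ⟨F.gen, F.gen_ppt, fun x => F.gen_spec (lam x)⟩ hlam).nth 2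

theorem PolyFun.decideInput {lam : X → ℕ} (hlam : PolyFun ctx fun x => Val.unary (lam x))
    {v : X → Val} (hv : PolyFun ctx v) : PolyFun ctx fun x =>
      .num (if (v x).isPair = 0 ∧ (v x).toNat ∈ F.dom (lam x) then 1 else 0) := by
  refine ((hv.isPair.decideEq (.const (.num 0))).mul
    (PolyFun.decideMem (PolyFun.dom (F := F) hlam) hv.toNat)).congr fun x => ?_
  by_cases h1 : (v x).isPair = 0 <;> by_cases h2 : (v x).toNat ∈ F.dom (lam x) <;> simp [h1, h2]

/-- Reading an input of the adversary, and continuing according to whether it lies in the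
domain. -/
theorem PolyKernel.readInput {lam : X → ℕ} (hlam : PolyFun ctx fun x => Val.unary (lam x))
    {v : X → Val} (hv : PolyFun ctx v) {G₀ : X → PMF Val} {G : X → ℕ → PMF Val}
    (h₀ : PolyKernel ctx G₀)
    (h : PolyKernel (fun z : Σ x : X, {a : ℕ // a ∈ F.dom (lam x)} => .pair (ctx z.1) (.num z.2))
      fun z => G z.1 z.2) :
    PolyKernel ctx fun x => match (PE.scheme n 𝒢 F).readInput (lam x) (v x) with
      | none => G₀ x
      | some a => G x a := by
  refine PolyKernel.cases (fun x => (v x).isPair = 0 ∧ (v x).toNat ∈ F.dom (lam x))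
    (PolyFun.decideInput hlam hv) ?_ ?_
  · have hX := (hv.toNat).reindex
      fun x : {x // (v x).isPair = 0 ∧ (v x).toNat ∈ F.dom (lam x)} => x.1
    refine PolyKernel.congr (PolyKernel.comp (h.reindex
      fun x : {x // (v x).isPair = 0 ∧ (v x).toNat ∈ F.dom (lam x)} =>
        ⟨x.1, (v x.1).toNat, x.2.2⟩) (PolyFun.self.pair hX)) fun x => ?_
    have : (PE.scheme n 𝒢 F).readInput (lam x) (v x) = some (v x).toNat := by
      rw [VCScheme.readInput_eq]
      exact if_pos x.2
    rw [this]
  · refine PolyKernel.congr (h₀.reindex Subtype.val) fun x => ?_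
    have : (PE.scheme n 𝒢 F).readInput (lam x) (v x) = none := by
      rw [VCScheme.readInput_eq]
      exact if_neg x.2
    rw [this]

theorem MultilinearInstance.length_of_mem_encryptK {K : ℕ} (Γ : MultilinearInstance K)
    (h : Γ.G 1) (k : ℕ) : ∀ (a : ZMod Γ.N), ∀ σ ∈ (Γ.encryptK h k a).support, σ.length = k := by
  induction k with
  | zero => intro a σ hσ; simp [encryptK] at hσ; simp [hσ]
  | succ k ih =>
    intro a σ hσ
    simp only [encryptK, PMF.mem_support_bind_iff, PMF.mem_support_map_iff] at hσ
    obtain ⟨r, -, l, hl, rfl⟩ := hσ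
    rw [List.length_cons, ih _ _ hl]

theorem ZMod.val_natCast_fun {N a : X → ℕ} (hN : PolyFun ctx fun x => .num (N x))
    (ha : PolyFun ctx fun x => .num (a x)) :
    PolyFun ctx fun x => .num (a x : ZMod (N x)).val :=
  (ha.mod hN).congr fun x => by rw [ZMod.val_natCast]

namespace KeyData

variable {pk : X → PE.PublicKey 𝒢}

theorem encryptK (h : KeyData F ctx pk) {a : X → ℕ} (ha : PolyFun ctx fun x => .num (a x)) :
    PolyKernel ctx fun x => ((pk x).inst.encryptK (pk x).h (logDeg n) (a x)).map fun σ =>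
      Val.list (σ.map (pk x).inst.elt) :=
  h.groupData.encryptK _ h.h_fun (ZMod.val_natCast_fun h.groupData.order ha)

theorem oracleStep (h : KeyData F ctx pk) {query : Code} (hq : query.PPT) {st tr : X → Val}
    (hst : PolyFun ctx st) (htr : PolyFun ctx tr) :
    PolyKernel ctx fun x => PE.oracleStep F (pk x) query (st x) (tr x) := by
  refine PolyKernel.bind (Y := fun _ => Val) (fun _ v => v)
    (PolyKernel.congr (PolyKernel.comp hq.polyKernel (hst.pair htr))
      fun _ => (PMF.map_id _).symm) ?_
  refine PolyKernel.readInput h.weaken.groupData.lam_fun PolyFun.top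
    ((PolyFun.const (.num 0)).pair htr.weaken) ?_
  refine PolyKernel.bind (fun z σ => Val.list (σ.map (pk z.1.1).inst.elt))
    (h.weaken.weaken.encryptK PolyFun.top) ?_
  refine PolyFun.pair (PolyFun.pair PolyFun.self.fst.snd PolyFun.top) ?_
  exact htr.via (Sigma.fst ∘ Sigma.fst ∘ Sigma.fst) PolyFun.self.fst.fst.fst

/-- The query phase is a polynomial-time computation, since each query lengthens the transcript by
an element of the domain and `k` group elements only. -/
theorem queries (h : KeyData F ctx pk) {query : Code} (hq : query.PPT) {st tr : X → Val}
    (hst : PolyFun ctx st) (htr : PolyFun ctx tr) (R : ℕ[X]) :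
    PolyKernel ctx fun x =>
      PMF.iterate (PE.oracleStep F (pk x) query (st x)) (R.eval (pk x).lam) (tr x) := by
  obtain ⟨P, hP⟩ := h.groupData.eval_lam_le R
  obtain ⟨D, hD⟩ := (PolyFun.dom (F := F) h.groupData.lam_fun).size_le
  obtain ⟨Q, hQ⟩ := h.groupData.elt_size
  refine PolyKernel.congr (PolyKernel.iterate (Y := fun _ => Val) (fun _ v => v)
    (h.groupData.lam_num.polyEval R) P hP htr
    (PolyKernel.congr (h.weaken.oracleStep hq hst.weaken PolyFun.top) fun _ => (PMF.map_id _).symm)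
    (D + (C (logDeg n) * (Q + 1) + 1) + 3) ?_) fun _ => PMF.map_id _
  intro x tr tr' htr'
  simp only [PE.oracleStep, PMF.mem_support_bind_iff] at htr'
  obtain ⟨v, -, hv⟩ := htr'
  rw [VCScheme.readInput_eq] at hv
  simp only [eval_add, eval_mul, eval_C, eval_one, eval_ofNat]
  split_ifs at hv with hin
  · simp only [PMF.mem_support_map_iff] at hv
    obtain ⟨σ, hσ, rfl⟩ := hv
    have h1 := (pk x).inst.length_of_mem_encryptK _ _ _ σ hσ
    have h2 := Val.size_list_le (l := σ.map (pk x).inst.elt)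
      (B := Q.eval (ctx x).size) fun a ha => by
      obtain ⟨y, -, rfl⟩ := List.mem_map.1 ha
      exact hQ x 1 le_rfl (by omega) y
    have h3 : (Val.num v.toNat).size ≤ _ :=
      Val.size_le_size_list (List.mem_map_of_mem (f := Val.num) hin.2)
    have h4 := hD x
    have h3 := h3.trans h4
    rw [List.length_map, h1] at h2
    simp only [Val.size] at h3 ⊢
    omega
  · simp only [PMF.mem_support_pure_iff] at hv
    rw [hv]
    simp only [Val.size, Nat.size_zero]
    omega

end KeyData

end

/-! ### Exponents -/

namespace MultilinearInstance

variable {K : ℕ} (Γ : MultilinearInstance K) {i j : ℕ}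

theorem orderOf_g (hi : 1 ≤ i) (hi' : i ≤ K) : orderOf (Γ.g i) = Γ.N := by
  rw [N, ← Γ.card_eq i hi hi', orderOf_eq_card_of_forall_mem_zpowers (Γ.generates i hi hi'),
    Nat.card_eq_fintype_card]

theorem gpow_natCast (hi : 1 ≤ i) (hi' : i ≤ K) (a : ℕ) : Γ.gpow i a = Γ.g i ^ a := by
  rw [gpow, ZMod.val_natCast, ← Γ.orderOf_g hi hi', pow_mod_orderOf]

theorem gpow_add (hi : 1 ≤ i) (hi' : i ≤ K) (a b : ZMod Γ.N) :
    Γ.gpow i (a + b) = Γ.gpow i a * Γ.gpow i b := by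
  conv_lhs => rw [← ZMod.natCast_zmod_val a, ← ZMod.natCast_zmod_val b, ← Nat.cast_add,
    Γ.gpow_natCast hi hi', pow_add]
  rfl

theorem gpow_zero (i : ℕ) : Γ.gpow i 0 = 1 := by
  rw [gpow, ZMod.val_zero, pow_zero]

theorem gpow_mul_natCast (hi : 1 ≤ i) (hi' : i ≤ K) (a : ZMod Γ.N) (m : ℕ) :
    Γ.gpow i (a * m) = Γ.gpow i a ^ m := by
  conv_lhs => rw [← ZMod.natCast_zmod_val a, ← Nat.cast_mul, Γ.gpow_natCast hi hi', pow_mul]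
  rfl

theorem gpow_pow_val (hi : 1 ≤ i) (hi' : i ≤ K) (a b : ZMod Γ.N) :
    Γ.gpow i a ^ b.val = Γ.gpow i (a * b) := by
  rw [← Γ.gpow_mul_natCast hi hi', ZMod.natCast_zmod_val]

theorem gpow_sub (hi : 1 ≤ i) (hi' : i ≤ K) (a b : ZMod Γ.N) :
    Γ.gpow i (a - b) = Γ.gpow i a / Γ.gpow i b := by
  rw [eq_div_iff_mul_eq', ← Γ.gpow_add hi hi', sub_add_cancel]

theorem gpow_sum {ι : Type} (s : Finset ι) (a : ι → ZMod Γ.N) (hi : 1 ≤ i) (hi' : i ≤ K) :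
    Γ.gpow i (∑ l ∈ s, a l) = ∏ l ∈ s, Γ.gpow i (a l) := by
  classical
  induction s using Finset.induction_on with
  | empty => simp [gpow_zero]
  | insert b s hb ih => rw [Finset.sum_insert hb, Finset.prod_insert hb, Γ.gpow_add hi hi', ih]

theorem gpow_injective (hi : 1 ≤ i) (hi' : i ≤ K) : Function.Injective (Γ.gpow i) := by
  intro a b h
  apply ZMod.val_injective
  refine pow_injOn_Iio_orderOf ?_ ?_ h <;> rw [Γ.orderOf_g hi hi'] <;> exact ZMod.val_lt _

theorem gpow_bijective (hi : 1 ≤ i) (hi' : i ≤ K) : Function.Bijective (Γ.gpow i) := by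
  rw [Fintype.bijective_iff_injective_and_card]
  exact ⟨Γ.gpow_injective hi hi', by rw [ZMod.card, Γ.card_eq i hi hi', N]⟩

theorem e_gpow (hi : 1 ≤ i) (hj : 1 ≤ j) (hij : i + j ≤ K) (a b : ZMod Γ.N) :
    Γ.e (Γ.gpow i a) (Γ.gpow j b) = Γ.gpow (i + j) (a * b) := by
  rw [gpow, gpow, Γ.e_pow i j hi hj hij, ← Γ.gpow_natCast (by omega) hij, Nat.cast_mul,
    ZMod.natCast_zmod_val, ZMod.natCast_zmod_val]

theorem map_gpow_uniform (hi : 1 ≤ i) (hi' : i ≤ K) :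
    (PMF.uniformOfFintype (ZMod Γ.N)).map (Γ.gpow i) = PMF.uniformOfFintype (Γ.G i) :=
  PMF.map_uniformOfFintype_of_bijective (Γ.gpow_bijective hi hi')

end MultilinearInstance

/-! ### Expectations -/

namespace PMF

open scoped ENNReal

variable {α β : Type}

/-- The expectation of a nonnegative function. -/
def mean (p : PMF α) (f : α → ℝ≥0∞) : ℝ≥0∞ := ∑' a, p a * f a

theorem bind_apply_eq_mean (p : PMF α) (f : α → PMF β) (b : β) :
    p.bind f b = p.mean fun a => f a b := rfl

theorem mean_mono {p : PMF α} {f g : α → ℝ≥0∞} (h : ∀ a ∈ p.support, f a ≤ g a) :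
    p.mean f ≤ p.mean g := by
  refine ENNReal.tsum_le_tsum fun a => ?_
  by_cases ha : a ∈ p.support
  · gcongr
    exact h a ha
  · rw [PMF.mem_support_iff, not_not] at ha
    simp [ha]

theorem mean_add (p : PMF α) (f g : α → ℝ≥0∞) :
    (p.mean fun a => f a + g a) = p.mean f + p.mean g := by
  simp only [mean, mul_add, ENNReal.tsum_add]

theorem mean_sum {ι : Type} (p : PMF α) (s : Finset ι) (f : ι → α → ℝ≥0∞) :
    (p.mean fun a => ∑ i ∈ s, f i a) = ∑ i ∈ s, p.mean (f i) := by
  simp only [mean, Finset.mul_sum]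
  exact Summable.tsum_finsetSum fun _ _ => ENNReal.summable

theorem mean_const (p : PMF α) (c : ℝ≥0∞) : (p.mean fun _ => c) = c := by
  rw [mean, ENNReal.tsum_mul_right, p.tsum_coe, one_mul]

theorem mean_const_mul (p : PMF α) (c : ℝ≥0∞) (f : α → ℝ≥0∞) :
    (p.mean fun a => c * f a) = c * p.mean f := by
  simp only [mean, mul_left_comm _ c, ENNReal.tsum_mul_left]

theorem mean_le {p : PMF α} {f : α → ℝ≥0∞} {c : ℝ≥0∞} (h : ∀ a ∈ p.support, f a ≤ c) :
    p.mean f ≤ c :=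
  (mean_mono h).trans_eq (p.mean_const c)

theorem mean_pure (a : α) (f : α → ℝ≥0∞) : (PMF.pure a).mean f = f a := by
  rw [mean, tsum_eq_single a]
  · simp
  · intro b hb
    simp [hb]

theorem mean_bind (p : PMF α) (g : α → PMF β) (f : β → ℝ≥0∞) :
    (p.bind g).mean f = p.mean fun a => (g a).mean f := by
  simp only [mean, PMF.bind_apply, ← ENNReal.tsum_mul_right, ← ENNReal.tsum_mul_left]
  rw [ENNReal.tsum_comm]
  simp only [mul_assoc]

theorem mean_map (p : PMF α) (g : α → β) (f : β → ℝ≥0∞) :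
    (p.map g).mean f = p.mean fun a => f (g a) := by
  rw [PMF.map, mean_bind]
  simp only [Function.comp, mean_pure]

theorem mean_uniform [Fintype α] [Nonempty α] (f : α → ℝ≥0∞) :
    (PMF.uniformOfFintype α).mean f = (Fintype.card α : ℝ≥0∞)⁻¹ * ∑ a, f a := by
  simp only [mean, PMF.uniformOfFintype_apply, tsum_fintype, Finset.mul_sum]

theorem mul_mean_below (m : ℕ) (f : ℕ → ℝ≥0∞) :
    m * (PMF.below m).mean f = ∑ i ∈ Finset.range m, f i := by
  rcases m with _ | m
  · simp
  · rw [PMF.below, mean_map, mean_uniform, ← mul_assoc, Fintype.card_fin, ENNReal.mul_inv_cancel,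
      one_mul, Finset.sum_range]
    · simp
    · exact ENNReal.natCast_ne_top _

theorem bind_congr_support {p : PMF α} {f g : α → PMF β} (h : ∀ a ∈ p.support, f a = g a) :
    p.bind f = p.bind g := by
  apply PMF.ext
  intro b
  rw [PMF.bind_apply, PMF.bind_apply]
  refine tsum_congr fun a => ?_
  by_cases ha : a ∈ p.support
  · rw [h a ha]
  · rw [PMF.mem_support_iff, not_not] at ha
    simp [ha]

theorem map_apply_of_injective (p : PMF α) {f : α → β} (hf : Function.Injective f) (a : α) :
    p.map f (f a) = p a := by
  classical
  rw [PMF.map_apply, tsum_eq_single a]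
  · simp
  · intro b hb
    rw [if_neg fun h => hb (hf h.symm)]

end PMF

/-! ### Random exponents are invertible -/

namespace MultilinearInstance

open scoped ENNReal Classical

variable {K : ℕ} (Γ : MultilinearInstance K)

/-- The probability that a random exponent is not invertible modulo `N`. -/
def badProb : ℝ≥0∞ := (PMF.uniformOfFintype (ZMod Γ.N)).mean fun v => if IsUnit v then 0 else 1

/-- A union bound over the two prime factors of `N`. -/
theorem badProb_le : Γ.badProb ≤ (Γ.p : ℝ≥0∞)⁻¹ + (Γ.q : ℝ≥0∞)⁻¹ := by
  have hp0 : (Γ.p : ℝ≥0∞) ≠ 0 := by exact_mod_cast Γ.p_prime.ne_zero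
  have hq0 : (Γ.q : ℝ≥0∞) ≠ 0 := by exact_mod_cast Γ.q_prime.ne_zero
  have hpt : (Γ.p : ℝ≥0∞) ≠ ∞ := ENNReal.natCast_ne_top _
  have hqt : (Γ.q : ℝ≥0∞) ≠ ∞ := ENNReal.natCast_ne_top _
  -- the non-units are the multiples of `p` and the multiples of `q`
  have hsum : (∑ v : ZMod Γ.N, if IsUnit v then (0 : ℝ≥0∞) else 1) ≤ Γ.q + Γ.p := by
    have hsub : (Finset.univ.filter fun v : ZMod Γ.N => ¬ IsUnit v) ⊆
        (Finset.range Γ.q).image (fun a => ((Γ.p * a : ℕ) : ZMod Γ.N)) ∪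
          (Finset.range Γ.p).image (fun a => ((Γ.q * a : ℕ) : ZMod Γ.N)) := by
      intro v hv
      have hv : ¬ IsUnit v := (Finset.mem_filter.1 hv).2
      have hval := ZMod.val_lt v
      have hcop : ¬ v.val.Coprime (Γ.p * Γ.q) := by
        rwa [← ZMod.natCast_zmod_val v, ZMod.isUnit_iff_coprime] at hv
      rw [Nat.coprime_mul_iff_right, not_and_or, Nat.coprime_comm,
        Γ.p_prime.coprime_iff_not_dvd, not_not, Nat.coprime_comm,
        Γ.q_prime.coprime_iff_not_dvd, not_not] at hcop
      rw [Finset.mem_union, Finset.mem_image, Finset.mem_image]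
      rcases hcop with ⟨a, ha⟩ | ⟨a, ha⟩
      · refine Or.inl ⟨a, Finset.mem_range.2 ?_, ?_⟩
        · rw [ha] at hval
          exact lt_of_mul_lt_mul_left hval (Nat.zero_le _)
        · rw [← ha, ZMod.natCast_zmod_val]
      · refine Or.inr ⟨a, Finset.mem_range.2 ?_, ?_⟩
        · rw [ha, N, mul_comm Γ.p] at hval
          exact lt_of_mul_lt_mul_left hval (Nat.zero_le _)
        · rw [← ha, ZMod.natCast_zmod_val]
    have hcard := (Finset.card_le_card hsub).trans (Finset.card_union_le _ _)
    have h1 := Finset.card_image_le (s := Finset.range Γ.q)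
      (f := fun a => ((Γ.p * a : ℕ) : ZMod Γ.N))
    have h2 := Finset.card_image_le (s := Finset.range Γ.p)
      (f := fun a => ((Γ.q * a : ℕ) : ZMod Γ.N))
    rw [Finset.card_range] at h1 h2
    have : (∑ v : ZMod Γ.N, if IsUnit v then (0 : ℝ≥0∞) else 1) =
        ((Finset.univ.filter fun v : ZMod Γ.N => ¬ IsUnit v).card : ℝ≥0∞) := by
      rw [Finset.card_filter]
      push_cast
      refine Finset.sum_congr rfl fun v _ => ?_
      by_cases h : IsUnit v <;> simp [h]
    rw [this]
    exact_mod_cast hcard.trans (add_le_add h1 h2)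
  have hN : (Γ.N : ℝ≥0∞) = Γ.p * Γ.q := Nat.cast_mul _ _
  rw [badProb, PMF.mean_uniform, ZMod.card, hN,
    ENNReal.mul_inv (Or.inl hp0) (Or.inl hpt)]
  refine (mul_le_mul_right hsum _).trans_eq ?_
  rw [mul_add, mul_assoc, ENNReal.inv_mul_cancel hq0 hqt, mul_one, mul_right_comm,
    ENNReal.inv_mul_cancel hp0 hpt, one_mul]

end MultilinearInstance

namespace MultilinearGenerator

open scoped ENNReal

variable {K : ℕ} (𝒢 : MultilinearGenerator K)

/-- The probability that a random exponent for a random instance is not invertible. -/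
def badProb (lam : ℕ) : ℝ≥0∞ := (𝒢.sample lam).mean fun w => (𝒢.inst w).badProb

theorem badProb_le {lam : ℕ} (h : 2 ≤ lam) :
    𝒢.badProb lam ≤ ENNReal.ofReal (4 * (1 / 2 : ℝ) ^ lam) := by
  refine PMF.mean_le fun w hw => ((𝒢.inst w).badProb_le).trans ?_
  have key : ∀ m : ℕ, Nat.size m = lam →
      (m : ℝ≥0∞)⁻¹ ≤ ENNReal.ofReal (2 * (1 / 2 : ℝ) ^ lam) := by
    intro m hm
    have h1 : 2 ^ (lam - 1) ≤ m := Nat.lt_size.1 (by omega)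
    have h2 : (2 : ℝ) ^ (lam - 1) ≤ m := by exact_mod_cast h1
    have h3 : (0 : ℝ) < m := lt_of_lt_of_le (by positivity) h2
    rw [← ENNReal.ofReal_natCast, ← ENNReal.ofReal_inv_of_pos h3]
    refine ENNReal.ofReal_le_ofReal ?_
    rw [inv_le_comm₀ h3 (by positivity)]
    refine le_trans (le_of_eq ?_) h2
    obtain ⟨l, rfl⟩ : ∃ l, lam = l + 1 := ⟨lam - 1, by omega⟩
    rw [Nat.add_sub_cancel, pow_succ, one_div, inv_pow]
    field_simp
  refine (add_le_add (key _ (𝒢.size_p lam h w hw)) (key _ (𝒢.size_q lam h w hw))).trans_eq ?_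
  rw [← ENNReal.ofReal_add (by positivity) (by positivity)]
  congr 1
  ring

theorem badProb_ne_top {lam : ℕ} (h : 2 ≤ lam) : 𝒢.badProb lam ≠ ∞ :=
  ((𝒢.badProb_le h).trans_lt ENNReal.ofReal_lt_top).ne

end MultilinearGenerator

theorem Negligible.mono {f g : ℕ → ℝ} (hg : Negligible g)
    (h : ∀ᶠ lam in Filter.atTop, |f lam| ≤ g lam) : Negligible f :=
  Asymptotics.SuperpolynomialDecay.trans_eventually_abs_le hg
    (h.mono fun _ hx => hx.trans (le_abs_self _))

theorem negligible_half_pow : Negligible fun lam => (1 / 2 : ℝ) ^ lam := fun m =>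
  tendsto_pow_const_mul_const_pow_of_abs_lt_one m (by norm_num [abs_of_pos])

theorem Negligible.polynomial_mul {f : ℕ → ℝ} (hf : Negligible f) (P : ℕ[X]) :
    Negligible fun lam => ((P.eval lam : ℕ) : ℝ) * f lam := by
  refine (Asymptotics.SuperpolynomialDecay.polynomial_mul hf (P.map (Nat.castRingHom ℝ))).congr
    fun lam => ?_
  rw [Polynomial.eval_natCast_map]
  rfl

theorem Negligible.add {f g : ℕ → ℝ} (hf : Negligible f) (hg : Negligible g) :
    Negligible fun lam => f lam + g lam :=
  Asymptotics.SuperpolynomialDecay.add hf hg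

theorem MultilinearGenerator.negligible_badProb {K : ℕ} (𝒢 : MultilinearGenerator K) :
    Negligible fun lam => (𝒢.badProb lam).toReal := by
  refine (negligible_half_pow.polynomial_mul 4).mono ?_
  filter_upwards [Filter.eventually_ge_atTop 2] with lam h
  rw [abs_of_nonneg ENNReal.toReal_nonneg]
  refine ENNReal.toReal_le_of_le_ofReal (by positivity) ((𝒢.badProb_le h).trans_eq ?_)
  simp

/-! ### Input privacy -/

/-- A bit as a datum. -/
def Val.bit (b : Bool) : Val := .num b.toNat

theorem Val.bit_injective : Function.Injective Val.bit := by
  intro a b h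
  cases a <;> cases b <;> simp_all [Val.bit]

theorem PolyKernel.uniformBool {X : Type} {ctx : X → Val} :
    PolyKernel ctx fun _ => (PMF.uniformOfFintype Bool).map Val.bit := by
  refine (PolyKernel.below (PolyFun.const (.num 2))).congr fun _ => ?_
  rw [← PMF.map_uniformOfFintype_of_bijective finTwoEquiv.bijective, PMF.map_comp, PMF.below,
    PMF.map_comp]
  congr 1
  funext i
  fin_cases i <;> rfl

open Classical in
theorem PolyFun.decideBit {X : Type} {ctx v : X → Val} {b : X → Bool} (hv : PolyFun ctx v)
    (hb : PolyFun ctx fun x => Val.bit (b x)) :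
    PolyFun ctx fun x => Val.bit (decide (v x = .num (if b x then 1 else 0))) := by
  refine ((hv.isPair.decideEq (.const (.num 0))).mul (hv.toNat.decideEq hb)).congr fun x => ?_
  rcases v x with m | ⟨c, d⟩
  · cases hbx : b x <;> by_cases hm : m = 0 <;> by_cases hm' : m = 1 <;>
      simp_all [Val.isPair, Val.toNat, Val.bit]
  · simp [Val.isPair, Val.bit]

section

variable {n : ℕ} {𝒢 : MultilinearGenerator (2 * logDeg n + 1)} {F : PolyFamily n}

open Classical in
variable (F) in
/-- The privacy experiment after the choice of the two inputs `x₀` and `x₁`. -/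
def PE.priChallenge (A : PriAdversary) (pk : PE.PublicKey 𝒢) (st tr : Val) (x₀ x₁ : ℕ) :
    PMF Bool :=
  (PMF.uniformOfFintype Bool).bind fun b =>
  (pk.inst.encryptK pk.h (logDeg n) ((if b then x₁ else x₀ : ℕ) : ZMod pk.inst.N)).bind fun σ =>
  (PMF.iterate (PE.oracleStep F pk A.query' st) (A.rounds.eval pk.lam)
    (.pair (.pair (.num x₀) (.pair (.num x₁) (Val.list (σ.map pk.inst.elt)))) tr)).bind fun tr' =>
  (A.guess.output (.pair st tr')).bind fun b' =>
  PMF.pure (decide (b' = .num (if b then 1 else 0)))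

variable (F) in
/-- The privacy experiment after the adversary's announcement of two inputs. -/
def PE.priAnnounced (A : PriAdversary) (pk : PE.PublicKey 𝒢) (st tr v : Val) : PMF Bool :=
  match (PE.scheme n 𝒢 F).readInput pk.lam v.fst with
  | none => PMF.pure false
  | some x₀ =>
    match (PE.scheme n 𝒢 F).readInput pk.lam v.snd with
    | none => PMF.pure false
    | some x₁ => PE.priChallenge F A pk st tr x₀ x₁

variable (F) in
/-- The privacy experiment after the choice of the public key. -/
def PE.priGame (A : PriAdversary) (pk : PE.PublicKey 𝒢) : PMF Bool :=
  (A.setup.output ((PE.scheme n 𝒢 F).pkVal pk)).bind fun st =>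
  (PMF.iterate (PE.oracleStep F pk A.query st) (A.rounds.eval pk.lam) (.num 0)).bind fun tr =>
  (A.challenge.output (.pair st tr)).bind fun v => PE.priAnnounced F A pk st tr v

/-- The public key with secret exponent `s` and with the group element `h`. -/
def PE.mkKey (lam : ℕ) (w : 𝒢.Idx) (s : ZMod (𝒢.inst w).N) (h : (𝒢.inst w).G 1) :
    PE.PublicKey 𝒢 :=
  ⟨lam, w, h, (List.range (logDeg n)).map fun ℓ => (𝒢.inst w).gpow 1 (s ^ 2 ^ ℓ)⟩

theorem PE.scheme_keyGen_bind (lam : ℕ) {β : Type}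
    (f : (Σ pk : PE.PublicKey 𝒢, PE.SecretKey pk) → PMF β) :
    ((PE.scheme n 𝒢 F).keyGen lam).bind f =
      (𝒢.sample lam).bind fun w =>
      (PMF.uniformOfFintype (ZMod (𝒢.inst w).N)).bind fun s =>
      (PMF.uniformOfFintype ((𝒢.inst w).G 1)).bind fun u =>
      f ⟨PE.mkKey lam w s (u ^ (𝒢.inst w).q),
        ⟨s, (𝒢.inst w).gpow 1 (evalMod (F.poly lam) (𝒢.inst w).N s)⟩⟩ := by
  have key : ∀ (μ : PMF 𝒢.Idx) (ν : ∀ w, PMF (ZMod (𝒢.inst w).N)) (η : ∀ w, PMF ((𝒢.inst w).G 1))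
      (g : ∀ w, ZMod (𝒢.inst w).N → (𝒢.inst w).G 1 → Σ pk : PE.PublicKey 𝒢, PE.SecretKey pk),
      (μ.bind fun w => (ν w).bind fun s => (η w).bind fun u => PMF.pure (g w s u)).bind f =
      μ.bind fun w => (ν w).bind fun s => (η w).bind fun u => f (g w s u) := by
    intro μ ν η g
    simp only [PMF.bind_bind, PMF.pure_bind]
  exact key _ _ _ _

open Classical in
theorem PE.priExp_eq (A : PriAdversary) (lam : ℕ) : (PE.scheme n 𝒢 F).priExp A lam =
    (𝒢.sample lam).bind fun w =>
      (PMF.uniformOfFintype (ZMod (𝒢.inst w).N)).bind fun s =>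
      (PMF.uniformOfFintype ((𝒢.inst w).G 1)).bind fun u =>
      PE.priGame F A (PE.mkKey lam w s (u ^ (𝒢.inst w).q)) := by
  refine (PE.scheme_keyGen_bind (F := F) lam _).trans ?_
  refine congrArg _ (funext fun w => congrArg _ (funext fun s => congrArg _ (funext fun u => ?_)))
  generalize (PE.SecretKey.mk s ((𝒢.inst w).gpow 1 (evalMod (F.poly lam) (𝒢.inst w).N s)) :
    PE.SecretKey (PE.mkKey lam w s (u ^ (𝒢.inst w).q))) = sk
  revert sk
  generalize hpk : PE.mkKey lam w s (u ^ (𝒢.inst w).q) = pk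
  intro sk
  obtain rfl : lam = pk.lam := by rw [← hpk]; rfl
  refine congrArg (PMF.bind _) (funext fun st => congrArg₂ PMF.bind (PE.queries_eq ..)
    (funext fun tr => congrArg (PMF.bind _) (funext fun v => ?_)))
  unfold PE.priAnnounced
  rcases (PE.scheme n 𝒢 F).readInput pk.lam v.fst with _ | x₀
  · rfl
  rcases (PE.scheme n 𝒢 F).readInput pk.lam v.snd with _ | x₁
  · rfl
  refine congrArg (PMF.bind _) (funext fun b => ?_)
  refine (PE.scheme_probGen_bind (F := F) pk sk _ fun σ _ =>
    ((PE.scheme n 𝒢 F).queries pk.lam pk sk A.query' st (A.rounds.eval pk.lam)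
      (.pair (.pair (.num x₀) (.pair (.num x₁) (Val.list (σ.map pk.inst.elt)))) tr)).bind fun tr' =>
    (A.guess.output (.pair st tr')).bind fun b' =>
    PMF.pure (decide (b' = .num (if b then 1 else 0)))).trans
    (congrArg (PMF.bind _) (funext fun σ => ?_))
  exact congrArg₂ PMF.bind (PE.queries_eq ..) rfl

/-- A public key is computed from the powers `g_1^(s^(2^ℓ))`. -/
theorem GroupData.keyData {X : Type} {ctx : X → Val} {lam : X → ℕ} {w : X → 𝒢.Idx}
    (hG : GroupData 𝒢 ctx lam w) {s : ∀ x, ZMod (𝒢.inst (w x)).N}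
    (hs : ∀ ℓ < logDeg n, PolyFun ctx fun x =>
      (𝒢.inst (w x)).elt ((𝒢.inst (w x)).gpow 1 (s x ^ 2 ^ ℓ)))
    {h : ∀ x, (𝒢.inst (w x)).G 1} (hh : PolyFun ctx fun x => (𝒢.inst (w x)).elt (h x)) :
    KeyData F ctx fun x => PE.mkKey (lam x) (w x) (s x) (h x) := by
  refine ⟨hG.mem, ?_⟩
  refine PolyFun.congr (hG.lam_fun.pair (hG.inst_fun.pair (hh.pair (PolyFun.pair
    (PolyFun.list (m := logDeg n) hs) (PolyFun.pair (PolyFun.list (m := n + 1)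
      fun i hi => PolyFun.coeff (F := F) hG.lam_fun i (by omega)) (.const (.num 0)))))))
    fun x => ?_
  simp only [PE.scheme, PE.mkKey, List.map_map]
  rfl

theorem GroupData.gpow_pow {X : Type} {ctx : X → Val} {lam : X → ℕ} {w : X → 𝒢.Idx}
    (hG : GroupData 𝒢 ctx lam w) {s : ∀ x, ZMod (𝒢.inst (w x)).N}
    (hs : PolyFun ctx fun x => .num (s x).val) (m : ℕ) :
    PolyFun ctx fun x => (𝒢.inst (w x)).elt ((𝒢.inst (w x)).gpow 1 (s x ^ m)) := by
  refine hG.gpow (i := 1) le_rfl (by omega) (((hs.natPow m).mod hG.order).congr fun x => ?_)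
  rw [← ZMod.val_natCast, Nat.cast_pow, ZMod.natCast_zmod_val]

variable {X : Type} {ctx : X → Val} {pk : X → PE.PublicKey 𝒢}

/-- A call of an adversary, in the form required by `PolyKernel.bind`. -/
theorem Code.PPT.polyKernel_map {c : Code} (hc : c.PPT) {f : X → Val} (hf : PolyFun ctx f) :
    PolyKernel ctx fun x => (c.output (f x)).map fun v => v :=
  PolyKernel.congr (PolyKernel.comp hc.polyKernel hf) fun _ => (PMF.map_id _).symm

theorem PolyFun.selectNat {a b : X → ℕ} {c : X → Bool} (ha : PolyFun ctx fun x => .num (a x))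
    (hb : PolyFun ctx fun x => .num (b x)) (hc : PolyFun ctx fun x => Val.bit (c x)) :
    PolyFun ctx fun x => .num (if c x then a x else b x) :=
  (PolyFun.ite (fun x => (c x).toNat ≠ 0) (PolyFun.decideNe hc) ha hb).congr fun x => by
    cases c x <;> simp

theorem KeyData.priChallenge (h : KeyData F ctx pk) (A : PriAdversary) {st tr : X → Val}
    (hst : PolyFun ctx st) (htr : PolyFun ctx tr) {x₀ x₁ : X → ℕ}
    (h₀ : PolyFun ctx fun x => .num (x₀ x)) (h₁ : PolyFun ctx fun x => .num (x₁ x)) :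
    PolyKernel ctx fun x =>
      (PE.priChallenge F A (pk x) (st x) (tr x) (x₀ x) (x₁ x)).map Val.bit := by
  simp only [PE.priChallenge, PMF.map_bind, PMF.pure_map]
  refine PolyKernel.bind (Y := fun _ => Bool) (fun _ b => Val.bit b) PolyKernel.uniformBool ?_
  refine PolyKernel.bind (Y := fun z : Σ _ : X, Bool => List ((pk z.1).inst.G 1))
    (fun z σ => Val.list (σ.map (pk z.1).inst.elt))
    (h.weaken.encryptK (PolyFun.selectNat h₁.weaken h₀.weaken PolyFun.top)) ?_
  refine PolyKernel.bind (Y := fun _ => Val) (fun _ v => v) (PolyKernel.congr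
    ((h.via (Sigma.fst ∘ Sigma.fst) PolyFun.self.fst.fst).queries A.query'_ppt
      (hst.via (Sigma.fst ∘ Sigma.fst) PolyFun.self.fst.fst) (PolyFun.pair
        (PolyFun.pair (h₀.via (Sigma.fst ∘ Sigma.fst) PolyFun.self.fst.fst)
          (PolyFun.pair (h₁.via (Sigma.fst ∘ Sigma.fst) PolyFun.self.fst.fst) PolyFun.top))
        (htr.via (Sigma.fst ∘ Sigma.fst) PolyFun.self.fst.fst)) A.rounds)
    fun _ => (PMF.map_id _).symm) ?_
  refine PolyKernel.bind (Y := fun _ => Val) (fun _ v => v) (A.guess_ppt.polyKernel_map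
    (PolyFun.pair (hst.via (Sigma.fst ∘ Sigma.fst ∘ Sigma.fst) PolyFun.self.fst.fst.fst)
      PolyFun.top)) ?_
  refine PolyFun.decideBit ?_ ?_
  · exact PolyFun.top
  · exact PolyFun.self.fst.fst.fst.snd

theorem KeyData.priAnnounced (h : KeyData F ctx pk) (A : PriAdversary) {st tr v : X → Val}
    (hst : PolyFun ctx st) (htr : PolyFun ctx tr) (hv : PolyFun ctx v) :
    PolyKernel ctx fun x => (PE.priAnnounced F A (pk x) (st x) (tr x) (v x)).map Val.bit := by
  have hF : ∀ {X' : Type} {c : X' → Val}, PolyKernel c fun _ => PMF.pure (Val.bit false) :=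
    PolyFun.const _
  have h₁ : PolyKernel (fun z : Σ z : Σ x : X, {a : ℕ // a ∈ F.dom (pk x).lam},
      {a : ℕ // a ∈ F.dom (pk z.1).lam} => .pair (.pair (ctx z.1.1) (.num z.1.2)) (.num z.2))
      fun z => (PE.priChallenge F A (pk z.1.1) (st z.1.1) (tr z.1.1) z.1.2 z.2).map Val.bit := by
    have hc : PolyFun (fun z : Σ z : Σ x : X, {a : ℕ // a ∈ F.dom (pk x).lam},
      {a : ℕ // a ∈ F.dom (pk z.1).lam} => .pair (.pair (ctx z.1.1) (.num z.1.2)) (.num z.2))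
      fun z => ctx z.1.1 := PolyFun.self.fst.fst
    exact (h.via _ hc).priChallenge A (hst.via _ hc) (htr.via _ hc) PolyFun.self.fst.snd
      PolyFun.top
  have h₂ : PolyKernel (fun z : Σ x : X, {a : ℕ // a ∈ F.dom (pk x).lam} =>
      .pair (ctx z.1) (.num z.2))
      fun z => match (PE.scheme n 𝒢 F).readInput (pk z.1).lam (v z.1).snd with
      | none => PMF.pure (Val.bit false)
      | some x₁ => (PE.priChallenge F A (pk z.1) (st z.1) (tr z.1) z.2 x₁).map Val.bit :=
    PolyKernel.readInput (n := n) (𝒢 := 𝒢) (F := F)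
      (X := Σ x : X, {a : ℕ // a ∈ F.dom (pk x).lam}) (lam := fun z => (pk z.1).lam)
      (v := fun z => (v z.1).snd) (G₀ := fun _ => PMF.pure (Val.bit false))
      h.weaken.groupData.lam_fun hv.snd.weaken hF
      (G := fun z x₁ => (PE.priChallenge F A (pk z.1) (st z.1) (tr z.1) z.2 x₁).map Val.bit) h₁
  refine (PolyKernel.readInput (n := n) (𝒢 := 𝒢) (F := F) h.groupData.lam_fun
    hv.fst hF (G := fun x x₀ => match (PE.scheme n 𝒢 F).readInput (pk x).lam (v x).snd with
      | none => PMF.pure (Val.bit false)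
      | some x₁ => (PE.priChallenge F A (pk x) (st x) (tr x) x₀ x₁).map Val.bit) h₂).congr
    fun x => ?_
  unfold PE.priAnnounced
  rcases (PE.scheme n 𝒢 F).readInput (pk x).lam (v x).fst with _ | x₀
  · exact (PMF.pure_map _ _).symm
  rcases (PE.scheme n 𝒢 F).readInput (pk x).lam (v x).snd with _ | x₁
  · exact (PMF.pure_map _ _).symm
  · rfl

/-- The privacy game, for a given public key, is simulated in polynomial time without the secret
key. -/
theorem KeyData.priGame (h : KeyData F ctx pk) (A : PriAdversary) :
    PolyKernel ctx fun x => (PE.priGame F A (pk x)).map Val.bit := by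
  simp only [PE.priGame, PMF.map_bind]
  refine PolyKernel.bind (Y := fun _ => Val) (fun _ v => v)
    (A.setup_ppt.polyKernel_map h.pk_fun) ?_
  refine PolyKernel.bind (Y := fun _ => Val) (fun _ v => v) (PolyKernel.congr
    (h.weaken.queries A.query_ppt PolyFun.top (.const _) A.rounds) fun _ => (PMF.map_id _).symm) ?_
  refine PolyKernel.bind (Y := fun _ => Val) (fun _ v => v) (A.challenge_ppt.polyKernel_map
    (PolyFun.pair PolyFun.self.fst.snd PolyFun.top)) ?_
  exact KeyData.priAnnounced (h.via (Sigma.fst ∘ Sigma.fst ∘ Sigma.fst) PolyFun.self.fst.fst.fst) A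
    PolyFun.self.fst.fst.snd PolyFun.self.fst.snd PolyFun.top

end

section

open scoped ENNReal

/-- If `h` is a generator, the encodings of all inputs have the same distribution. -/
theorem MultilinearInstance.encryptK_congr {K : ℕ} (Γ : MultilinearInstance K) (hK : 1 ≤ K)
    {v : ZMod Γ.N} (hv : IsUnit v) (k : ℕ) (a a' : ZMod Γ.N) :
    Γ.encryptK (Γ.gpow 1 v) k a = Γ.encryptK (Γ.gpow 1 v) k a' := by
  have hbij : ∀ b : ZMod Γ.N,
      Function.Bijective fun r : ZMod Γ.N => Γ.gpow 1 b * Γ.gpow 1 v ^ r.val := by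
    intro b
    have : (fun r : ZMod Γ.N => Γ.gpow 1 b * Γ.gpow 1 v ^ r.val) =
        fun r => Γ.gpow 1 (b + v * r) := by
      funext r
      rw [Γ.gpow_pow_val le_rfl hK, Γ.gpow_add le_rfl hK]
    rw [this]
    refine (Γ.gpow_bijective le_rfl hK).comp ?_
    refine Finite.injective_iff_bijective.1 fun r r' h => ?_
    exact hv.mul_left_cancel (add_left_cancel h)
  have hstep : ∀ (b : ZMod Γ.N) (E : PMF (List (Γ.G 1))),
      ((PMF.uniformOfFintype (ZMod Γ.N)).bind fun r =>
        E.map fun l => Γ.gpow 1 b * Γ.gpow 1 v ^ r.val :: l) =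
      (PMF.uniformOfFintype (Γ.G 1)).bind fun c => E.map fun l => c :: l := by
    intro b E
    rw [← PMF.map_uniformOfFintype_of_bijective (hbij b), PMF.bind_map]
    rfl
  induction k generalizing a a' with
  | zero => rfl
  | succ k ih => rw [encryptK, encryptK, ih (a * a) (a' * a'), hstep, hstep]

variable {n : ℕ} {𝒢 : MultilinearGenerator (2 * logDeg n + 1)} {F : PolyFamily n}

/-- If `h` is a generator, the challenge bit is independent of all that the adversary sees. -/
theorem PE.priChallenge_le (A : PriAdversary) (pk : PE.PublicKey 𝒢) {v : ZMod pk.inst.N}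
    (hv : IsUnit v) (hh : pk.h = pk.inst.gpow 1 v) (st tr : Val) (x₀ x₁ : ℕ) :
    PE.priChallenge F A pk st tr x₀ x₁ true ≤ 2⁻¹ := by
  classical
  have hE : ∀ b : Bool, pk.inst.encryptK pk.h (logDeg n)
      ((if b then x₁ else x₀ : ℕ) : ZMod pk.inst.N) = pk.inst.encryptK pk.h (logDeg n) 0 := by
    intro b
    rw [hh]
    exact pk.inst.encryptK_congr (by omega) hv _ _ _
  unfold PE.priChallenge
  simp only [hE]
  rw [PMF.bind_comm, PMF.bind_apply_eq_mean]
  refine PMF.mean_le fun σ _ => ?_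
  rw [PMF.bind_comm, PMF.bind_apply_eq_mean]
  refine PMF.mean_le fun tr' _ => ?_
  rw [PMF.bind_comm, PMF.bind_apply_eq_mean]
  refine PMF.mean_le fun b' _ => ?_
  rw [PMF.bind_apply_eq_mean, PMF.mean_uniform, Fintype.card_bool, Fintype.sum_bool]
  refine (mul_le_of_le_one_right' (a := (2 : ℝ≥0∞)⁻¹) ?_)
  by_cases h : b' = .num 1
  · simp [h]
  · simp [h, PMF.pure_apply]
    split_ifs <;> simp

theorem PE.priGame_le (A : PriAdversary) (pk : PE.PublicKey 𝒢) {v : ZMod pk.inst.N}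
    (hv : IsUnit v) (hh : pk.h = pk.inst.gpow 1 v) : PE.priGame F A pk true ≤ 2⁻¹ := by
  unfold PE.priGame
  rw [PMF.bind_apply_eq_mean]
  refine PMF.mean_le fun st _ => ?_
  rw [PMF.bind_apply_eq_mean]
  refine PMF.mean_le fun tr _ => ?_
  rw [PMF.bind_apply_eq_mean]
  refine PMF.mean_le fun w _ => ?_
  unfold PE.priAnnounced
  rcases (PE.scheme n 𝒢 F).readInput pk.lam w.fst with _ | x₀
  · simp
  rcases (PE.scheme n 𝒢 F).readInput pk.lam w.snd with _ | x₁
  · simp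
  exact PE.priChallenge_le A pk hv hh _ _ _ _

/-- The privacy experiment run with a given group element `h`, as a kernel computed from the
challenge of the subgroup decision problem. -/
theorem PE.exists_sda_adversary (F : PolyFamily n) (A : PriAdversary) : ∃ c : Code, c.PPT ∧
    ∀ lam, ∀ w ∈ (𝒢.sample lam).support, ∀ h : (𝒢.inst w).G 1,
      c.output (Val.list [Val.unary lam, (𝒢.inst w).toVal, (𝒢.inst w).elt h]) =
        ((PMF.uniformOfFintype (ZMod (𝒢.inst w).N)).bind fun s =>
          PE.priGame F A (PE.mkKey lam w s h)).map Val.bit := by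
  let X := Σ x : {x : ℕ × 𝒢.Idx // x.2 ∈ (𝒢.sample x.1).support}, (𝒢.inst x.1.2).G 1
  let ctx : X → Val := fun x =>
    Val.list [Val.unary x.1.1.1, (𝒢.inst x.1.1.2).toVal, (𝒢.inst x.1.1.2).elt x.2]
  have hG : GroupData 𝒢 ctx (fun x => x.1.1.1) fun x => x.1.1.2 :=
    ⟨fun x => x.1.2, PolyFun.self.nth 0, PolyFun.self.nth 1⟩
  have hh : PolyFun ctx fun x => (𝒢.inst x.1.1.2).elt x.2 := PolyFun.self.nth 2
  obtain ⟨c, hc, hspec⟩ : PolyKernel ctx fun x =>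
      (PMF.uniformOfFintype (ZMod (𝒢.inst x.1.1.2).N)).bind fun s =>
        (PE.priGame F A (PE.mkKey x.1.1.1 x.1.1.2 s x.2)).map Val.bit := by
    refine PolyKernel.bind (Y := fun x : X => ZMod (𝒢.inst x.1.1.2).N) (fun x r => .num r.val)
      hG.uniform ?_
    exact KeyData.priGame (hG.weaken.keyData
      (fun ℓ _ => hG.weaken.gpow_pow PolyFun.top (2 ^ ℓ)) hh.weaken) A
  refine ⟨c, hc, fun lam w hw h => (hspec ⟨⟨⟨lam, w⟩, hw⟩, h⟩).trans ?_⟩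
  rw [PMF.map_bind]

/-- A distinguisher for the subgroup decision problem plays the privacy game with its challenge as
`h`. On `u^q` this is the game itself; on `u`, which generates `G_1` except with negligible
probability, the adversary can only guess. -/
theorem PE.inputPrivate (h : SDA 𝒢) : (PE.scheme n 𝒢 F).InputPrivate := by
  intro A
  obtain ⟨c, hc, hspec⟩ := PE.exists_sda_adversary (𝒢 := 𝒢) F A
  -- the game that the reduction plays on the challenge `u^q` or `u`
  have hgame : ∀ b lam, sdaGame 𝒢 1 c b lam = ((𝒢.sample lam).bind fun w =>
      (PMF.uniformOfFintype ((𝒢.inst w).G 1)).bind fun u =>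
      (PMF.uniformOfFintype (ZMod (𝒢.inst w).N)).bind fun s =>
      PE.priGame F A (PE.mkKey lam w s (if b then u ^ (𝒢.inst w).q else u))).map Val.bit := by
    intro b lam
    rw [PMF.map_bind]
    refine PMF.bind_congr_support fun w hw => ?_
    rw [PMF.map_bind]
    refine congrArg (PMF.bind _) (funext fun u => ?_)
    exact hspec lam w hw _
  -- on `u^q`, the reduction plays the privacy experiment
  have hreal : ∀ lam, sdaGame 𝒢 1 c true lam (.num 1) = (PE.scheme n 𝒢 F).priExp A lam true := by
    intro lam
    rw [hgame, show Val.num 1 = Val.bit true from rfl,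
      PMF.map_apply_of_injective _ Val.bit_injective, PE.priExp_eq]
    simp only [if_true]
    congr 2
    funext w
    exact PMF.bind_comm _ _ _
  -- on `u`, the challenge bit is hidden unless `u` fails to generate `G_1`
  have hideal : ∀ lam, sdaGame 𝒢 1 c false lam (.num 1) ≤ 2⁻¹ + 𝒢.badProb lam := by
    intro lam
    rw [hgame, show Val.num 1 = Val.bit true from rfl,
      PMF.map_apply_of_injective _ Val.bit_injective, PMF.bind_apply_eq_mean]
    have : 2⁻¹ + 𝒢.badProb lam = (𝒢.sample lam).mean fun w => 2⁻¹ + (𝒢.inst w).badProb := by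
      rw [PMF.mean_add, PMF.mean_const]
      rfl
    rw [this]
    refine PMF.mean_mono fun w _ => ?_
    rw [← (𝒢.inst w).map_gpow_uniform le_rfl (by omega), PMF.bind_map, PMF.bind_apply_eq_mean,
      ← (PMF.uniformOfFintype (ZMod (𝒢.inst w).N)).mean_const 2⁻¹, MultilinearInstance.badProb,
      ← PMF.mean_add]
    refine PMF.mean_mono fun v _ => ?_
    rw [Function.comp, PMF.bind_apply_eq_mean]
    simp only [Bool.false_eq_true, if_false]
    split_ifs with hv
    · rw [add_zero]
      exact PMF.mean_le fun s _ => PE.priGame_le A _ hv rfl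
    · exact PMF.mean_le fun s _ => (PMF.coe_le_one _ _).trans le_add_self
  refine ⟨fun lam => if 2 ≤ lam then
    |(sdaGame 𝒢 1 c false lam (.num 1)).toReal - (sdaGame 𝒢 1 c true lam (.num 1)).toReal| +
      (𝒢.badProb lam).toReal else 1, ?_, fun lam => ?_⟩
  · refine ((h 1 le_rfl (by omega) c hc).add 𝒢.negligible_badProb).mono ?_
    filter_upwards [Filter.eventually_ge_atTop 2] with lam hlam
    rw [if_pos hlam, abs_of_nonneg (by positivity)]
  · rw [prTrue]
    dsimp only
    split_ifs with hlam
    · have h1 := ENNReal.toReal_mono (by simp [𝒢.badProb_ne_top hlam]) (hideal lam)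
      rw [ENNReal.toReal_add (by simp) (𝒢.badProb_ne_top hlam)] at h1
      rw [← hreal]
      have h2 := neg_abs_le ((sdaGame 𝒢 1 c false lam (.num 1)).toReal -
        (sdaGame 𝒢 1 c true lam (.num 1)).toReal)
      have h3 : ((2 : ℝ≥0∞)⁻¹).toReal = 1 / 2 := by simp
      linarith
    · have := ENNReal.toReal_mono ENNReal.one_ne_top
        (PMF.coe_le_one ((PE.scheme n 𝒢 F).priExp A lam) true)
      rw [ENNReal.toReal_one] at this
      linarith

end

/-! ### Verification in terms of exponents modulo `q` -/

namespace MultilinearInstance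

variable {K : ℕ} (Γ : MultilinearInstance K) {i : ℕ}

/-- Reduction of exponents modulo `q`. -/
def modQ : ZMod Γ.N →+* ZMod Γ.q := ZMod.castHom (Dvd.intro_left Γ.p rfl) (ZMod Γ.q)

/-- Raising to the power `p` retains exactly the exponents modulo `q`. -/
theorem mul_p_eq_zero_iff (a : ZMod Γ.N) : a * Γ.p = 0 ↔ Γ.modQ a = 0 := by
  obtain ⟨m, rfl⟩ : ∃ m : ℕ, (m : ZMod Γ.N) = a := ⟨a.val, ZMod.natCast_zmod_val a⟩
  rw [map_natCast, ← Nat.cast_mul, ZMod.natCast_eq_zero_iff, ZMod.natCast_eq_zero_iff]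
  change Γ.p * Γ.q ∣ _ ↔ _
  rw [mul_comm m, Nat.mul_dvd_mul_iff_left Γ.p_prime.pos]

theorem mul_p_eq_iff (a b : ZMod Γ.N) : a * Γ.p = b * Γ.p ↔ Γ.modQ a = Γ.modQ b := by
  rw [← sub_eq_zero, ← sub_mul, mul_p_eq_zero_iff, map_sub, sub_eq_zero]

theorem pow_p_eq_iff (hi : 1 ≤ i) (hi' : i ≤ K) (a b : ZMod Γ.N) :
    Γ.gpow i a ^ Γ.p = Γ.gpow i b ^ Γ.p ↔ Γ.modQ a = Γ.modQ b := by
  rw [← Γ.gpow_mul_natCast hi hi', ← Γ.gpow_mul_natCast hi hi',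
    (Γ.gpow_injective hi hi').eq_iff, mul_p_eq_iff]

theorem modQ_evalMod (f : ℕ[X]) (s : ZMod Γ.N) :
    Γ.modQ (evalMod f Γ.N s) = evalMod f Γ.q (Γ.modQ s) := by
  rw [evalMod, Polynomial.hom_eval₂]
  congr 1
  ext
  simp

theorem exists_gpow (hi : 1 ≤ i) (hi' : i ≤ K) (x : Γ.G i) : ∃ a, x = Γ.gpow i a :=
  ((Γ.gpow_bijective hi hi').2 x).imp fun _ h => h.symm

theorem g_eq_gpow (hi : 1 ≤ i) (hi' : i ≤ K) : Γ.g i = Γ.gpow i 1 := by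
  have := Γ.gpow_natCast hi hi' 1
  rw [pow_one, Nat.cast_one] at this
  exact this.symm

end MultilinearInstance

namespace PE

open Classical in
theorem findLog_val {G : Type} [Group G] (a b : G) (M : List ℕ) :
    (findLog a b M).val = M.find? fun m => decide (b ^ m = a) := by
  induction M with
  | nil => rfl
  | cons m M ih =>
    rw [List.find?_cons]
    by_cases h : b ^ m = a
    · simp [findLog, Counted.op, h, bind, pure]
    · simp only [findLog, Counted.op, h, bind, decide_false]
      exact ih

/-- Verification, on group elements with exponents `T`, `R` and `P`, checks modulo `q` that `R` lies
in the domain of results and that `T - R = (s - α) P`; it returns `R`. -/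
theorem verifyAlg_val {K : ℕ} (Γ : MultilinearInstance K) {k : ℕ} (hk : 1 ≤ k)
    (hkK : 1 + (k + k) ≤ K) (M : List ℕ) (s T R P : ZMod Γ.N) (α : ℕ) (z : ZMod Γ.q) :
    (verifyAlg Γ k M s (Γ.gpow 1 T) α (Γ.gpow k R) (Γ.gpow (k + k) P)).val = some z ↔
      z = Γ.modQ R ∧ (∃ m ∈ M, (m : ZMod Γ.q) = Γ.modQ R) ∧
        Γ.modQ T - Γ.modQ R = (Γ.modQ s - α) * Γ.modQ P := by
  classical
  have h1 : 1 ≤ K := by omega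
  have h2 : k ≤ K := by omega
  have h3 : k + k ≤ K := by omega
  have hlog : ∀ m : ℕ, (Γ.g k ^ Γ.p) ^ m = Γ.gpow k R ^ Γ.p ↔ (m : ZMod Γ.q) = Γ.modQ R := by
    intro m
    rw [← pow_mul, mul_comm, pow_mul, ← Γ.gpow_natCast hk h2, Γ.pow_p_eq_iff hk h2, map_natCast]
  have hcheck : ∀ y : ℕ, (y : ZMod Γ.q) = Γ.modQ R →
      (Γ.e (Γ.gpow 1 T / Γ.g 1 ^ y) (Γ.g (k + k) ^ Γ.p) =
        Γ.e (Γ.gpow 1 s / Γ.g 1 ^ α) (Γ.gpow (k + k) P ^ Γ.p) ↔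
      Γ.modQ T - Γ.modQ R = (Γ.modQ s - α) * Γ.modQ P) := by
    intro y hy
    rw [← Γ.gpow_natCast le_rfl h1, ← Γ.gpow_natCast le_rfl h1, ← Γ.gpow_natCast (by omega) h3,
      ← Γ.gpow_sub le_rfl h1, ← Γ.gpow_sub le_rfl h1, ← Γ.gpow_mul_natCast (by omega) h3,
      Γ.e_gpow le_rfl (by omega) hkK, Γ.e_gpow le_rfl (by omega) hkK,
      (Γ.gpow_injective (by omega) hkK).eq_iff, ← mul_assoc, Γ.mul_p_eq_iff, map_sub, map_mul,
      map_sub, map_natCast, map_natCast, hy]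
  have hval : (verifyAlg Γ k M s (Γ.gpow 1 T) α (Γ.gpow k R) (Γ.gpow (k + k) P)).val =
      match (findLog (Γ.gpow k R ^ Γ.p) (Γ.g k ^ Γ.p) M).val with
      | none => none
      | some y => if Γ.e (Γ.gpow 1 T / Γ.g 1 ^ y) (Γ.g (k + k) ^ Γ.p) =
        Γ.e (Γ.gpow 1 s / Γ.g 1 ^ α) (Γ.gpow (k + k) P ^ Γ.p) then
          some (y : ZMod Γ.q) else none := by
    simp only [verifyAlg, Counted.op, bind]
    rcases (findLog (Γ.gpow k R ^ Γ.p) (Γ.g k ^ Γ.p) M).val with _ | y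
    · rfl
    · by_cases h : Γ.e (Γ.gpow 1 T / Γ.g 1 ^ y) (Γ.g (k + k) ^ Γ.p) =
        Γ.e (Γ.gpow 1 s / Γ.g 1 ^ α) (Γ.gpow (k + k) P ^ Γ.p) <;> simp [h, pure]
  rw [hval, findLog_val]
  rcases hf : M.find? fun m => decide ((Γ.g k ^ Γ.p) ^ m = Γ.gpow k R ^ Γ.p) with _ | y
  · simp only [List.find?_eq_none, decide_eq_true_eq, hlog] at hf
    simp only [reduceCtorEq, false_iff, not_and]
    rintro - ⟨m, hm, hmR⟩
    exact absurd hmR (hf m hm)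
  · have hy : (y : ZMod Γ.q) = Γ.modQ R := by
      rw [← hlog]
      simpa using List.find?_some hf
    have hyM : y ∈ M := List.mem_of_find?_eq_some hf
    simp only [hcheck y hy]
    constructor
    · intro h
      split_ifs at h with hc
      rw [← Option.some.inj h]
      exact ⟨hy, ⟨y, hyM, hy⟩, hc⟩
    · rintro ⟨rfl, -, hc⟩
      rw [if_pos hc, hy]

end PE

/-! ### Correctness -/

namespace MultilinearInstance

variable {K : ℕ} (Γ : MultilinearInstance K)

theorem multiPair_gpow {m : ℕ} (hm : 1 ≤ m) (hmK : m ≤ K) {x : ℕ → Γ.G 1} {c : ℕ → ZMod Γ.N}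
    (h : ∀ l < m, x l = Γ.gpow 1 (c l)) :
    Γ.multiPair m x = Γ.gpow m (∏ l ∈ Finset.range m, c l) := by
  induction m with
  | zero => omega
  | succ m ih =>
    rcases m with _ | m
    · simp [multiPair, h 0 (by omega)]
    · rw [multiPair, ih (by omega) (by omega) fun l hl => h l (by omega), h _ (by omega),
        Γ.e_gpow (by omega) le_rfl hmK, ← Finset.prod_range_succ]

/-- Binary expansion of an exponent. -/
theorem prod_testBit {M : Type} [CommMonoid M] (x : M) (k i : ℕ) :
    (∏ l ∈ Finset.range k, if i.testBit l then x ^ 2 ^ l else 1) = x ^ (i % 2 ^ k) := by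
  induction k with
  | zero => simp [Nat.mod_one]
  | succ k ih =>
    rw [Finset.prod_range_succ, ih, Nat.mod_pow_succ, ← Nat.toNat_testBit, pow_add]
    cases i.testBit k <;> simp

/-- The exponent modulo `q` of an encoded monomial. -/
theorem monomial_gpow {k : ℕ} (hk : 1 ≤ k) (hkK : k ≤ K) {l : List (Γ.G 1)} {x : ZMod Γ.q}
    (h : ∀ j < k, ∃ c, l.getD j 1 = Γ.gpow 1 c ∧ Γ.modQ c = x ^ 2 ^ j) {i : ℕ} (hi : i < 2 ^ k) :
    ∃ c, PE.monomial Γ k l i = Γ.gpow k c ∧ Γ.modQ c = x ^ i := by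
  choose! c hc hcx using h
  refine ⟨∏ j ∈ Finset.range k, if i.testBit j then c j else 1,
    Γ.multiPair_gpow hk hkK fun j hj => ?_, ?_⟩
  · split_ifs
    · exact hc j hj
    · exact Γ.g_eq_gpow le_rfl (by omega)
  · rw [map_prod]
    conv_rhs => rw [← Nat.mod_eq_of_lt hi]
    rw [← prod_testBit]
    refine Finset.prod_congr rfl fun j hj => ?_
    rw [apply_ite Γ.modQ, map_one]
    split_ifs
    · exact hcx j (Finset.mem_range.1 hj)
    · rfl

/-- If the exponent of `h` vanishes modulo `q`, so does the blinding of the encoded powers. -/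
theorem encryptK_getD (hK : 1 ≤ K) {η : ZMod Γ.N} (hη : Γ.modQ η = 0) (k : ℕ) :
    ∀ (a : ZMod Γ.N), ∀ σ ∈ (Γ.encryptK (Γ.gpow 1 η) k a).support, ∀ j < k,
      ∃ c, σ.getD j 1 = Γ.gpow 1 c ∧ Γ.modQ c = Γ.modQ a ^ 2 ^ j := by
  induction k with
  | zero => intro a σ _ j hj; omega
  | succ k ih =>
    intro a σ hσ j hj
    simp only [encryptK, PMF.mem_support_bind_iff, PMF.mem_support_map_iff] at hσ
    obtain ⟨r, -, l, hl, rfl⟩ := hσ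
    rcases j with _ | j
    · refine ⟨a + η * r, ?_, ?_⟩
      · rw [List.getD_cons_zero, Γ.gpow_add le_rfl hK, ← Γ.gpow_pow_val le_rfl hK]
      · rw [map_add, map_mul, hη, zero_mul, add_zero, pow_zero, pow_one]
    · rw [List.getD_cons_succ]
      obtain ⟨c, hc, hc'⟩ := ih _ l hl j (by omega)
      refine ⟨c, hc, ?_⟩
      rw [hc', map_mul, ← pow_two, ← pow_mul, pow_succ' 2 j]

theorem pow_q_gpow (hK : 1 ≤ K) (u : Γ.G 1) : ∃ η, u ^ Γ.q = Γ.gpow 1 η ∧ Γ.modQ η = 0 := by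
  obtain ⟨a, rfl⟩ := Γ.exists_gpow le_rfl hK u
  refine ⟨a * Γ.q, (Γ.gpow_mul_natCast le_rfl hK _ _).symm, ?_⟩
  rw [map_mul, map_natCast, ZMod.natCast_self, mul_zero]

end MultilinearInstance

theorem evalMod_eq_sum {f : ℕ[X]} {n : ℕ} (hf : f.natDegree ≤ n) {m : ℕ} (a : ZMod m) :
    evalMod f m a = ∑ i ∈ Finset.range (n + 1), (f.coeff i : ZMod m) * a ^ i := by
  rw [evalMod, Polynomial.eval₂_eq_sum_range' _ (Nat.lt_succ_of_le hf)]
  rfl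

/-- The identity behind the proof `π`: the quotient of `f(x) - f(a)` by `x - a`. -/
theorem evalMod_sub {f : ℕ[X]} {n : ℕ} (hf : f.natDegree ≤ n) {m : ℕ} (x a : ZMod m) :
    evalMod f m x - evalMod f m a = (x - a) * ∑ i ∈ Finset.range n,
      ∑ j ∈ Finset.range (i + 1), a ^ j * x ^ (i - j) * f.coeff (i + 1) := by
  rw [evalMod_eq_sum hf, evalMod_eq_sum hf, ← Finset.sum_sub_distrib, Finset.sum_range_succ',
    Finset.mul_sum]
  simp only [pow_zero, sub_self, add_zero]
  refine Finset.sum_congr rfl fun i _ => ?_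
  have h := Commute.geom_sum₂_mul (Commute.all a x) (i + 1)
  rw [← mul_sub, ← Finset.sum_mul, Nat.add_sub_cancel] at *
  linear_combination (f.coeff (i + 1) : ZMod m) * h

namespace MultilinearInstance

variable {K : ℕ} (Γ : MultilinearInstance K) {k n : ℕ} {f : ℕ[X]} {l l' : List (Γ.G 1)}
  {x y : ZMod Γ.q}

/-- The honest encoded output has the exponent `f(x)` modulo `q`. -/
theorem rho_gpow (hk : 1 ≤ k) (hkK : k ≤ K) (hn : n < 2 ^ k) (hf : f.natDegree ≤ n)
    (hl : ∀ j < k, ∃ c, l.getD j 1 = Γ.gpow 1 c ∧ Γ.modQ c = x ^ 2 ^ j) :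
    ∃ R, ∏ i ∈ Finset.range (n + 1), PE.monomial Γ k l i ^ f.coeff i = Γ.gpow k R ∧
      Γ.modQ R = evalMod f Γ.q x := by
  have ha := fun i (hi : i < 2 ^ k) => Γ.monomial_gpow hk hkK hl hi
  choose! a ha hax using ha
  refine ⟨∑ i ∈ Finset.range (n + 1), a i * f.coeff i, ?_, ?_⟩
  · rw [Γ.gpow_sum _ _ hk hkK]
    refine Finset.prod_congr rfl fun i hi => ?_
    rw [Finset.mem_range] at hi
    rw [Γ.gpow_mul_natCast hk hkK, ← ha i (by omega)]
  · rw [evalMod_eq_sum hf, map_sum]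
    refine Finset.sum_congr rfl fun i hi => ?_
    rw [Finset.mem_range] at hi
    rw [map_mul, map_natCast, hax i (by omega), mul_comm]

/-- The honest proof has the exponent `(f(y) - f(x)) / (y - x)` modulo `q`, written as a
polynomial. -/
theorem pi_gpow (hk : 1 ≤ k) (hkK : k + k ≤ K) (hn : n < 2 ^ k)
    (hl : ∀ j < k, ∃ c, l.getD j 1 = Γ.gpow 1 c ∧ Γ.modQ c = x ^ 2 ^ j)
    (hl' : ∀ j < k, ∃ c, l'.getD j 1 = Γ.gpow 1 c ∧ Γ.modQ c = y ^ 2 ^ j) :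
    ∃ P, (∏ i ∈ Finset.range n, ∏ j ∈ Finset.range (i + 1),
      Γ.e (PE.monomial Γ k l j) (PE.monomial Γ k l' (i - j)) ^ f.coeff (i + 1)) =
        Γ.gpow (k + k) P ∧
      Γ.modQ P = ∑ i ∈ Finset.range n, ∑ j ∈ Finset.range (i + 1),
        x ^ j * y ^ (i - j) * f.coeff (i + 1) := by
  have ha := fun i (hi : i < 2 ^ k) => Γ.monomial_gpow hk (by omega) hl hi
  have hb := fun i (hi : i < 2 ^ k) => Γ.monomial_gpow hk (by omega) hl' hi
  choose! a ha hax using ha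
  choose! b hb hby using hb
  refine ⟨∑ i ∈ Finset.range n, ∑ j ∈ Finset.range (i + 1), a j * b (i - j) * f.coeff (i + 1),
    ?_, ?_⟩
  · rw [Γ.gpow_sum _ _ (by omega) (by omega)]
    refine Finset.prod_congr rfl fun i hi => ?_
    rw [Γ.gpow_sum _ _ (by omega) (by omega)]
    refine Finset.prod_congr rfl fun j hj => ?_
    rw [Finset.mem_range] at hi hj
    rw [Γ.gpow_mul_natCast (by omega) (by omega), ← Γ.e_gpow hk hk (by omega),
      ← ha j (by omega), ← hb (i - j) (by omega)]
  · rw [map_sum]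
    refine Finset.sum_congr rfl fun i hi => ?_
    rw [map_sum]
    refine Finset.sum_congr rfl fun j hj => ?_
    rw [Finset.mem_range] at hi hj
    rw [map_mul, map_mul, map_natCast, hax j (by omega), hby (i - j) (by omega)]

end MultilinearInstance

theorem List.getD_map_range {α : Type} (f : ℕ → α) (d : α) {j k : ℕ} (hj : j < k) :
    ((List.range k).map f).getD j d = f j := by
  rw [List.getD_eq_getElem _ _ (by simpa using hj)]
  simp

theorem logDeg_pos {n : ℕ} (hn : 1 ≤ n) : 1 ≤ logDeg n :=
  Nat.clog_pos (by norm_num) (by omega)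

theorem lt_two_pow_logDeg (n : ℕ) : n < 2 ^ logDeg n :=
  Nat.le_pow_clog (by norm_num) (n + 1)

theorem PE.correct {n : ℕ} (hn : 1 ≤ n) {𝒢 : MultilinearGenerator (2 * logDeg n + 1)}
    {F : PolyFamily n} (hF : F.Admissible 𝒢) : (PE.scheme n 𝒢 F).Correct := by
  have hk := logDeg_pos hn
  have hlt := lt_two_pow_logDeg n
  intro lam key hkey α hα c hc
  obtain ⟨w, hw, s, u, rfl⟩ : ∃ w ∈ (𝒢.sample lam).support, ∃ s u, key =
      ⟨PE.mkKey lam w s (u ^ (𝒢.inst w).q),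
        ⟨s, (𝒢.inst w).gpow 1 (evalMod (F.poly lam) (𝒢.inst w).N s)⟩⟩ := by
    have h := (PMF.bind_pure ((PE.scheme n 𝒢 F).keyGen lam)).symm.trans
      (PE.scheme_keyGen_bind (𝒢 := 𝒢) (F := F) lam PMF.pure)
    rw [h] at hkey
    obtain ⟨w, hw, hkey⟩ := (PMF.mem_support_bind_iff _ _ _).1 hkey
    obtain ⟨s, -, hkey⟩ := (PMF.mem_support_bind_iff _ _ _).1 hkey
    obtain ⟨u, -, hkey⟩ := (PMF.mem_support_bind_iff _ _ _).1 hkey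
    exact ⟨w, hw, s, u, (PMF.mem_support_pure_iff _ _).1 hkey⟩
  obtain ⟨η, hη, hη0⟩ := (𝒢.inst w).pow_q_gpow (by omega) u
  -- the encoded powers of the input
  obtain ⟨σ, hσ, hc1, hc2⟩ :
      ∃ σ ∈ ((𝒢.inst w).encryptK ((𝒢.inst w).gpow 1 η) (logDeg n) α).support,
        c.val.1 = σ ∧ c.val.2 = α := by
    rw [← hη]
    have h := PE.scheme_probGen_map (F := F) (PE.mkKey lam w s (u ^ (𝒢.inst w).q))
      ⟨s, (𝒢.inst w).gpow 1 (evalMod (F.poly lam) (𝒢.inst w).N s)⟩ α fun σ α => (σ, α)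
    have h' := (PMF.mem_support_map_iff (fun c => (c.val.1, c.val.2)) _ (c.val.1, c.val.2)).2
      ⟨c, hc, rfl⟩
    obtain ⟨σ, hσ, hσc⟩ := (PMF.mem_support_map_iff _ _ _).1 (h ▸ h')
    exact ⟨σ, hσ, (congrArg Prod.fst hσc).symm, (congrArg Prod.snd hσc).symm⟩
  have hl := (𝒢.inst w).encryptK_getD (by omega) hη0 _ _ σ hσ
  rw [map_natCast] at hl
  -- the encoded powers of the secret
  have hl' : ∀ j < logDeg n, ∃ d, (PE.mkKey lam w s (u ^ (𝒢.inst w).q)).xi.getD j 1 =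
      (𝒢.inst w).gpow 1 d ∧ (𝒢.inst w).modQ d = (𝒢.inst w).modQ s ^ 2 ^ j :=
    fun j hj => ⟨s ^ 2 ^ j, List.getD_map_range _ _ hj, by rw [map_pow]⟩
  obtain ⟨R, hR, hR'⟩ := (𝒢.inst w).rho_gpow (f := F.poly lam) hk (by omega) hlt
    (F.degree_le lam) hl
  obtain ⟨P, hP, hP'⟩ := (𝒢.inst w).pi_gpow (f := F.poly lam) (n := n) hk (by omega) hlt hl hl'
  have hv := ((𝒢.inst w).modQ_evalMod (F.poly lam) s)
  have key := (PE.verifyAlg_val (𝒢.inst w) hk (by omega) (F.msg lam) s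
    (evalMod (F.poly lam) (𝒢.inst w).N s) R P α _).2 ⟨hR'.symm, by
      rw [hR']
      exact hF lam w hw α hα, by
      rw [hR', hP', hv]
      exact evalMod_sub (F.degree_le lam) _ _⟩
  rw [← hR, ← hP, ← hc2, ← hc1] at key
  rw [← hc2]
  exact key

/-! ### The verification experiment -/

section

open scoped ENNReal

variable {n : ℕ} {𝒢 : MultilinearGenerator (2 * logDeg n + 1)} {F : PolyFamily n}

/-- The answer of the adversary on the encoding of the input `x`, paired with `x`. -/
def PE.answer (A : VerAdversary) (pk : PE.PublicKey 𝒢) (st tr : Val) : Option ℕ → PMF Val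
  | none => PMF.pure (.num 0)
  | some x => (pk.inst.encryptK pk.h (logDeg n) x).bind fun σ =>
      (A.forge.output (.pair st (.pair (.pair (.num x) (Val.list (σ.map pk.inst.elt))) tr))).bind
        fun o => PMF.pure (.pair (.num x) o)

variable (F) in
/-- The verification experiment up to the adversary's answer: the input chosen by the adversary,
paired with its answer. -/
def PE.forgery (A : VerAdversary) (pk : PE.PublicKey 𝒢) : PMF Val :=
  (A.setup.output ((PE.scheme n 𝒢 F).pkVal pk)).bind fun st =>
  (PMF.iterate (PE.oracleStep F pk A.query st) (A.rounds.eval pk.lam) (.num 0)).bind fun tr =>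
  (A.challenge.output (.pair st tr)).bind fun v =>
  PE.answer A pk st tr ((PE.scheme n 𝒢 F).readInput pk.lam v)

open Classical in
/-- Whether the client, with verification key `τ`, accepts the answer `o` although it encodes a
value different from the one at `x`. -/
def VCScheme.fooled (S : VCScheme) (pk : S.PK) (sk : S.SK pk) (τ : S.Tau pk) (x : ℕ) (o : Val) :
    Bool :=
  match S.parseRho pk o.fst, S.parsePrf pk o.snd with
  | some ρ, some π =>
    match (S.verify pk sk τ ρ π).val with
    | none => false
    | some y => decide (y ≠ S.func pk x)
  | _, _ => false

theorem VCScheme.verExp_eq_fooled (S : VCScheme) (A : VerAdversary) (lam : ℕ) :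
    S.verExp A lam = (S.keyGen lam).bind fun key =>
      (A.setup.output (S.pkVal key.1)).bind fun st =>
      (S.queries lam key.1 key.2 A.query st (A.rounds.eval lam) (.num 0)).bind fun tr =>
      (A.challenge.output (.pair st tr)).bind fun v =>
      (S.readInput lam v).elim (PMF.pure false) fun x =>
        (S.probGen key.1 key.2 x).bind fun c =>
        (A.forge.output (.pair st (.pair (.pair (.num x) (S.queryVal key.1 c.val.1)) tr))).bind
          fun o => PMF.pure (S.fooled key.1 key.2 c.val.2 x o) := by
  refine congrArg (PMF.bind _) (funext fun key => congrArg (PMF.bind _) (funext fun st =>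
    congrArg (PMF.bind _) (funext fun tr => congrArg (PMF.bind _) (funext fun v => ?_))))
  obtain ⟨pk, sk⟩ := key
  dsimp only
  rcases S.readInput lam v with _ | x
  · rfl
  refine congrArg (PMF.bind _) (funext fun c => congrArg (PMF.bind _) (funext fun o => ?_))
  unfold VCScheme.fooled
  rcases S.parseRho pk o.fst with _ | ρ
  · rfl
  rcases S.parsePrf pk o.snd with _ | π
  · rfl
  dsimp only
  rcases (S.verify pk sk c.val.2 ρ π).val with _ | y
  · rfl
  · rfl

theorem VCScheme.exists_of_fooled {S : VCScheme} {pk : S.PK} {sk : S.SK pk} {τ : S.Tau pk} {x : ℕ}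
    {o : Val} (h : S.fooled pk sk τ x o = true) : ∃ ρ π y, S.parseRho pk o.fst = some ρ ∧
      S.parsePrf pk o.snd = some π ∧ (S.verify pk sk τ ρ π).val = some y ∧ y ≠ S.func pk x := by
  unfold VCScheme.fooled at h
  rcases hρ : S.parseRho pk o.fst with _ | ρ
  · simp [hρ] at h
  rcases hπ : S.parsePrf pk o.snd with _ | π
  · simp [hρ, hπ] at h
  rw [hρ, hπ] at h
  dsimp only at h
  rcases hy : (S.verify pk sk τ ρ π).val with _ | y
  · simp [hy] at h
  · rw [hy] at h
    exact ⟨ρ, π, y, rfl, rfl, hy, by simpa using h⟩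

variable (F) in
/-- Whether the adversary wins the verification experiment with a given forgery. -/
def PE.wins (pk : PE.PublicKey 𝒢) (sk : PE.SecretKey pk) : Val → Bool
  | .pair (.num x) o => (PE.scheme n 𝒢 F).fooled pk sk x x o
  | _ => false

theorem PE.answer_map_wins (A : VerAdversary) (pk : PE.PublicKey 𝒢) (sk : PE.SecretKey pk)
    (st tr : Val) (x : Option ℕ) :
    (PE.answer A pk st tr x).map (PE.wins F pk sk) =
      x.elim (PMF.pure false) fun x => ((PE.scheme n 𝒢 F).probGen pk sk x).bind fun c =>
        (A.forge.output (.pair st (.pair (.pair (.num x)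
          ((PE.scheme n 𝒢 F).queryVal pk c.val.1)) tr))).bind fun o =>
        PMF.pure ((PE.scheme n 𝒢 F).fooled pk sk c.val.2 x o) := by
  rcases x with _ | x
  · exact PMF.pure_map (PE.wins F pk sk) (.num 0)
  refine Eq.trans ?_ (PE.scheme_probGen_bind (F := F) pk sk x fun σ α =>
    (A.forge.output (.pair st (.pair (.pair (.num x) (Val.list (σ.map pk.inst.elt))) tr))).bind
      fun o => PMF.pure ((PE.scheme n 𝒢 F).fooled pk sk α x o)).symm
  unfold PE.answer
  simp only [PMF.map_bind, PMF.pure_map]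
  rfl

theorem PE.verExp_eq (A : VerAdversary) (lam : ℕ) : (PE.scheme n 𝒢 F).verExp A lam =
    (𝒢.sample lam).bind fun w =>
      (PMF.uniformOfFintype (ZMod (𝒢.inst w).N)).bind fun s =>
      (PMF.uniformOfFintype ((𝒢.inst w).G 1)).bind fun u =>
      (PE.forgery F A (PE.mkKey lam w s (u ^ (𝒢.inst w).q))).map
        (PE.wins F (PE.mkKey lam w s (u ^ (𝒢.inst w).q))
          ⟨s, (𝒢.inst w).gpow 1 (evalMod (F.poly lam) (𝒢.inst w).N s)⟩) := by
  refine (VCScheme.verExp_eq_fooled _ A lam).trans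
    ((PE.scheme_keyGen_bind (F := F) lam _).trans ?_)
  refine congrArg _ (funext fun w => congrArg _ (funext fun s => congrArg _ (funext fun u => ?_)))
  generalize (PE.SecretKey.mk s ((𝒢.inst w).gpow 1 (evalMod (F.poly lam) (𝒢.inst w).N s)) :
    PE.SecretKey (PE.mkKey lam w s (u ^ (𝒢.inst w).q))) = sk
  revert sk
  generalize hpk : PE.mkKey lam w s (u ^ (𝒢.inst w).q) = pk
  intro sk
  obtain rfl : lam = pk.lam := by rw [← hpk]; rfl
  unfold PE.forgery
  rw [PMF.map_bind]
  refine congrArg (PMF.bind _) (funext fun st => ?_)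
  rw [PMF.map_bind]
  refine congrArg₂ PMF.bind (PE.queries_eq ..) (funext fun tr => ?_)
  rw [PMF.map_bind]
  refine congrArg (PMF.bind _) (funext fun v => ?_)
  exact (PE.answer_map_wins (F := F) A pk sk st tr _).symm

/-- The adversary is run up to its answer in polynomial time, given the public key only. -/
theorem KeyData.forgery {X : Type} {ctx : X → Val} {pk : X → PE.PublicKey 𝒢}
    (h : KeyData F ctx pk) (A : VerAdversary) :
    PolyKernel ctx fun x => PE.forgery F A (pk x) := by
  refine PolyKernel.bind (Y := fun _ => Val) (fun _ v => v)
    (A.setup_ppt.polyKernel_map h.pk_fun) ?_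
  refine PolyKernel.bind (Y := fun _ => Val) (fun _ v => v) (PolyKernel.congr
    (h.weaken.queries A.query_ppt PolyFun.top (.const _) A.rounds) fun _ => (PMF.map_id _).symm) ?_
  refine PolyKernel.bind (Y := fun _ => Val) (fun _ v => v) (A.challenge_ppt.polyKernel_map
    (PolyFun.pair PolyFun.self.fst.snd PolyFun.top)) ?_
  let X' := Σ _ : (Σ _ : (Σ _ : X, Val), Val), Val
  have hK : KeyData F (fun z : X' => .pair (.pair (.pair (ctx z.1.1.1) z.1.1.2) z.1.2) z.2)
    fun z => pk z.1.1.1 := h.via (Sigma.fst ∘ Sigma.fst ∘ Sigma.fst) PolyFun.self.fst.fst.fst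
  refine PolyKernel.readInput (n := n) (𝒢 := 𝒢) (F := F) (X := X')
    (lam := fun z => (pk z.1.1.1).lam) (v := fun z => z.2) hK.groupData.lam_fun PolyFun.top
    (PolyFun.const _) ?_
  refine PolyKernel.bind
    (Y := fun z : Σ z : X', {a : ℕ // a ∈ F.dom (pk z.1.1.1).lam} =>
      List ((pk z.1.1.1.1).inst.G 1))
    (fun z σ => Val.list (σ.map (pk z.1.1.1.1).inst.elt)) (hK.weaken.encryptK PolyFun.top) ?_
  refine PolyKernel.bind (Y := fun _ => Val) (fun _ v => v) (A.forge_ppt.polyKernel_map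
    (PolyFun.pair PolyFun.self.fst.fst.fst.fst.snd (PolyFun.pair (PolyFun.pair
      PolyFun.self.fst.snd PolyFun.top) PolyFun.self.fst.fst.fst.snd))) ?_
  exact PolyFun.pair PolyFun.self.fst.fst.snd PolyFun.top

theorem MultilinearInstance.eq_elt_of_parse {K : ℕ} {Γ : MultilinearInstance K} {i : ℕ} {v : Val}
    {x : Γ.G i} (h : Γ.parse i v = some x) : v = Γ.elt x := by
  unfold MultilinearInstance.parse at h
  split_ifs at h with hx
  rw [← Option.some.inj h]
  exact hx.choose_spec

/-- A successful forgery for the input `x` contains a group element `g_{2k}^P` whose exponent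
satisfies the verification equation for some `y` in the domain of results with `y ≠ f(x)`. -/
theorem PE.exists_of_wins (hn : 1 ≤ n) {lam : ℕ} {w : 𝒢.Idx} {s : ZMod (𝒢.inst w).N}
    {h : (𝒢.inst w).G 1} {A : VerAdversary} {v : Val}
    (hv : v ∈ (PE.forgery F A (PE.mkKey lam w s h)).support)
    (hw : PE.wins F (PE.mkKey lam w s h)
      ⟨s, (𝒢.inst w).gpow 1 (evalMod (F.poly lam) (𝒢.inst w).N s)⟩ v = true) :
    ∃ x ∈ F.dom lam, ∃ y ∈ F.msg lam, ∃ P : ZMod (𝒢.inst w).N,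
      v.snd.snd = (𝒢.inst w).elt ((𝒢.inst w).gpow (logDeg n + logDeg n) P) ∧
      (y : ZMod (𝒢.inst w).q) ≠ evalMod (F.poly lam) (𝒢.inst w).q x ∧
      evalMod (F.poly lam) (𝒢.inst w).q ((𝒢.inst w).modQ s) - y =
        ((𝒢.inst w).modQ s - x) * (𝒢.inst w).modQ P := by
  have hk := logDeg_pos hn
  obtain ⟨x, hx, o, rfl⟩ | rfl : (∃ x ∈ F.dom lam, ∃ o, v = .pair (.num x) o) ∨ v = .num 0 := by
    unfold PE.forgery at hv
    obtain ⟨st, -, hv⟩ := (PMF.mem_support_bind_iff _ _ _).1 hv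
    obtain ⟨tr, -, hv⟩ := (PMF.mem_support_bind_iff _ _ _).1 hv
    obtain ⟨v', -, hv⟩ := (PMF.mem_support_bind_iff _ _ _).1 hv
    rw [VCScheme.readInput_eq] at hv
    split_ifs at hv with hin
    · obtain ⟨σ, -, hv⟩ := (PMF.mem_support_bind_iff _ _ _).1 hv
      obtain ⟨o, -, hv⟩ := (PMF.mem_support_bind_iff _ _ _).1 hv
      exact Or.inl ⟨_, hin.2, o, (PMF.mem_support_pure_iff _ _).1 hv⟩
    · exact Or.inr ((PMF.mem_support_pure_iff _ _).1 hv)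
  swap
  · simp [PE.wins] at hw
  refine ⟨x, hx, ?_⟩
  obtain ⟨ρ, π, z, -, hπ, hz, hne⟩ := VCScheme.exists_of_fooled (S := PE.scheme n 𝒢 F) hw
  obtain ⟨R, rfl⟩ := (𝒢.inst w).exists_gpow hk (by omega) ρ
  obtain ⟨P, rfl⟩ := (𝒢.inst w).exists_gpow (i := logDeg n + logDeg n) (by omega) (by omega) π
  obtain ⟨rfl, ⟨y, hyM, hyR⟩, hcheck⟩ := (PE.verifyAlg_val (𝒢.inst w) hk (by omega) (F.msg lam) s
    (evalMod (F.poly lam) (𝒢.inst w).N s) R P x z).1 hz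
  refine ⟨y, hyM, P, MultilinearInstance.eq_elt_of_parse hπ, ?_, ?_⟩
  · rw [hyR]
    exact hne
  · rw [hyR, ← (𝒢.inst w).modQ_evalMod]
    exact hcheck

end

/-! ### Extracting an MSDHS solution from a forgery -/

section

variable {n : ℕ} {𝒢 : MultilinearGenerator (2 * logDeg n + 1)} {F : PolyFamily n}
  {X : Type} {ctx : X → Val} {lam : X → ℕ} {w : X → 𝒢.Idx}

theorem ZMod.val_powSucc_fun {N : X → ℕ} [∀ x, NeZero (N x)]
    (hN : PolyFun ctx fun x => .num (N x)) {a : ∀ x, ZMod (N x)}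
    (ha : PolyFun ctx fun x => .num (a x).val) {m : X → ℕ}
    (hm : PolyFun ctx fun x => .num (m x)) :
    PolyFun ctx fun x => .num (a x ^ (m x + 1)).val := by
  obtain ⟨Q, hQ⟩ := hN.size_le
  refine PolyFun.powSucc (M := fun x => ZMod (N x)) (fun _ y => .num y.val) Q (fun x y => ?_) ?_
    ha hm
  · refine le_trans ?_ (hQ x)
    exact Nat.add_le_add_right (Nat.size_le_size (ZMod.val_lt y).le) 1
  · intro X' ctx' φ a b hc ha hb
    exact ((ha.mul hb).mod (hN.via φ hc)).congr fun x => by rw [ZMod.val_mul]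

/-- Shifting the secret: the powers of `s + a` in the exponent are computed from those of `s`. -/
theorem GroupData.gpow_shift_pow (hG : GroupData 𝒢 ctx lam w) {s : ∀ x, ZMod (𝒢.inst (w x)).N}
    {a : X → ℕ} (ha : PolyFun ctx fun x => .num (a x)) {m : ℕ}
    (hs : ∀ i ≤ m, PolyFun ctx fun x =>
      (𝒢.inst (w x)).elt ((𝒢.inst (w x)).gpow 1 (s x ^ i))) :
    PolyFun ctx fun x => (𝒢.inst (w x)).elt ((𝒢.inst (w x)).gpow 1 ((s x + a x) ^ m)) := by
  refine (hG.prod le_rfl (by omega) (m + 1)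
    (a := fun i x => (𝒢.inst (w x)).gpow 1 (s x ^ i) ^ (a x ^ (m - i) * m.choose i)) fun i hi =>
      hG.pow le_rfl (by omega) (hs i (by omega))
        ((ha.natPow (m - i)).mul (.const (.num (m.choose i))))).congr fun x => ?_
  rw [add_pow, MultilinearInstance.gpow_sum _ _ _ le_rfl (by omega)]
  refine congrArg _ (Finset.prod_congr rfl fun i _ => ?_)
  rw [← MultilinearInstance.gpow_mul_natCast _ le_rfl (by omega)]
  push_cast
  ring_nf

/-- The value at `S`, modulo `m`, of the polynomial `(f(X) - f(a)) / (X - a)`, for `f` of degree at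
most `n`. -/
def evalQuotient (n : ℕ) (f : ℕ[X]) (m : ℕ) (S : ZMod m) (a : ℕ) : ZMod m :=
  ∑ i ∈ Finset.range n, ∑ j ∈ Finset.range (i + 1),
    (a : ZMod m) ^ j * S ^ (i - j) * f.coeff (i + 1)

theorem GroupData.gpow_evalQuotient (hG : GroupData 𝒢 ctx lam w)
    {S : ∀ x, ZMod (𝒢.inst (w x)).N} {a : X → ℕ} (ha : PolyFun ctx fun x => .num (a x))
    (hS : ∀ i ≤ n, PolyFun ctx fun x =>
      (𝒢.inst (w x)).elt ((𝒢.inst (w x)).gpow 1 (S x ^ i))) :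
    PolyFun ctx fun x => (𝒢.inst (w x)).elt ((𝒢.inst (w x)).gpow 1
      (evalQuotient n (F.poly (lam x)) _ (S x) (a x))) := by
  refine (hG.prod le_rfl (by omega) n (a := fun i x => ∏ j ∈ Finset.range (i + 1),
    (𝒢.inst (w x)).gpow 1 (S x ^ (i - j)) ^ (a x ^ j * (F.poly (lam x)).coeff (i + 1)))
    fun i hi => hG.prod le_rfl (by omega) (i + 1) fun j hj =>
      hG.pow le_rfl (by omega) (hS (i - j) (by omega))
        ((ha.natPow j).mul (PolyFun.coeff hG.lam_fun (i + 1) (by omega)))).congr fun x => ?_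
  unfold evalQuotient
  rw [MultilinearInstance.gpow_sum _ _ _ le_rfl (by omega)]
  refine congrArg _ (Finset.prod_congr rfl fun i _ => ?_)
  rw [MultilinearInstance.gpow_sum _ _ _ le_rfl (by omega)]
  refine Finset.prod_congr rfl fun j _ => ?_
  rw [← MultilinearInstance.gpow_mul_natCast _ le_rfl (by omega)]
  push_cast
  ring_nf

/-- A natural number that represents the inverse of `f(a) - y` modulo the prime `q`, if there is
one: by Fermat's little theorem, the power with exponent `2 (q - 2) + 1 = 2 (q - 1) - 1`, which is
positive for `q = 2` too. -/
def invGap (f : ℕ[X]) (q a y : ℕ) : ℕ :=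
  (((f.eval a + (q - y % q) : ℕ) : ZMod q) ^ (2 * (q - 2) + 1)).val

theorem natCast_invGap (f : ℕ[X]) {q : ℕ} (hq : q.Prime) {a y : ℕ}
    (h : (y : ZMod q) ≠ evalMod f q a) :
    (evalMod f q a - y) * (invGap f q a y : ZMod q) = 1 := by
  have : Fact q.Prime := ⟨hq⟩
  have hcast : ((f.eval a + (q - y % q) : ℕ) : ZMod q) = evalMod f q a - y := by
    have heval : evalMod f q a = (f.eval a : ℕ) :=
      (Polynomial.eval₂_at_apply (Nat.castRingHom (ZMod q)) a)
    rw [Nat.cast_add, Nat.cast_sub (Nat.mod_lt _ hq.pos).le, ZMod.natCast_mod, ZMod.natCast_self,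
      heval]
    ring
  unfold invGap
  rw [hcast, ZMod.natCast_zmod_val, ← pow_succ', show 2 * (q - 2) + 1 + 1 = (q - 1) * 2 by
    have := hq.two_le; omega, pow_mul, ZMod.pow_card_sub_one_eq_one (sub_ne_zero.2 h.symm),
    one_pow]

theorem PolyFun.num_invGap {q a y : X → ℕ} [∀ x, NeZero (q x)]
    (hlam : PolyFun ctx fun x => Val.unary (lam x)) (hq : PolyFun ctx fun x => .num (q x))
    (ha : PolyFun ctx fun x => .num (a x)) (hy : PolyFun ctx fun x => .num (y x)) :
    PolyFun ctx fun x => .num (invGap (F.poly (lam x)) (q x) (a x) (y x)) := by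
  have heval : PolyFun ctx fun x => .num ((F.poly (lam x)).eval (a x)) :=
    (PolyFun.sum_range (a := fun i x => (F.poly (lam x)).coeff i * a x ^ i) (n + 1) fun i hi =>
      (PolyFun.coeff (F := F) hlam i (by omega)).mul (ha.natPow i)).congr fun x => by
        rw [Polynomial.eval_eq_sum_range' (Nat.lt_succ_of_le (F.degree_le _))]
  exact ZMod.val_powSucc_fun hq (ZMod.val_natCast_fun hq (heval.add (hq.sub (hy.mod hq))))
    ((PolyFun.const (.num 2)).mul (hq.sub (.const (.num 2))))

/-- If `π = g_{2k}^P` proves a value `y ≠ f(a)` for the secret `S = s + a`, then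
`s (P - W) = f(a) - y` modulo `q`, where `W = (f(S) - f(a)) / (S - a)`; hence `p / s` is obtained
from `P - W` and the inverse of `f(a) - y`. -/
theorem MultilinearInstance.exponent_eq {K : ℕ} (Γ : MultilinearInstance K) {f : ℕ[X]}
    (hf : f.natDegree ≤ n) {s P : ZMod Γ.N} {a y : ℕ} (hs : IsUnit s)
    (hy : (y : ZMod Γ.q) ≠ evalMod f Γ.q a)
    (h : evalMod f Γ.q (Γ.modQ (s + a)) - y = (Γ.modQ (s + a) - a) * Γ.modQ P) :
    (P - evalQuotient n f Γ.N (s + a) a) * (Γ.p * invGap f Γ.q a y : ℕ) = Γ.p * s⁻¹ := by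
  have hW : evalMod f Γ.q (Γ.modQ (s + a)) - evalMod f Γ.q a =
      Γ.modQ s * Γ.modQ (evalQuotient n f Γ.N (s + a) a) := by
    rw [evalMod_sub hf, map_add, map_natCast, add_sub_cancel_right]
    simp only [evalQuotient, map_sum, map_mul, map_pow, map_add, map_natCast]
  have hgap : Γ.modQ s * (Γ.modQ P - Γ.modQ (evalQuotient n f Γ.N (s + a) a)) =
      evalMod f Γ.q a - y := by
    have h' : Γ.modQ (s + a) - a = Γ.modQ s := by
      rw [map_add, map_natCast, add_sub_cancel_right]
    rw [h'] at h
    rw [mul_sub, ← h, ← hW]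
    ring
  have hinv : Γ.modQ s⁻¹ * Γ.modQ s = 1 := by
    rw [← map_mul, ZMod.inv_mul_of_unit _ hs, map_one]
  have key := (Γ.mul_p_eq_iff ((P - evalQuotient n f Γ.N (s + a) a) * (invGap f Γ.q a y : ℕ))
    s⁻¹).2 <| by
      have := natCast_invGap f Γ.q_prime hy
      rw [← hgap] at this
      rw [map_mul, map_sub, map_natCast]
      calc _ = Γ.modQ s⁻¹ * Γ.modQ s * ((Γ.modQ P - Γ.modQ (evalQuotient n f Γ.N (s + a) a)) *
            (invGap f Γ.q a y : ZMod Γ.q)) := by rw [hinv, one_mul]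
        _ = Γ.modQ s⁻¹ * (Γ.modQ s * (Γ.modQ P - Γ.modQ (evalQuotient n f Γ.N (s + a) a)) *
            (invGap f Γ.q a y : ZMod Γ.q)) := by ring
        _ = _ := by rw [this, mul_one]
  rw [mul_comm (Γ.p : ZMod Γ.N), ← key]
  push_cast
  ring

theorem MultilinearInstance.elt_gpow_congr {K : ℕ} (Γ : MultilinearInstance K) {i j : ℕ}
    (h : i = j) (a : ZMod Γ.N) : Γ.elt (Γ.gpow i a) = Γ.elt (Γ.gpow j a) := by
  subst h
  rfl

/-- The group element `g_{2k+1}^((P - W) m)` is computed from `g_{2k}^P` and `g_1^W` as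
`e(g_1, g_{2k}^P)^m * e(g_1^W, g_{2k})^(N - m)`. -/
theorem GroupData.gpow_sub_mul (hn : 1 ≤ n) (hG : GroupData 𝒢 ctx lam w)
    {P W : ∀ x, ZMod (𝒢.inst (w x)).N} {m : X → ℕ} (hm : PolyFun ctx fun x => .num (m x))
    (hmN : ∀ x, m x ≤ (𝒢.inst (w x)).N)
    (hP : PolyFun ctx fun x =>
      (𝒢.inst (w x)).elt ((𝒢.inst (w x)).gpow (logDeg n + logDeg n) (P x)))
    (hW : PolyFun ctx fun x => (𝒢.inst (w x)).elt ((𝒢.inst (w x)).gpow 1 (W x))) :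
    PolyFun ctx fun x => (𝒢.inst (w x)).elt ((𝒢.inst (w x)).gpow (2 * logDeg n + 1)
      ((P x - W x) * m x)) := by
  have hk := logDeg_pos hn
  have h2 : 1 ≤ logDeg n + logDeg n := by omega
  have h3 : 1 + (logDeg n + logDeg n) ≤ 2 * logDeg n + 1 := by omega
  have h4 : logDeg n + logDeg n ≤ 2 * logDeg n + 1 := by omega
  refine (hG.mul (by omega) h3 (hG.pow (by omega) h3
    (hG.pairing le_rfl h2 h3 (hG.gen le_rfl (by omega)) hP) hm)
    (hG.pow (by omega) h3 (hG.pairing le_rfl h2 h3 hW (hG.gen h2 h4))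
      (hG.order.sub hm))).congr fun x => ?_
  rw [MultilinearInstance.g_eq_gpow _ le_rfl (by omega), MultilinearInstance.g_eq_gpow _ h2 h4,
    MultilinearInstance.e_gpow _ le_rfl h2 h3, MultilinearInstance.e_gpow _ le_rfl h2 h3,
    ← MultilinearInstance.gpow_mul_natCast _ (by omega) h3,
    ← MultilinearInstance.gpow_mul_natCast _ (by omega) h3,
    ← MultilinearInstance.gpow_add _ (by omega) h3,
    ← MultilinearInstance.elt_gpow_congr _
      (show 1 + (logDeg n + logDeg n) = 2 * logDeg n + 1 by omega),
    Nat.cast_sub (hmN x), ZMod.natCast_self]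
  ring_nf

end

/-! ### The reduction to MSDHS -/

section

variable {K : ℕ} (𝒢 : MultilinearGenerator K)

/-- An instance of the MSDHS problem that can occur. -/
structure MSDHSInstance where
  lam : ℕ
  idx : 𝒢.Idx
  mem : idx ∈ (𝒢.sample lam).support
  s : ZMod (𝒢.inst idx).N

variable {𝒢}

/-- The input of the solver of the MSDHS problem. -/
def MSDHSInstance.val (n : ℕ) (z : MSDHSInstance 𝒢) : Val :=
  Val.list [Val.unary z.lam, .num (𝒢.inst z.idx).p, .num (𝒢.inst z.idx).q, (𝒢.inst z.idx).toVal,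
    Val.list ((List.range (n + 1)).map fun i =>
      (𝒢.inst z.idx).elt ((𝒢.inst z.idx).gpow 1 (z.s ^ i)))]

namespace MSDHSInstance

variable {n : ℕ} {X : Type} {ctx : X → Val} {z : X → MSDHSInstance 𝒢}

theorem groupData (h : PolyFun ctx fun x => (z x).val n) :
    GroupData 𝒢 ctx (fun x => (z x).lam) fun x => (z x).idx :=
  ⟨fun x => (z x).mem, h.nth 0, h.nth 3⟩

theorem p_fun (h : PolyFun ctx fun x => (z x).val n) :
    PolyFun ctx fun x => .num (𝒢.inst (z x).idx).p := h.nth 1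

theorem q_fun (h : PolyFun ctx fun x => (z x).val n) :
    PolyFun ctx fun x => .num (𝒢.inst (z x).idx).q := h.nth 2

theorem gpow_fun (h : PolyFun ctx fun x => (z x).val n) {i : ℕ} (hi : i ≤ n) :
    PolyFun ctx fun x => (𝒢.inst (z x).idx).elt ((𝒢.inst (z x).idx).gpow 1 ((z x).s ^ i)) :=
  ((h.nth 4).nth i).congr fun x => Val.nth_list (by
    rw [List.getElem?_map, List.getElem?_range (by omega)]
    rfl)

end MSDHSInstance

end

section

open scoped ENNReal

variable {n : ℕ} {𝒢 : MultilinearGenerator (2 * logDeg n + 1)} {F : PolyFamily n}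

variable (F) in
/-- The program `c` solves the MSDHS problem with the help of a proof `g_{2k}^P` of a wrong value
of the polynomial, relative to the shifted secret `s + a`. It is told the positions `i` and `j` of
the input `a` and of the wrong value `y` in their domains. -/
def PE.IsSolver (𝒢 : MultilinearGenerator (2 * logDeg n + 1)) (c : Code) : Prop :=
  ∀ (z : MSDHSInstance 𝒢) (i j : ℕ) (P : ZMod (𝒢.inst z.idx).N), IsUnit z.s →
    let a := (F.dom z.lam).getD i 0
    let y := (F.msg z.lam).getD j 0
    (y : ZMod (𝒢.inst z.idx).q) ≠ evalMod (F.poly z.lam) (𝒢.inst z.idx).q a →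
    evalMod (F.poly z.lam) (𝒢.inst z.idx).q ((𝒢.inst z.idx).modQ (z.s + a)) - y =
      ((𝒢.inst z.idx).modQ (z.s + a) - a) * (𝒢.inst z.idx).modQ P →
    c.output (.pair (.pair (.pair (z.val n) (.num i)) (.num j))
        ((𝒢.inst z.idx).elt ((𝒢.inst z.idx).gpow (logDeg n + logDeg n) P))) =
      PMF.pure ((𝒢.inst z.idx).elt
        ((𝒢.inst z.idx).gpow (2 * logDeg n + 1) ((𝒢.inst z.idx).p * z.s⁻¹)))

theorem PE.exists_isSolver (hn : 1 ≤ n) (F : PolyFamily n) : ∃ c : Code, c.PPT ∧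
    PE.IsSolver F 𝒢 c := by
  let X := Σ z : MSDHSInstance 𝒢, ℕ × ℕ × ZMod (𝒢.inst z.idx).N
  let ctx : X → Val := fun x => .pair (.pair (.pair (x.1.val n) (.num x.2.1)) (.num x.2.2.1))
    ((𝒢.inst x.1.idx).elt ((𝒢.inst x.1.idx).gpow (logDeg n + logDeg n) x.2.2.2))
  have hz : PolyFun ctx fun x : X => x.1.val n := PolyFun.self.fst.fst.fst
  have hG := MSDHSInstance.groupData hz
  have ha : PolyFun ctx fun x : X => .num ((F.dom x.1.lam).getD x.2.1 0) :=
    (PolyFun.dom hG.lam_fun).getD PolyFun.self.fst.fst.snd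
  have hy : PolyFun ctx fun x : X => .num ((F.msg x.1.lam).getD x.2.2.1 0) :=
    (PolyFun.msg hG.lam_fun).getD PolyFun.self.fst.snd
  have : ∀ x : X, NeZero (𝒢.inst x.1.idx).q := fun x => ⟨(𝒢.inst x.1.idx).q_prime.ne_zero⟩
  have hsol := hG.gpow_sub_mul hn (P := fun x => x.2.2.2)
    (W := fun x => evalQuotient n (F.poly x.1.lam) _ (x.1.s + ((F.dom x.1.lam).getD x.2.1 0 : ℕ))
      ((F.dom x.1.lam).getD x.2.1 0))
    ((MSDHSInstance.p_fun hz).mul (PolyFun.num_invGap (F := F) hG.lam_fun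
      (MSDHSInstance.q_fun hz) ha hy))
    (fun x => Nat.mul_le_mul_left _ (ZMod.val_lt _).le) PolyFun.self.snd
    (hG.gpow_evalQuotient ha fun i hi => hG.gpow_shift_pow ha fun l hl =>
      MSDHSInstance.gpow_fun hz (hl.trans hi))
  obtain ⟨c, hc, hcx⟩ := hsol
  refine ⟨c, hc, fun z i j P hs => ?_⟩
  intro a y hne hP
  exact (hcx ⟨z, i, j, P⟩).trans (congrArg (fun e => PMF.pure ((𝒢.inst z.idx).elt
    ((𝒢.inst z.idx).gpow (2 * logDeg n + 1) e)))
    ((𝒢.inst z.idx).exponent_eq (F.degree_le z.lam) hs hne hP))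

/-- The reduction: guess the positions of the input of the forgery and of the wrong value, shift
the secret accordingly, and solve the MSDHS problem by means of the forged proof. -/
def PE.reduction (A : VerAdversary) (F : PolyFamily n) (c : Code) (z : MSDHSInstance 𝒢) :
    PMF Val :=
  (PMF.below (F.dom z.lam).length).bind fun i =>
  (PMF.below (F.msg z.lam).length).bind fun j =>
  (PMF.uniformOfFintype (ZMod (𝒢.inst z.idx).N)).bind fun r =>
  (PE.forgery F A (PE.mkKey z.lam z.idx (z.s + ((F.dom z.lam).getD i 0 : ℕ))
    ((𝒢.inst z.idx).gpow 1 r ^ (𝒢.inst z.idx).q))).bind fun v =>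
  c.output (.pair (.pair (.pair (z.val n) (.num i)) (.num j)) v.snd.snd)

theorem PE.polyKernel_reduction (A : VerAdversary) {c : Code} (hc : c.PPT) :
    PolyKernel (fun z : MSDHSInstance 𝒢 => z.val n) (PE.reduction A F c) := by
  have hz₀ : PolyFun (fun z : MSDHSInstance 𝒢 => z.val n) fun z => z.val n := PolyFun.self
  refine PolyKernel.bind (Y := fun _ => ℕ) (fun _ i => .num i) (PolyKernel.below
    (PolyFun.length (PolyFun.dom (F := F) (MSDHSInstance.groupData hz₀).lam_fun))) ?_
  let X₁ := Σ _ : MSDHSInstance 𝒢, ℕ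
  have hz₁ : PolyFun (fun x : X₁ => .pair (x.1.val n) (.num x.2)) fun x => x.1.val n :=
    PolyFun.self.fst
  refine PolyKernel.bind (X := X₁) (Y := fun _ => ℕ) (fun _ j => .num j) (PolyKernel.below
    (PolyFun.length (PolyFun.msg (F := F) (MSDHSInstance.groupData hz₁).lam_fun))) ?_
  let X₂ := Σ _ : X₁, ℕ
  have hz₂ : PolyFun (fun x : X₂ => .pair (.pair (x.1.1.val n) (.num x.1.2)) (.num x.2))
    fun x => x.1.1.val n := PolyFun.self.fst.fst
  refine PolyKernel.bind (X := X₂) (Y := fun x => ZMod (𝒢.inst x.1.1.idx).N)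
    (fun _ r => .num r.val) (MSDHSInstance.groupData hz₂).uniform ?_
  let X₃ := Σ x : X₂, ZMod (𝒢.inst x.1.1.idx).N
  have hz₃ : PolyFun (fun x : X₃ => .pair (.pair (.pair (x.1.1.1.val n) (.num x.1.1.2))
    (.num x.1.2)) (.num x.2.val)) fun x => x.1.1.1.val n := PolyFun.self.fst.fst.fst
  have hG := MSDHSInstance.groupData hz₃
  have ha := (PolyFun.dom (F := F) hG.lam_fun).getD (i := fun x : X₃ => x.1.1.2)
    PolyFun.self.fst.fst.snd
  -- `2^ℓ ≤ n` for `ℓ < k`, so the given powers of `g_1` suffice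
  have hkey := hG.keyData (F := F)
    (s := fun x => x.1.1.1.s + ((F.dom x.1.1.1.lam).getD x.1.1.2 0 : ℕ))
    (h := fun x => (𝒢.inst x.1.1.1.idx).gpow 1 x.2 ^ (𝒢.inst x.1.1.1.idx).q)
    (fun ℓ hℓ => hG.gpow_shift_pow ha fun i hi => MSDHSInstance.gpow_fun hz₃
      (hi.trans (Nat.lt_succ_iff.1 ((Nat.lt_clog_iff_pow_lt one_lt_two).1 hℓ))))
    (hG.pow le_rfl (by omega) (hG.gpow le_rfl (by omega) PolyFun.self.snd)
      (MSDHSInstance.q_fun hz₃))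
  refine PolyKernel.bind (X := X₃) (Y := fun _ => Val) (fun _ v => v)
    ((hkey.forgery A).congr fun _ => (PMF.map_id _).symm) ?_
  exact hc.polyKernel.comp (PolyFun.self.fst.fst.pair PolyFun.self.snd.snd.snd)

open Classical in
/-- Whether `o` is the solution of the MSDHS problem. -/
def MSDHSInstance.solves {K : ℕ} {𝒢 : MultilinearGenerator K} (z : MSDHSInstance 𝒢) (o : Val) :
    Bool :=
  decide (IsUnit z.s ∧ o = (𝒢.inst z.idx).elt ((𝒢.inst z.idx).gpow K ((𝒢.inst z.idx).p * z.s⁻¹)))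

/-- The success probability of the reduction once the positions `i`, `j` have been guessed. -/
def PE.guessProb (A : VerAdversary) (F : PolyFamily n) (c : Code) (z : MSDHSInstance 𝒢)
    (i j : ℕ) : ℝ≥0∞ :=
  (PMF.uniformOfFintype (ZMod (𝒢.inst z.idx).N)).mean fun r =>
  (PE.forgery F A (PE.mkKey z.lam z.idx (z.s + ((F.dom z.lam).getD i 0 : ℕ))
    ((𝒢.inst z.idx).gpow 1 r ^ (𝒢.inst z.idx).q))).mean fun v =>
  (c.output (.pair (.pair (.pair (z.val n) (.num i)) (.num j)) v.snd.snd)).map z.solves true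

theorem PE.map_reduction_apply (A : VerAdversary) (c : Code) (z : MSDHSInstance 𝒢) :
    (F.dom z.lam).length * ((F.msg z.lam).length *
      (PE.reduction A F c z).map z.solves true) =
        ∑ i ∈ Finset.range (F.dom z.lam).length, ∑ j ∈ Finset.range (F.msg z.lam).length,
          PE.guessProb A F c z i j := by
  unfold PE.reduction
  rw [PMF.map_bind, PMF.bind_apply_eq_mean, ← PMF.mean_const_mul, PMF.mul_mean_below]
  refine Finset.sum_congr rfl fun i _ => ?_
  rw [PMF.map_bind, PMF.bind_apply_eq_mean, PMF.mul_mean_below]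
  refine Finset.sum_congr rfl fun j _ => ?_
  rw [PMF.map_bind, PMF.bind_apply_eq_mean]
  unfold PE.guessProb
  refine congrArg _ (funext fun r => ?_)
  rw [PMF.map_bind, PMF.bind_apply_eq_mean]

open Classical in
/-- For one forgery `v` under the secret `s`: if it wins, then, unless `s` minus the input is not
invertible, the solver succeeds for the right guess. -/
theorem PE.wins_le (A : VerAdversary) (hn : 1 ≤ n) {c : Code} (hc : PE.IsSolver F 𝒢 c)
    {lam : ℕ} {w : 𝒢.Idx} (hw : w ∈ (𝒢.sample lam).support) (s : ZMod (𝒢.inst w).N)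
    {h : (𝒢.inst w).G 1} {v : Val} (hv : v ∈ (PE.forgery F A (PE.mkKey lam w s h)).support) :
    (PMF.pure (PE.wins F (PE.mkKey lam w s h)
      ⟨s, (𝒢.inst w).gpow 1 (evalMod (F.poly lam) (𝒢.inst w).N s)⟩ v) true : ℝ≥0∞) ≤
    (∑ i ∈ Finset.range (F.dom lam).length, ∑ j ∈ Finset.range (F.msg lam).length,
      (c.output (.pair (.pair (.pair
        ((MSDHSInstance.mk lam w hw (s - ((F.dom lam).getD i 0 : ℕ))).val n) (.num i)) (.num j))
          v.snd.snd)).map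
        (MSDHSInstance.mk lam w hw (s - ((F.dom lam).getD i 0 : ℕ))).solves true) +
    ∑ i ∈ Finset.range (F.dom lam).length,
      if IsUnit (s - ((F.dom lam).getD i 0 : ℕ)) then 0 else 1 := by
  by_cases hwin : PE.wins F (PE.mkKey lam w s h)
      ⟨s, (𝒢.inst w).gpow 1 (evalMod (F.poly lam) (𝒢.inst w).N s)⟩ v = true
  swap
  · rw [PMF.pure_apply, if_neg fun h' => hwin h'.symm]
    exact zero_le
  refine (PMF.coe_le_one _ _).trans ?_
  obtain ⟨a, ha, y, hy, P, hvP, hne, hP⟩ := PE.exists_of_wins hn hv hwin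
  obtain ⟨i, hi, rfl⟩ := List.getElem_of_mem ha
  obtain ⟨j, hj, rfl⟩ := List.getElem_of_mem hy
  rw [← List.getD_eq_getElem _ 0 hi] at hne hP
  rw [← List.getD_eq_getElem _ 0 hj] at hne hP
  by_cases hunit : IsUnit (s - ((F.dom lam).getD i 0 : ℕ))
  · refine le_trans ?_ le_self_add
    refine le_trans ?_ (Finset.single_le_sum (fun _ _ => zero_le) (Finset.mem_range.2 hi))
    refine le_trans ?_ (Finset.single_le_sum (fun _ _ => zero_le) (Finset.mem_range.2 hj))
    have hout := hc ⟨lam, w, hw, s - ((F.dom lam).getD i 0 : ℕ)⟩ i j P hunit hne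
      (by simpa only [sub_add_cancel] using hP)
    rw [hvP]
    refine le_of_eq ?_
    refine Eq.symm ?_
    refine (congrArg (fun μ : PMF Val => μ.map _ true) hout).trans ?_
    rw [PMF.pure_map, PMF.pure_apply, if_pos]
    exact (decide_eq_true ⟨hunit, rfl⟩).symm
  · refine le_trans ?_ le_add_self
    refine le_trans ?_ (Finset.single_le_sum (fun _ _ => zero_le) (Finset.mem_range.2 hi))
    rw [if_neg hunit]

end

/-! ### Security -/

section

open scoped ENNReal

theorem PMF.mean_uniform_sub {N : ℕ} [NeZero N] (f : ZMod N → ℝ≥0∞) (a : ZMod N) :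
    ((PMF.uniformOfFintype (ZMod N)).mean fun s => f (s - a)) =
      (PMF.uniformOfFintype (ZMod N)).mean f := by
  rw [PMF.mean_uniform, PMF.mean_uniform]
  exact congrArg _ (Equiv.sum_comp (Equiv.subRight a) f)

theorem PMF.mean_add_const {α : Type} (p : PMF α) (f : α → ℝ≥0∞) (c : ℝ≥0∞) :
    (p.mean fun a => f a + c) = p.mean f + c := by
  rw [PMF.mean_add, PMF.mean_const]

variable {n : ℕ} {𝒢 : MultilinearGenerator (2 * logDeg n + 1)} {F : PolyFamily n}

/-- The winning probability of the adversary, for a given instance. -/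
def PE.winProb (A : VerAdversary) (F : PolyFamily n) (lam : ℕ) (w : 𝒢.Idx) : ℝ≥0∞ :=
  (PMF.uniformOfFintype (ZMod (𝒢.inst w).N)).mean fun s =>
  (PMF.uniformOfFintype (ZMod (𝒢.inst w).N)).mean fun r =>
  (PE.forgery F A (PE.mkKey lam w s ((𝒢.inst w).gpow 1 r ^ (𝒢.inst w).q))).mean fun v =>
  PMF.pure (PE.wins F (PE.mkKey lam w s ((𝒢.inst w).gpow 1 r ^ (𝒢.inst w).q))
    ⟨s, (𝒢.inst w).gpow 1 (evalMod (F.poly lam) (𝒢.inst w).N s)⟩ v) true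

theorem PE.verExp_apply (A : VerAdversary) (lam : ℕ) :
    (PE.scheme n 𝒢 F).verExp A lam true = (𝒢.sample lam).mean (PE.winProb A F lam) := by
  rw [PE.verExp_eq, PMF.bind_apply_eq_mean]
  refine congrArg _ (funext fun w => ?_)
  rw [PMF.bind_apply_eq_mean]
  refine congrArg _ (funext fun s => ?_)
  rw [← (𝒢.inst w).map_gpow_uniform le_rfl (by omega), PMF.bind_map, PMF.bind_apply_eq_mean]
  exact congrArg _ (funext fun r => PMF.bind_apply_eq_mean _ _ _)

/-- Averaging `PE.wins_le` over all coins. The shifted secret `s - a` is as uniform as `s`, whence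
the guesses of the reduction are summed over uniform secrets. -/
theorem PE.winProb_le (A : VerAdversary) (hn : 1 ≤ n) {c : Code} (hc : PE.IsSolver F 𝒢 c)
    {lam : ℕ} {w : 𝒢.Idx} (hw : w ∈ (𝒢.sample lam).support) :
    PE.winProb A F lam w ≤
      ((F.dom lam).length : ℝ≥0∞) * ((F.msg lam).length *
        (PMF.uniformOfFintype (ZMod (𝒢.inst w).N)).mean fun s =>
          (PE.reduction A F c ⟨lam, w, hw, s⟩).map (MSDHSInstance.mk lam w hw s).solves true) +
      (F.dom lam).length * (𝒢.inst w).badProb := by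
  classical
  have hbad : ((F.dom lam).length : ℝ≥0∞) * (𝒢.inst w).badProb =
      (PMF.uniformOfFintype (ZMod (𝒢.inst w).N)).mean fun s =>
        ∑ i ∈ Finset.range (F.dom lam).length,
          if IsUnit (s - ((F.dom lam).getD i 0 : ℕ)) then 0 else 1 := by
    rw [PMF.mean_sum]
    refine Eq.symm ((Finset.sum_congr rfl fun i _ => ?_).trans ((Finset.sum_const
      (𝒢.inst w).badProb).trans (by rw [Finset.card_range, nsmul_eq_mul])))
    refine (PMF.mean_uniform_sub (fun s => if IsUnit s then (0 : ℝ≥0∞) else 1) _).trans ?_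
    unfold MultilinearInstance.badProb
    congr!
  have hred : ((F.dom lam).length : ℝ≥0∞) * ((F.msg lam).length *
        (PMF.uniformOfFintype (ZMod (𝒢.inst w).N)).mean fun s =>
          (PE.reduction A F c ⟨lam, w, hw, s⟩).map (MSDHSInstance.mk lam w hw s).solves true) =
      (PMF.uniformOfFintype (ZMod (𝒢.inst w).N)).mean fun s =>
        ∑ i ∈ Finset.range (F.dom lam).length, ∑ j ∈ Finset.range (F.msg lam).length,
          PE.guessProb A F c ⟨lam, w, hw, s - ((F.dom lam).getD i 0 : ℕ)⟩ i j := by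
    rw [← PMF.mean_const_mul, ← PMF.mean_const_mul, PMF.mean_sum]
    refine (congrArg _ (funext fun s => PE.map_reduction_apply A c ⟨lam, w, hw, s⟩)).trans ?_
    refine (PMF.mean_sum _ (Finset.range (F.dom lam).length) fun i s =>
      ∑ j ∈ Finset.range (F.msg lam).length, PE.guessProb A F c ⟨lam, w, hw, s⟩ i j).trans ?_
    refine Finset.sum_congr rfl fun i _ => Eq.symm ?_
    exact PMF.mean_uniform_sub (fun s => ∑ j ∈ Finset.range (F.msg lam).length,
      PE.guessProb A F c ⟨lam, w, hw, s⟩ i j) _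
  rw [hbad, hred, ← PMF.mean_add]
  refine PMF.mean_mono fun s _ => ?_
  have hguess : ∀ i j, PE.guessProb A F c ⟨lam, w, hw, s - ((F.dom lam).getD i 0 : ℕ)⟩ i j =
      (PMF.uniformOfFintype (ZMod (𝒢.inst w).N)).mean fun r =>
      (PE.forgery F A (PE.mkKey lam w s ((𝒢.inst w).gpow 1 r ^ (𝒢.inst w).q))).mean fun v =>
      (c.output (.pair (.pair (.pair
        ((MSDHSInstance.mk lam w hw (s - ((F.dom lam).getD i 0 : ℕ))).val n) (.num i)) (.num j))
          v.snd.snd)).map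
        (MSDHSInstance.mk lam w hw (s - ((F.dom lam).getD i 0 : ℕ))).solves true := by
    intro i j
    unfold PE.guessProb
    dsimp only
    rw [sub_add_cancel]
  simp only [hguess, ← PMF.mean_sum]
  have hle := fun (h : (𝒢.inst w).G 1) (v : Val) (hv : v ∈ (PE.forgery F A
    (PE.mkKey lam w s h)).support) => PE.wins_le A hn hc hw s hv
  generalize (∑ i ∈ Finset.range (F.dom lam).length,
    if IsUnit (s - ((F.dom lam).getD i 0 : ℕ)) then (0 : ℝ≥0∞) else 1) = B at hle ⊢
  rw [← PMF.mean_add_const]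
  refine PMF.mean_mono fun r _ => ?_
  rw [← PMF.mean_add_const]
  exact PMF.mean_mono fun v hv => hle _ v hv

/-- A list computed from `1^lam` in polynomial time has polynomial length. -/
theorem exists_length_le (l : ℕ → List ℕ)
    (hl : PolyFun Val.unary fun lam => Val.list ((l lam).map .num)) :
    ∃ P : ℕ[X], ∀ lam, (l lam).length ≤ P.eval lam := by
  obtain ⟨P, hP⟩ := hl.size_le
  refine ⟨P.comp (C 2 * X + 1), fun lam => ?_⟩
  have h1 := (Val.length_lt_size_list ((l lam).map .num)).le.trans (hP lam)
  have h2 : (Val.unary lam).size ≤ 2 * lam + 1 := by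
    refine (Val.size_list_le (B := 1) fun a ha => ?_).trans (by simp [mul_comm])
    rw [List.eq_of_mem_replicate ha]
    simp [Val.size]
  rw [List.length_map] at h1
  simp only [Polynomial.eval_comp, Polynomial.eval_add, Polynomial.eval_mul, Polynomial.eval_C,
    Polynomial.eval_X, Polynomial.eval_one]
  exact h1.trans (P.eval_nat_mono h2)

/-- The reduction loses a factor `|𝔻| |𝕄|`, for its guesses, and the probability that the shifted
secret is not invertible. -/
theorem PE.secure (hn : 1 ≤ n) (h : MSDHS 𝒢 n) : (PE.scheme n 𝒢 F).Secure := by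
  intro A
  obtain ⟨c, hc, hsolve⟩ := PE.exists_isSolver (𝒢 := 𝒢) hn F
  obtain ⟨d, hd, hdspec⟩ := PE.polyKernel_reduction (𝒢 := 𝒢) (F := F) A hc
  obtain ⟨P, hP⟩ := exists_length_le F.dom (PolyFun.dom PolyFun.self)
  obtain ⟨Q, hQ⟩ := exists_length_le F.msg (PolyFun.msg PolyFun.self)
  have hbound : ∀ lam, (PE.scheme n 𝒢 F).verExp A lam true ≤
      ((F.dom lam).length : ℝ≥0∞) * ((F.msg lam).length * msdhsGame 𝒢 n d lam true) +
        (F.dom lam).length * 𝒢.badProb lam := by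
    intro lam
    rw [PE.verExp_apply]
    change _ ≤ ((F.dom lam).length : ℝ≥0∞) * ((F.msg lam).length *
      (𝒢.sample lam).mean fun w => _) + (F.dom lam).length * (𝒢.sample lam).mean fun w => _
    rw [← PMF.mean_const_mul, ← PMF.mean_const_mul, ← PMF.mean_const_mul, ← PMF.mean_add]
    refine PMF.mean_mono fun w hw => (PE.winProb_le A hn hsolve hw).trans (le_of_eq ?_)
    refine congrArg (fun x : ℝ≥0∞ => ((F.dom lam).length : ℝ≥0∞) * ((F.msg lam).length * x) +
      (F.dom lam).length * (𝒢.inst w).badProb) (congrArg _ (funext fun s => ?_))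
    exact (congrArg (fun μ : PMF Val => μ.map (MSDHSInstance.mk lam w hw s).solves true)
      (hdspec ⟨lam, w, hw, s⟩)).symm
  have hneg := (((h d hd).polynomial_mul Q).polynomial_mul P).add
    (𝒢.negligible_badProb.polynomial_mul P)
  refine hneg.mono ?_
  filter_upwards [Filter.eventually_ge_atTop 2] with lam hlam
  have hb := 𝒢.badProb_ne_top hlam
  have hm := PMF.apply_ne_top (msdhsGame 𝒢 n d lam) true
  rw [prTrue, abs_of_nonneg ENNReal.toReal_nonneg]
  refine (ENNReal.toReal_mono (by finiteness) (hbound lam)).trans ?_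
  rw [ENNReal.toReal_add (by finiteness) (by finiteness)]
  simp only [ENNReal.toReal_mul, ENNReal.toReal_natCast, prTrue]
  gcongr
  · exact hP lam
  · exact hQ lam
  · exact hP lam

end

/-! ### The number of operations of the client -/

section

theorem Counted.bind_ops {α β : Type} (x : Counted α) (f : α → Counted β) :
    (x >>= f).ops = x.ops + (f x.val).ops := rfl

theorem PE.encryptPowers_ops {K : ℕ} (Γ : MultilinearInstance K) (h : Γ.G 1)
    (l : List (ZMod Γ.N)) : ∀ a, (PE.encryptPowers Γ h a l).ops = 5 * l.length := by
  induction l with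
  | nil => exact fun a => rfl
  | cons r l ih =>
    intro a
    have : (PE.encryptPowers Γ h a (r :: l)).ops =
        1 + (1 + (1 + (1 + (1 + ((PE.encryptPowers Γ h (a * a) l).ops + 0))))) := rfl
    rw [this, ih, List.length_cons]
    ring

theorem PE.findLog_ops_le {G : Type} [Group G] (a b : G) (M : List ℕ) :
    (PE.findLog a b M).ops ≤ 2 * M.length := by
  classical
  induction M with
  | nil => exact le_rfl
  | cons m M ih =>
    unfold PE.findLog
    rw [Counted.bind_ops, Counted.bind_ops, List.length_cons]
    have : ∀ c : Bool, (if c = true then (pure (some m) : Counted (Option ℕ))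
        else PE.findLog a b M).ops ≤ 2 * M.length := by
      intro c
      split_ifs
      · exact Nat.zero_le _
      · exact ih
    have h1 := this (Counted.op (decide (b ^ m = a))).val
    change 1 + (1 + _) ≤ _
    exact (Nat.add_le_add_left (Nat.add_le_add_left (this _) 1) 1).trans (by omega)

theorem PE.verifyAlg_ops_le {K : ℕ} (Γ : MultilinearInstance K) (k : ℕ) (M : List ℕ)
    (s : ZMod Γ.N) (t : Γ.G 1) (α : ℕ) (ρ : Γ.G k) (π : Γ.G (k + k)) :
    (PE.verifyAlg Γ k M s t α ρ π).ops ≤ 2 * M.length + 12 := by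
  unfold PE.verifyAlg
  rw [Counted.bind_ops, Counted.bind_ops, Counted.bind_ops]
  have h := PE.findLog_ops_le (ρ ^ Γ.p) (Γ.g k ^ Γ.p) M
  change 1 + (1 + ((PE.findLog (ρ ^ Γ.p) (Γ.g k ^ Γ.p) M).ops + _)) ≤ _
  -- ten operations follow a successful search
  refine (Nat.add_le_add_left (Nat.add_le_add_left (Nat.add_le_add h (d := 10) ?_) 1) 1).trans
    (by omega)
  change Counted.ops (match (PE.findLog (ρ ^ Γ.p) (Γ.g k ^ Γ.p) M).val with
    | none => _
    | some y => _) ≤ _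
  rcases (PE.findLog (ρ ^ Γ.p) (Γ.g k ^ Γ.p) M).val with _ | y
  · exact Nat.zero_le _
  · exact le_rfl

theorem hornerLoop_ops (f : ℕ[X]) (m : ℕ) (a : ZMod m) (d : ℕ) :
    ∀ acc, (hornerLoop f m a d acc).ops = 2 * d := by
  induction d with
  | zero => exact fun _ => rfl
  | succ d ih =>
    intro acc
    have : (hornerLoop f m a (d + 1) acc).ops =
        1 + (1 + (hornerLoop f m a d (acc * a + (f.coeff d : ZMod m))).ops) := rfl
    rw [this, ih]
    ring

variable {n : ℕ} {𝒢 : MultilinearGenerator (2 * logDeg n + 1)} {F : PolyFamily n}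

theorem PE.ops_le (pk : PE.PublicKey 𝒢) (sk : PE.SecretKey pk) (x : ℕ)
    {c : Counted (List (pk.inst.G 1) × ℕ)}
    (hc : c ∈ ((PE.scheme n 𝒢 F).probGen pk sk x).support) (ρ : pk.inst.G (logDeg n))
    (π : pk.inst.G (logDeg n + logDeg n)) :
    c.ops + ((PE.scheme n 𝒢 F).verify pk sk c.val.2 ρ π).ops ≤
      5 * logDeg n + (2 * (F.msg pk.lam).length + 12) := by
  refine Nat.add_le_add ?_ (PE.verifyAlg_ops_le _ _ _ _ _ _ _ _)
  obtain ⟨r, -, hr⟩ := (PMF.mem_support_bind_iff _ _ _).1 hc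
  rw [PMF.mem_support_pure_iff] at hr
  rw [hr]
  change (PE.encryptPowers pk.inst pk.h x (List.ofFn r)).ops + 0 ≤ _
  rw [PE.encryptPowers_ops, List.length_ofFn, add_zero]

theorem PE.lam_eq_of_mem_keyGen {lam : ℕ} {key : Σ pk : PE.PublicKey 𝒢, PE.SecretKey pk}
    (h : key ∈ ((PE.scheme n 𝒢 F).keyGen lam).support) : key.1.lam = lam := by
  obtain ⟨w, -, h⟩ := (PMF.mem_support_bind_iff _ _ _).1 h
  obtain ⟨s, -, h⟩ := (PMF.mem_support_bind_iff _ _ _).1 h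
  obtain ⟨u, -, h⟩ := (PMF.mem_support_bind_iff _ _ _).1 h
  rw [(PMF.mem_support_pure_iff _ _).1 h]

theorem logDeg_le (n : ℕ) : (logDeg n : ℝ) ≤ Real.logb 2 (n + 1) + 1 := by
  have h := Real.ceil_logb_natCast (b := 2) (r := ((n + 1 : ℕ) : ℝ)) (by positivity)
  have h' : (⌈Real.logb 2 ((n + 1 : ℕ) : ℝ)⌉ : ℝ) < Real.logb 2 ((n + 1 : ℕ) : ℝ) + 1 :=
    Int.ceil_lt_add_one _
  have h'' : (logDeg n : ℤ) = ⌈Real.logb 2 ((n + 1 : ℕ) : ℝ)⌉ := by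
    rw [logDeg, ← Int.clog_natCast (R := ℝ)]
    exact_mod_cast h.symm
  rw [← h''] at h'
  push_cast at h'
  exact h'.le

theorem PE.clientOpsAtMost (hn : 1 ≤ n) (lam : ℕ) : (PE.scheme n 𝒢 F).ClientOpsAtMost lam
    (22 * (Real.logb 2 (n + 1) + (F.msg lam).length)) := by
  intro key hkey x _ c hc ρ π
  have h := PE.ops_le (F := F) key.1 key.2 x hc ρ π
  rw [PE.lam_eq_of_mem_keyGen hkey] at h
  have hlog : 1 ≤ Real.logb 2 (n + 1 : ℝ) := by
    rw [Real.le_logb_iff_rpow_le one_lt_two (by positivity), Real.rpow_one]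
    have : (1 : ℝ) ≤ n := by exact_mod_cast hn
    linarith
  have h' := (Nat.cast_le (α := ℝ)).2 h
  push_cast at h' ⊢
  have := logDeg_le n
  have : (0 : ℝ) ≤ (F.msg lam).length := Nat.cast_nonneg _
  -- `5 k + 12 ≤ 5 L + 17 ≤ 22 L` for `L = log₂ (n + 1) ≥ 1`
  refine h'.trans ?_
  linarith

/-- The client's work is logarithmic, and so eventually less than any fraction of the linear
work of Horner's rule. -/
theorem exists_logb_le (ε : ℝ) (hε : 0 < ε) (B : ℕ) : ∃ n₀ : ℕ, ∀ n : ℕ, n₀ ≤ n →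
    1 ≤ n ∧ 22 * (Real.logb 2 (n + 1) + B) ≤ ε * (2 * n) := by
  have h1 : Filter.Tendsto (fun n : ℕ => ((n : ℝ) + 1)) Filter.atTop Filter.atTop :=
    tendsto_natCast_atTop_atTop.atTop_add tendsto_const_nhds
  -- `22 L` takes at most `ε (n + 1) / 2`, which leaves `ε (3 n - 1) / 2` for the constant `22 B`
  have hlog : ∀ᶠ n : ℕ in Filter.atTop,
      ‖Real.log ((n : ℝ) + 1)‖ ≤ ε * Real.log 2 / 44 * ‖(n : ℝ) + 1‖ :=
    h1.eventually (Real.isLittleO_log_id_atTop.bound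
      (by have := Real.log_pos one_lt_two; positivity))
  have hlin : ∀ᶠ n : ℕ in Filter.atTop, (22 * B + ε / 2) / (3 / 2 * ε) ≤ (n : ℝ) :=
    tendsto_natCast_atTop_atTop.eventually_ge_atTop _
  obtain ⟨n₀, h⟩ := Filter.eventually_atTop.1 (hlog.and (hlin.and (Filter.eventually_ge_atTop 1)))
  refine ⟨n₀, fun n hn => ⟨(h n hn).2.2, ?_⟩⟩
  obtain ⟨ha, hb, -⟩ := h n hn
  have h2 := Real.log_pos one_lt_two
  rw [Real.norm_of_nonneg (Real.log_nonneg (by linarith [Nat.cast_nonneg (α := ℝ) n])),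
    Real.norm_of_nonneg (by positivity)] at ha
  have hc : Real.logb 2 (n + 1) ≤ ε / 44 * (n + 1) := by
    rw [Real.logb, div_le_iff₀ h2]
    linarith
  rw [div_le_iff₀ (by positivity)] at hb
  linarith

end
theorem mainTheorem1 :
    (∀ (n : ℕ), 1 ≤ n → ∀ (𝒢 : MultilinearGenerator (2 * logDeg n + 1)) (F : PolyFamily n),
      F.Admissible 𝒢 → MSDHS 𝒢 n → SDA 𝒢 →
        (PE.scheme n 𝒢 F).Correct ∧ (PE.scheme n 𝒢 F).Secure ∧
          (PE.scheme n 𝒢 F).InputPrivate) ∧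
    (∃ C : ℝ, ∀ (n : ℕ), 1 ≤ n →
      ∀ (𝒢 : MultilinearGenerator (2 * logDeg n + 1)) (F : PolyFamily n) (lam : ℕ),
        (PE.scheme n 𝒢 F).ClientOpsAtMost lam
          (C * (Real.logb 2 (n + 1) + (F.msg lam).length))) ∧
    (∀ ε : ℝ, 0 < ε → ∀ B : ℕ, ∃ n₀ : ℕ, ∀ (n : ℕ), n₀ ≤ n →
      ∀ (𝒢 : MultilinearGenerator (2 * logDeg n + 1)) (F : PolyFamily n) (lam : ℕ),
        (F.poly lam).natDegree = n → (F.msg lam).length ≤ B →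
          ∀ (m : ℕ) (a : ZMod m),
            (PE.scheme n 𝒢 F).ClientOpsAtMost lam (ε * (horner (F.poly lam) m a).ops)) := by
  refine ⟨fun n hn 𝒢 F hF hM hS => ⟨PE.correct hn hF, PE.secure hn hM, PE.inputPrivate hS⟩,
    ⟨22, fun n hn 𝒢 F lam => PE.clientOpsAtMost hn lam⟩, fun ε hε B => ?_⟩
  obtain ⟨n₀, h⟩ := exists_logb_le ε hε B
  refine ⟨n₀, fun n hn 𝒢 F lam hdeg hlen m a key hkey x hx c hc ρ π => ?_⟩
  obtain ⟨hn1, hle⟩ := h n hn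
  refine (PE.clientOpsAtMost hn1 lam key hkey x hx c hc ρ π).trans ?_
  have hB : ((F.msg lam).length : ℝ) ≤ B := Nat.cast_le.2 hlen
  rw [horner, hornerLoop_ops, hdeg]
  push_cast
  linarith

end
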